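/- Let $f_1,\dots,f_s\in\mathbb{C}[z_1,\dots,z_n]$ generate a prime ideal $I_X$, let $X=V(I_X)\subseteq\mathbb{V}=\mathbb{C}^n$ be the corresponding irreducible variety, $c=n-\dim X$ its codimension, $J(f)$ the Jacobian matrix, $I_{X_{\mathrm{sing}}}=I_X+\langle c\text{-minors of }J(f)\rangle$ and $X_{\mathrm{reg}}=X\setminus V(I_{X_{\mathrm{sing}}})$. Let $\overline X$ be the complex conjugate variety of $X$ and $X_\circ=X_{\mathrm{reg}}\times\overline{X}_{\mathrm{reg}}$. On $\mathbb{C}[\mathbf z,\mathbf w,\mathbf u,\mathbf v]$ (four blocks of $n$ variables) let $*$ be the ring map that conjugates the coefficients and exchanges $z_k\leftrightarrow w_k$, $u_k\leftrightarrow v_k$. Let $I'_X$ be the ideal of the $(c+1)$-minors of the $(s+1)\times n$ matrix with rows $\mathbf v-\mathbf w$ and $J_{\mathbf z}(f)$. The Hermitian critical ideal is the saturation $$\left(I_X+(I_X)^*+I'_X+(I'_X)^*\right):\left(I_{X_{\mathrm{sing}}}\cdot (I_{X_{\mathrm{sing}}})^*\right)^\infty ,$$ and its zero set in $\mathbb{V}^2\times\mathbb{V}^2$,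 with coordinates $((\mathbf z,\mathbf w),(\mathbf u,\mathbf v))$, is the vHD correspondence $\mathcal{VH}_X$. For fixed $(\mathbf u,\mathbf v)\in\mathbb{V}^2$ the same formula defines an ideal of $\mathbb{C}[\mathbf z,\mathbf w]$, the Hermitian critical ideal of $(\mathbf u,\mathbf v)$; $\mathrm{vHD}(X)$ is the number of points of its zero set for all $(\mathbf u,\mathbf v)$ in a suitable dense Zariski open subset of $\mathbb{V}^2$. Finally let $q_{\mathbf u}(\mathbf z)=\sum_k|u_k-z_k|^2$; a critical point of $q_{\mathbf u}$ is a point $\mathbf z\in X_{\mathrm{reg}}$ at which the real differential of $q_{\mathbf u}$ vanishes on the tangent space $T_{\mathbf z}X$, and $\mathrm{HD}(X)\subseteq\mathbb{N}$ is the set of all $N$ for which there is a nonempty (Euclidean) open set of points $\mathbf u\in\mathbb{V}$ such that $q_{\mathbf u}$ has exactly $N$ critical points. Then the following hold. 1. $\mathcal{VH}_X\subseteq X\times\overline X\times\mathbb{V}^2$, and $\mathcal{VH}_X$ is an irreducible variety of dimension $2n$. 2. Over $X_\circ\subseteq X\times\overline X$, the projection $\pi_{X\times\overline X}\colon\mathcal{VH}_X\to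 X\times\overline X$ is an algebraic vector bundle of rank $2c$: its fibre over $(\mathbf z,\mathbf w)$ is a $2c$-dimensional affine subspace of $\mathbb{V}^2$ through $(\mathbf u,\mathbf v)=(\mathbf z,\mathbf w)$, which is taken as the origin of the fibre, and these vector spaces are Zariski locally trivial over $X_\circ$. 3. The projection $\pi_{\mathbb{V}^2}\colon\mathcal{VH}_X\to\mathbb{V}^2$, $((\mathbf z,\mathbf w),(\mathbf u,\mathbf v))\mapsto(\mathbf u,\mathbf v)$, is dominant; $\mathrm{vHD}(X)$ is well defined; and for all $(\mathbf u,\mathbf v)$ in a nonempty Zariski open subset of $\mathbb{V}^2$ the fibre $\pi_{\mathbb{V}^2}^{-1}(\mathbf u,\mathbf v)$ has exactly $\mathrm{vHD}(X)$ points. 4. $\mathrm{HD}(X)$ is nonempty and $\min\mathrm{HD}(X)>0$. -/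

import Mathlib

open Topology

noncomputable section

namespace HermitianDistance

/-! ## Classical algebraic geometry in complex affine space -/

section AffineGeometry

variable {σ τ : Type}

/-- Zariski closed subsets of the affine space with coordinates indexed by `σ`. -/
def IsZariskiClosed (Z : Set (σ → ℂ)) : Prop :=
  ∃ I : Ideal (MvPolynomial σ ℂ), Z = MvPolynomial.zeroLocus ℂ I

/-- Zariski open subsets of affine space. -/
def IsZariskiOpen (U : Set (σ → ℂ)) : Prop := IsZariskiClosed Uᶜ

/-- The Zariski closure of a set of points. -/
def zariskiClosure (S : Set (σ → ℂ)) : Set (σ → ℂ) :=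
  MvPolynomial.zeroLocus ℂ (MvPolynomial.vanishingIdeal ℂ S)

/-- An irreducible (closed) subvariety of affine space: a nonempty Zariski closed set that is not
covered by two Zariski closed sets unless one of them already contains it. -/
def IsIrreducibleVariety (Z : Set (σ → ℂ)) : Prop :=
  IsZariskiClosed Z ∧ Z.Nonempty ∧
    ∀ A B : Set (σ → ℂ), IsZariskiClosed A → IsZariskiClosed B → Z ⊆ A ∪ B → Z ⊆ A ∨ Z ⊆ B

/-- The dimension of a set of points: the Krull dimension of its coordinate ring. -/
def dimension (Z : Set (σ → ℂ)) : WithBot ℕ∞ :=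
  ringKrullDim (MvPolynomial σ ℂ ⧸ MvPolynomial.vanishingIdeal ℂ Z)

/-- Regular functions on a subset of affine space: locally quotients of polynomials. -/
def IsRegularFunctionOn (S : Set (σ → ℂ)) (f : (σ → ℂ) → ℂ) : Prop :=
  ∀ p ∈ S, ∃ g h : MvPolynomial σ ℂ, MvPolynomial.eval p h ≠ 0 ∧
    ∀ x ∈ S, MvPolynomial.eval x h ≠ 0 → f x = MvPolynomial.eval x g / MvPolynomial.eval x h

/-- Maps all of whose coordinates are regular functions. -/
def IsRegularMapOn {ι : Type} (S : Set (σ → ℂ)) (f : (σ → ℂ) → (ι → ℂ)) : Prop :=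
  ∀ i, IsRegularFunctionOn S (fun x => f x i)

/-- `E`, a set of pairs `(x, y)`, is via `(x, y) ↦ x` an algebraic vector bundle of rank `r` over
`B` with zero section `x ↦ (x, zero x)`. Each fibre over `x` has to be a translate by `zero x` of a
linear subspace of the `y`-space, from which it gets its vector space structure with origin
`zero x`. Zariski locally on `B`, with `U` open, the map `(x, t) ↦ (x, zero x + φ x t)` is an
isomorphism of varieties from `(B ∩ U) × ℂ^r` onto the part of `E` over `U`, linear on fibres; its
inverse is `(x, y) ↦ (x, ψ (x, y))`. -/
structure IsAlgebraicVectorBundle (B : Set (σ → ℂ)) (E : Set (σ ⊕ τ → ℂ))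
    (zero : (σ → ℂ) → (τ → ℂ)) (r : ℕ) : Prop where
  proj_mem : ∀ x y, Sum.elim x y ∈ E → x ∈ B
  locally_trivial : ∀ x₀ ∈ B, ∃ U : Set (σ → ℂ), IsZariskiOpen U ∧ x₀ ∈ U ∧
    ∃ (φ : (σ → ℂ) → ((Fin r → ℂ) →ₗ[ℂ] (τ → ℂ))) (ψ : (σ ⊕ τ → ℂ) → (Fin r → ℂ)),
      IsRegularMapOn {p : σ ⊕ Fin r → ℂ | p ∘ Sum.inl ∈ B ∩ U}
        (fun p => zero (p ∘ Sum.inl) + φ (p ∘ Sum.inl) (p ∘ Sum.inr)) ∧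
      IsRegularMapOn {p : σ ⊕ τ → ℂ | p ∈ E ∧ p ∘ Sum.inl ∈ U} ψ ∧
      (∀ x ∈ B ∩ U, ∀ t, Sum.elim x (zero x + φ x t) ∈ E ∧
        ψ (Sum.elim x (zero x + φ x t)) = t) ∧
      (∀ x ∈ B ∩ U, ∀ y, Sum.elim x y ∈ E → zero x + φ x (ψ (Sum.elim x y)) = y)

end AffineGeometry

/-! ## Ideals of minors and saturations -/

/-- The ideal generated by the `k`-minors of a matrix. Repeated rows or columns contribute only the
zero minor, and reorderings only change signs. The `0`-minor is `1`. -/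
def minorsIdeal {R : Type} [CommRing R] {ι κ : Type} (k : ℕ) (M : Matrix ι κ R) : Ideal R :=
  Ideal.span {d | ∃ (a : Fin k → ι) (b : Fin k → κ), d = (M.submatrix a b).det}

/-- The saturation `I : J^∞`, the union of the ascending chain of the colon ideals `I : J ^ k`. -/
def saturation {R : Type} [CommRing R] (I J : Ideal R) : Ideal R :=
  ⨆ k : ℕ, Submodule.colon I ((J ^ k : Ideal R) : Set R)

/-! ## The variables `z, w, u, v` -/

/-- Indices of the coordinates of `𝕍² = ℂⁿ × ℂⁿ`. Of a pair `(z, w)`, or `(u, v)`, the first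
vector has the indices `Sum.inl i` and the second one the indices `Sum.inr i`. -/
abbrev PairIdx (n : ℕ) : Type := Fin n ⊕ Fin n

/-- Indices of the coordinates of `𝕍² × 𝕍²`, whose points are `((z, w), (u, v))`. -/
abbrev QuadIdx (n : ℕ) : Type := PairIdx n ⊕ PairIdx n

/-- The ring `ℂ[z]`. -/
abbrev RingZ (n : ℕ) : Type := MvPolynomial (Fin n) ℂ

/-- The ring `ℂ[z, w]`. -/
abbrev RingZW (n : ℕ) : Type := MvPolynomial (PairIdx n) ℂ

/-- The ring `ℂ[z, w, u, v]`. -/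
abbrev RingZWUV (n : ℕ) : Type := MvPolynomial (QuadIdx n) ℂ

section Variables

variable {n : ℕ}

def zVar (i : Fin n) : RingZWUV n := MvPolynomial.X (Sum.inl (Sum.inl i))
def wVar (i : Fin n) : RingZWUV n := MvPolynomial.X (Sum.inl (Sum.inr i))
def uVar (i : Fin n) : RingZWUV n := MvPolynomial.X (Sum.inr (Sum.inl i))
def vVar (i : Fin n) : RingZWUV n := MvPolynomial.X (Sum.inr (Sum.inr i))

/-- The inclusion `ℂ[z] ⊆ ℂ[z, w, u, v]`. -/
def inclZ : RingZ n →+* RingZWUV n :=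
  (MvPolynomial.rename (fun i : Fin n => (Sum.inl (Sum.inl i) : QuadIdx n))).toRingHom

/-- The map `∗` on `ℂ[z, w, u, v]`: it conjugates the coefficients and exchanges `z` with `w` and
`u` with `v`. -/
def conjMap : RingZWUV n →+* RingZWUV n :=
  MvPolynomial.eval₂Hom (MvPolynomial.C.comp (starRingEnd ℂ))
    (fun i : QuadIdx n => MvPolynomial.X (Sum.map Sum.swap Sum.swap i))

/-- Substituting the point `(u, v)` of `𝕍²` for the variables `u, v`. -/
def specialize (uv : PairIdx n → ℂ) : RingZWUV n →+* RingZW n :=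
  (MvPolynomial.aeval
    (Sum.elim (fun i : PairIdx n => (MvPolynomial.X i : RingZW n))
      (fun i => MvPolynomial.C (uv i)))).toRingHom

end Variables

/-! ## The Hermitian critical ideal and the vHD correspondence -/

section HermitianCriticalIdeal

variable {n s : ℕ} (f : Fin s → RingZ n) (c : ℕ)

/-- The ideal `I_X = ⟨f₁, …, f_s⟩`. -/
def idealX : Ideal (RingZ n) := Ideal.span (Set.range f)

/-- The variety `X = V(I_X)` in `𝕍 = ℂⁿ`. -/
def varX : Set (Fin n → ℂ) := MvPolynomial.zeroLocus ℂ (idealX f)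

/-- The Jacobian matrix `J(f)`. -/
def jacobian : Matrix (Fin s) (Fin n) (RingZ n) :=
  Matrix.of fun i j => MvPolynomial.pderiv j (f i)

/-- The ideal of the singular locus, `I_X + ⟨c-minors of J(f)⟩`, where `c` is the codimension. -/
def singIdeal : Ideal (RingZ n) := idealX f ⊔ minorsIdeal c (jacobian f)

/-- The regular locus of `X`. -/
def regX : Set (Fin n → ℂ) := varX f \ MvPolynomial.zeroLocus ℂ (singIdeal f c)

/-- The matrix with the row `v - w` on top of the Jacobian matrix `J_z(f)`. -/
def augmentedJacobian : Matrix (Fin (s + 1)) (Fin n) (RingZWUV n) :=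
  Matrix.of (Fin.cons (fun j => vVar j - wVar j) (fun i j => inclZ (jacobian f i j)))

/-- The ideal `I'_X` of the `(c+1)`-minors of the augmented Jacobian matrix. -/
def rankIdeal : Ideal (RingZWUV n) := minorsIdeal (c + 1) (augmentedJacobian f)

/-- `I_X + (I_X)∗ + I'_X + (I'_X)∗`. -/
def preCriticalIdeal : Ideal (RingZWUV n) :=
  (idealX f).map inclZ ⊔ ((idealX f).map inclZ).map conjMap ⊔
    rankIdeal f c ⊔ (rankIdeal f c).map conjMap

/-- `I_{X_sing} · (I_{X_sing})∗`. -/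
def singProductIdeal : Ideal (RingZWUV n) :=
  (singIdeal f c).map inclZ * ((singIdeal f c).map inclZ).map conjMap

/-- The Hermitian critical ideal in `ℂ[z, w, u, v]`. -/
def hermitianCriticalIdeal : Ideal (RingZWUV n) :=
  saturation (preCriticalIdeal f c) (singProductIdeal f c)

/-- The vHD correspondence: the zero set in `𝕍² × 𝕍²` of the Hermitian critical ideal. -/
def vHDCorrespondence : Set (QuadIdx n → ℂ) :=
  MvPolynomial.zeroLocus ℂ (hermitianCriticalIdeal f c)

/-- The Hermitian critical ideal of a given point `(u, v)` of `𝕍²`, an ideal of `ℂ[z, w]`. -/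
def hermitianCriticalIdealAt (uv : PairIdx n → ℂ) : Ideal (RingZW n) :=
  saturation ((preCriticalIdeal f c).map (specialize uv))
    ((singProductIdeal f c).map (specialize uv))

/-- `N` is the number of solutions `(z, w)` of the Hermitian critical ideal of `(u, v)` for all
points `(u, v)` of a dense (that is, nonempty) Zariski open subset of `𝕍²`. -/
def IsGenericSolutionNumber (N : ℕ) : Prop :=
  ∃ U : Set (PairIdx n → ℂ), IsZariskiOpen U ∧ U.Nonempty ∧
    ∀ uv ∈ U, (MvPolynomial.zeroLocus ℂ (hermitianCriticalIdealAt f c uv)).encard = N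

/-- The virtual Hermitian Distance degree `vHD(X)`: the generic number of solutions of the
Hermitian critical ideal of `(u, v)` (with the junk value `0` if there were no such number). -/
def vHD : ℕ := sInf {N | IsGenericSolutionNumber f c N}

/-- The product `X × X̄`, where `X̄` is the conjugate variety. -/
def prodX : Set (PairIdx n → ℂ) :=
  {zw | zw ∘ Sum.inl ∈ varX f ∧ (fun i => starRingEnd ℂ (zw (Sum.inr i))) ∈ varX f}

/-- The product `X_∘ = X_reg × X̄_reg` of the regular loci. -/
def prodReg : Set (PairIdx n → ℂ) :=
  {zw | zw ∘ Sum.inl ∈ regX f c ∧ (fun i => starRingEnd ℂ (zw (Sum.inr i))) ∈ regX f c}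

/-- The part of the vHD correspondence that lies over `X_∘`. -/
def vHDCorrespondenceReg : Set (QuadIdx n → ℂ) :=
  {p | p ∈ vHDCorrespondence f c ∧ p ∘ Sum.inl ∈ prodReg f c}

/-- The fibre over `(u, v)` of the projection of the vHD correspondence to the second `𝕍²`. -/
def vHDFibre (uv : PairIdx n → ℂ) : Set (QuadIdx n → ℂ) :=
  {p | p ∈ vHDCorrespondence f c ∧ p ∘ Sum.inr = uv}

/-! ## Critical points of the Hermitian distance function -/

/-- The squared Hermitian distance function `q_u(z) = ∑ |u_i - z_i|²`. -/
def sqDist (u z : Fin n → ℂ) : ℝ := ∑ i, ‖u i - z i‖ ^ 2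

/-- The tangent space `T_z X`. -/
def tangentSpace (z : Fin n → ℂ) : Set (Fin n → ℂ) :=
  {t | ∀ i, ∑ j, MvPolynomial.eval z (jacobian f i j) * t j = 0}

/-- The critical points of `q_u` on `X_reg`: the real differential of `q_u` vanishes on `T_z X`. -/
def criticalPoints (u : Fin n → ℂ) : Set (Fin n → ℂ) :=
  {z | z ∈ regX f c ∧ ∀ t ∈ tangentSpace f z, fderiv ℝ (sqDist u) z t = 0}

/-- The Hermitian Distance degree `HD(X)`: the set of those natural numbers that are the number of
critical points of `q_u` for all `u` in some nonempty open subset of `𝕍`. -/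
def HD : Set ℕ :=
  {N | ∃ O : Set (Fin n → ℂ), IsOpen O ∧ O.Nonempty ∧
    ∀ u ∈ O, (criticalPoints f c u).encard = N}

end HermitianCriticalIdeal

end HermitianDistance

end

open HermitianDistance

/-! Over `X_∘` the correspondence is linear. There the Jacobian has rank exactly `c` at `z` and at
the conjugate of `w`, so the minors say that `v - w` lies in the row space at `z` and the conjugate
of `u - z` in the row space at `w̄`. These conditions define `critSet`, whose fibres over `X_∘` have
dimension `2c`. The zero set of a saturation is the Zariski closure of the first zero set minus the
second one, hence the correspondence is the closure of `critSet`. It is irreducible because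
`critSet` is a polynomial image of `X_reg × X̄_reg × ℂ^(2s)`.

Most local statements rest on `trdeg_le_and_exists_section`: an isolated point of a fibre of a
polynomial map from an irreducible variety to `ℂ^m` forces dimension at most `m`, and in dimension
`m` the map has a section through that point, continuous at its image. Zariski's main theorem
reduces this to finite maps, where one follows a smallest root of a minimal polynomial. It yields
that the Jacobian has rank at most `c` on `X` (`rank_jacAt_le`), that tangent vectors at regular
points are velocities of curves (`exists_curve`), and that the correspondence has dimension at most
`2n`. That the rank `c` is attained follows from derivations of the function field
(`card_le_trdeg_add_rank`).

The metric enters through the points `(z, z̄, u, ū)`, which lie in `critSet` exactly when `z` is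
critical for `q_u`. Nearest points exist, and a regular nearest point is critical. For `u` close to
a regular point its nearest points are regular, so the image in `𝕍²` contains all `(u, ū)` with `u`
in an open set, and these are Zariski dense. This is dominance; it also gives dimension at least
`2n`. The projection is then generically finite, a primitive element counts its fibres
(`exists_generic_encard`), and generic fibres lie over `X_∘`, where they agree with the zero sets of
the specialised ideals.

Critical points over a generic `u` extend to continuous families (`exists_criticalPoint_sections`).
Their number is therefore lower semicontinuous there, and it is bounded, so its maximum is taken on
an open set and `HD(X)` is nonempty. For positivity it is enough that nearest points are not
confined to a proper subvariety `Y` over an open set of `u` (`interior_setOf_isNearest_eq_empty`).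
If they were, then at a suitable regular point `z` of `Y` one could translate `u` by small `x - z`
normal to `Y`, with `x` in `X`, and `z` would remain nearest. Comparison with `x` itself bounds a
real part of a linear form on the slice of `X` normal to `Y`, while a section over that slice makes
this form positive. -/

namespace HermitianDistance

/-! ## Dimension and transcendence degree -/

/-- The Krull dimension does not change under integral extensions of normal domains. -/
theorem ringKrullDim_eq_of_isIntegral {R A : Type} [CommRing R] [IsDomain R]
    [IsIntegrallyClosed R] [CommRing A] [IsDomain A] [Algebra R A] [FaithfulSMul R A]
    [Algebra.IsIntegral R A] : ringKrullDim A = ringKrullDim R := by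
  apply le_antisymm
  -- Incomparability: primes in a chain stay distinct after contraction.
  · refine Order.krullDim_le_of_strictMono (PrimeSpectrum.comap (algebraMap R A)) ?_
    intro p q hpq
    obtain ⟨x, hx, hx'⟩ := SetLike.exists_of_lt (show p.asIdeal < q.asIdeal from hpq)
    exact Ideal.comap_lt_comap_of_integral_mem_sdiff (le_of_lt hpq) ⟨hx, hx'⟩
      (Algebra.IsIntegral.isIntegral x)
  -- Lying over lifts the top of a chain, and going down, which needs normality of `R`, lifts the
  -- rest.
  · refine iSup_le fun l => ?_
    obtain ⟨Q, hQ, hQl⟩ := Ideal.exists_ideal_over_prime_of_isIntegral_of_isDomain (S := A)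
      l.last.asIdeal (by
        simp [(RingHom.injective_iff_ker_eq_bot _).mp (FaithfulSMul.algebraMap_injective R A)])
    have : Q.LiesOver l.last.asIdeal := ⟨hQl.symm⟩
    obtain ⟨L, hL, -, -⟩ := Ideal.exists_ltSeries_of_hasGoingDown l Q
    rw [← hL]
    exact Order.LTSeries.length_le_krullDim L

/-- The dimension of a finitely generated domain over a field is its transcendence degree. -/
theorem exists_ringKrullDim_eq_trdeg (k A : Type) [Field k] [CommRing A] [IsDomain A]
    [Algebra k A] [Algebra.FiniteType k A] :
    ∃ d : ℕ, ringKrullDim A = d ∧ Algebra.trdeg k A = d := by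
  obtain ⟨s, g, hg, hfin⟩ := exists_finite_inj_algHom_of_fg k A
  algebraize [g.toRingHom]
  have : IsScalarTower k (MvPolynomial (Fin s) k) A := .of_algebraMap_eq' g.comp_algebraMap.symm
  have : FaithfulSMul (MvPolynomial (Fin s) k) A :=
    (faithfulSMul_iff_algebraMap_injective _ _).2 hg
  have hfin' : Module.Finite (MvPolynomial (Fin s) k) A := hfin
  refine ⟨s, ?_, ?_⟩
  · rw [ringKrullDim_eq_of_isIntegral (R := MvPolynomial (Fin s) k),
      MvPolynomial.ringKrullDim_of_isNoetherianRing]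
    simp [ringKrullDim_eq_zero_of_field]
  · rw [← trdeg_add_eq k (MvPolynomial (Fin s) k) (A := A),
      trdeg_eq_zero (R := MvPolynomial (Fin s) k) (A := A)]
    simp

/-! ## Extending points -/

/-- A ring homomorphism to `ℂ` extends along integral extensions. -/
theorem exists_ringHom_extension {R A : Type} [CommRing R] [CommRing A] [Algebra R A]
    [Algebra.IsIntegral R A] (hinj : Function.Injective (algebraMap R A)) (ρ : R →+* ℂ)
    (hρ : Function.Surjective ρ) : ∃ x : A →+* ℂ, x.comp (algebraMap R A) = ρ := by
  have hmax : (RingHom.ker ρ).IsMaximal := RingHom.ker_isMaximal_of_surjective ρ hρ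
  obtain ⟨Q, hQ, hQP⟩ := Ideal.exists_ideal_over_maximal_of_isIntegral (S := A) (RingHom.ker ρ) (by
    simp [(RingHom.injective_iff_ker_eq_bot _).mp hinj])
  let : Field (A ⧸ Q) := Ideal.Quotient.field Q
  let g : R →+* A ⧸ Q := (Ideal.Quotient.mk Q).comp (algebraMap R A)
  have hg : RingHom.ker ρ ≤ RingHom.ker g := by
    intro r hr
    rw [← hQP] at hr
    exact Ideal.Quotient.eq_zero_iff_mem.2 hr
  let h : ℂ →+* A ⧸ Q := (Ideal.Quotient.lift (RingHom.ker ρ) g hg).comp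
    (RingHom.quotientKerEquivOfSurjective hρ).symm.toRingHom
  have hh : ∀ r, h (ρ r) = g r := by
    intro r
    have : (RingHom.quotientKerEquivOfSurjective hρ).symm (ρ r) = Ideal.Quotient.mk _ r := by
      rw [RingEquiv.symm_apply_eq]; simp
    simp only [h, RingHom.comp_apply, RingEquiv.toRingHom_eq_coe, RingHom.coe_coe, this]
    exact Ideal.Quotient.lift_mk _ _ _
  have hcomp : h.comp ρ = g := RingHom.ext hh
  -- The residue field of a prime above `ker ρ` is integral over `ℂ`, hence equal to `ℂ`.
  have hint : h.IsIntegral := by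
    have : (h.comp ρ).IsIntegral := by
      rw [hcomp]
      exact RingHom.IsIntegral.trans _ _ (algebraMap_isIntegral_iff.2 inferInstance)
        (RingHom.isIntegral_of_surjective _ Ideal.Quotient.mk_surjective)
    exact RingHom.IsIntegral.tower_top _ _ this
  let e := RingEquiv.ofBijective h (IsAlgClosed.ringHom_bijective_of_isIntegral h hint)
  refine ⟨e.symm.toRingHom.comp (Ideal.Quotient.mk Q), RingHom.ext fun r => ?_⟩
  change e.symm (g r) = ρ r
  rw [RingEquiv.symm_apply_eq]
  exact (hh r).symm

/-- Over an integrally closed domain `R[y]` is `R[T]` modulo the minimal polynomial, so extending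
`ρ` to `R[y]` amounts to choosing a root of the specialised polynomial. -/
theorem exists_ringHom_adjoin {R A : Type} [CommRing R] [IsDomain R] [IsIntegrallyClosed R]
    [CommRing A] [IsDomain A] [Algebra R A] [FaithfulSMul R A] {y : A} (hy : IsIntegral R y)
    (ρ : R →+* ℂ) {η : ℂ} (hη : (minpoly R y).eval₂ ρ η = 0) :
    ∃ x : Algebra.adjoin R {y} →+* ℂ, x.comp (algebraMap R (Algebra.adjoin R {y})) = ρ ∧
      x ⟨y, Algebra.self_mem_adjoin_singleton R y⟩ = η := by
  let e := minpoly.equivAdjoin hy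
  let l : AdjoinRoot (minpoly R y) →+* ℂ := AdjoinRoot.lift ρ η hη
  refine ⟨l.comp e.symm.toRingEquiv.toRingHom, RingHom.ext fun r => ?_, ?_⟩
  · change l (e.symm (algebraMap _ _ r)) = ρ r
    rw [AlgEquiv.commutes]
    exact AdjoinRoot.lift_of hη
  · have : e.symm ⟨y, Algebra.self_mem_adjoin_singleton R y⟩ = AdjoinRoot.root _ := by
      rw [AlgEquiv.symm_apply_eq]
      ext
      simp [e]
    change l (e.symm _) = η
    rw [this]
    exact AdjoinRoot.lift_root hη

theorem exists_ringHom_of_root {R A : Type} [CommRing R] [IsDomain R] [IsIntegrallyClosed R]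
    [CommRing A] [IsDomain A] [Algebra R A] [FaithfulSMul R A] [Algebra.IsIntegral R A] (y : A)
    (ρ : R →+* ℂ) (hρ : Function.Surjective ρ) {η : ℂ} (hη : (minpoly R y).eval₂ ρ η = 0) :
    ∃ x : A →+* ℂ, x.comp (algebraMap R A) = ρ ∧ x y = η := by
  obtain ⟨x, hx, hxy⟩ := exists_ringHom_adjoin (Algebra.IsIntegral.isIntegral (R := R) y) ρ hη
  have : Algebra.IsIntegral (Algebra.adjoin R {y}) A := Algebra.IsIntegral.tower_top (R := R)
  obtain ⟨x', hx'⟩ := exists_ringHom_extension (A := A) (R := Algebra.adjoin R {y})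
    Subtype.val_injective x (by
      intro c
      obtain ⟨r, hr⟩ := hρ c
      exact ⟨algebraMap _ _ r, by rw [← hr, ← hx]; rfl⟩)
  refine ⟨x', ?_, ?_⟩
  · rw [← hx, ← hx', RingHom.comp_assoc]; rfl
  · rw [← hxy, ← hx']; rfl

/-- Ring homomorphisms to a field extend from a subring to a partial localization of it. -/
theorem exists_ringHom_extension_of_away {R A K : Type} [CommRing R] [CommRing A] [Algebra R A]
    [Field K] (S : Subalgebra R A) (r : S) (hS : ∀ a : A, ∃ m : ℕ, (r : A) ^ m * a ∈ S)
    (φ : S →+* K) (hr : φ r ≠ 0) : ∃ ψ : A →+* K, ∀ s : S, ψ s = φ s := by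
  choose m hm using hS
  let ψ : A → K := fun a => φ ⟨_, hm a⟩ / φ r ^ m a
  -- The exponent `m a` was an arbitrary choice; independence of it is what makes `ψ` additive and
  -- multiplicative.
  have key : ∀ (a : A) (k : ℕ) (h : (r : A) ^ k * a ∈ S), ψ a = φ ⟨_, h⟩ / φ r ^ k := by
    intro a k h
    rw [div_eq_div_iff (pow_ne_zero _ hr) (pow_ne_zero _ hr), ← map_pow, ← map_pow, ← map_mul,
      ← map_mul]
    congr 1
    ext
    simp only [MulMemClass.coe_mul, SubmonoidClass.coe_pow]
    ring
  have hadd : ∀ a b, ψ (a + b) = ψ a + ψ b := by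
    intro a b
    have ha : (r : A) ^ (m a + m b) * a ∈ S := by
      convert S.mul_mem (pow_mem r.2 (m b)) (hm a) using 1; ring
    have hb : (r : A) ^ (m a + m b) * b ∈ S := by
      convert S.mul_mem (pow_mem r.2 (m a)) (hm b) using 1; ring
    have hab : (r : A) ^ (m a + m b) * (a + b) ∈ S := by rw [mul_add]; exact S.add_mem ha hb
    rw [key _ _ ha, key _ _ hb, key _ _ hab, ← add_div, ← map_add]
    congr 2
    ext
    simp [mul_add]
  have hmul : ∀ a b, ψ (a * b) = ψ a * ψ b := by
    intro a b
    have hab : (r : A) ^ (m a + m b) * (a * b) ∈ S := by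
      convert S.mul_mem (hm a) (hm b) using 1; ring
    rw [key _ _ hab, key _ _ (hm a), key _ _ (hm b), div_mul_div_comm, ← map_mul,
      pow_add (φ r)]
    congr 2
    ext
    simp only [MulMemClass.coe_mul]
    ring
  have hS : ∀ s : S, ψ s = φ s := by
    intro s
    have h : (r : A) ^ 0 * s ∈ S := by simp
    rw [key _ 0 h, pow_zero (φ r), div_one]
    congr 1
    ext
    simp
  exact ⟨
    { toFun := ψ
      map_add' := hadd
      map_mul' := hmul
      map_one' := by simpa using hS 1
      map_zero' := by simpa using hS 0 }, hS⟩

/-! ## Sections of finite maps -/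

theorem pow_card_le_norm_prod (s : Multiset ℂ) {ε : ℝ} (hε : 0 ≤ ε) (h : ∀ η ∈ s, ε ≤ ‖η‖) :
    ε ^ Multiset.card s ≤ ‖s.prod‖ := by
  induction s using Multiset.induction with
  | empty => simp
  | cons a s ih =>
    rw [Multiset.card_cons, Multiset.prod_cons, norm_mul, pow_succ']
    exact mul_le_mul (h a (by simp)) (ih fun η hη => h η (by simp [hη])) (by positivity)
      (norm_nonneg _)

/-- Take a root of least norm: the product of all roots is the constant coefficient up to sign. -/
theorem exists_root_norm_pow_le (p : Polynomial ℂ) (hp : p.Monic) (h1 : p.natDegree ≠ 0) :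
    ∃ η, p.eval η = 0 ∧ ‖η‖ ^ p.natDegree ≤ ‖p.coeff 0‖ := by
  have hs := IsAlgClosed.splits p
  have hcard := hs.natDegree_eq_card_roots
  have hne : p.roots.toFinset.Nonempty := by
    rw [Multiset.toFinset_nonempty]
    intro h
    rw [h] at hcard
    simp [h1] at hcard
  obtain ⟨η, hη, hmin⟩ := p.roots.toFinset.exists_min_image (fun z => ‖z‖) hne
  rw [Multiset.mem_toFinset, Polynomial.mem_roots hp.ne_zero] at hη
  refine ⟨η, hη, ?_⟩
  have h := pow_card_le_norm_prod p.roots (norm_nonneg η)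
    fun z hz => hmin z (Multiset.mem_toFinset.2 hz)
  rw [← hcard] at h
  rw [hs.coeff_zero_eq_prod_roots_of_monic hp]
  simpa using h

theorem norm_root_le {p : Polynomial ℂ} (hp : p.Monic) {M : ℝ} (hM : 0 ≤ M)
    (h : ∀ i < p.natDegree, ‖p.coeff i‖ ≤ M) {z : ℂ} (hz : p.eval z = 0) : ‖z‖ ≤ M + 1 := by
  have h1 := Polynomial.IsRoot.norm_lt_cauchyBound hp.ne_zero (show p.IsRoot z from hz)
  have h2 : p.cauchyBound ≤ ⟨M, hM⟩ + 1 := by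
    unfold Polynomial.cauchyBound
    rw [hp.leadingCoeff]
    simp only [nnnorm_one, div_one]
    refine add_le_add ?_ le_rfl
    refine Finset.sup_le fun i hi => ?_
    exact h i (Finset.mem_range.1 hi)
  exact h1.le.trans (by exact_mod_cast h2)

section Sections

variable {τ : Type} {A : Type} [CommRing A] [Algebra (MvPolynomial τ ℂ) A]

theorem minpoly_eval_of_comp_eq {x : A →+* ℂ} {t : τ → ℂ}
    (hx : x.comp (algebraMap (MvPolynomial τ ℂ) A) = MvPolynomial.eval t) (a : A) :
    ((minpoly (MvPolynomial τ ℂ) a).map (MvPolynomial.eval t)).eval (x a) = 0 := by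
  rw [Polynomial.eval_map, ← hx, ← Polynomial.hom_eval₂]
  change x (Polynomial.aeval a _) = 0
  rw [minpoly.aeval, map_zero]

/-- The fibres of a finite map are finite. -/
theorem finite_fibre [Module.Finite (MvPolynomial τ ℂ) A] (t : τ → ℂ) :
    {x : A →+* ℂ | x.comp (algebraMap (MvPolynomial τ ℂ) A) = MvPolynomial.eval t}.Finite := by
  obtain ⟨s, hs⟩ := Module.Finite.fg_top (R := MvPolynomial τ ℂ) (M := A)
  apply Set.Finite.of_finite_image (f := fun x (a : s) => x a)
  · refine (Set.Finite.pi' (ι := s)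
      (t := fun a => {z | ((minpoly (MvPolynomial τ ℂ) (a : A)).map (MvPolynomial.eval t)).eval z = 0})
      fun a => ?_).subset ?_
    · refine (((minpoly (MvPolynomial τ ℂ) (a : A)).map
        (MvPolynomial.eval t)).rootSet_finite ℂ).subset fun z hz => ?_
      rw [Polynomial.mem_rootSet]
      exact ⟨((minpoly.monic (Algebra.IsIntegral.isIntegral _)).map _).ne_zero, by simpa using hz⟩
    · rintro _ ⟨x, hx, rfl⟩ a
      exact minpoly_eval_of_comp_eq hx _
  · intro x hx x' hx' h
    ext a
    have ha : a ∈ Submodule.span (MvPolynomial τ ℂ) (s : Set A) := by rw [hs]; trivial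
    have hr : ∀ r, x (algebraMap _ _ r) = x' (algebraMap _ _ r) := fun r => by
      have := congrArg (fun f => f r) (hx.trans hx'.symm)
      simpa using this
    induction ha using Submodule.span_induction with
    | mem a ha => exact congrFun h ⟨a, ha⟩
    | zero => simp
    | add a b _ _ ha hb => simp [ha, hb]
    | smul r a _ ha => simp [Algebra.smul_def, ha, hr]

/-- An element vanishing at one point of a fibre but not at the others. -/
theorem exists_separating [Module.Finite (MvPolynomial τ ℂ) A] {t : τ → ℂ} {x₀ : A →+* ℂ}
    (hx₀ : x₀.comp (algebraMap (MvPolynomial τ ℂ) A) = MvPolynomial.eval t) :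
    ∃ y, x₀ y = 0 ∧ ∀ x : A →+* ℂ,
      x.comp (algebraMap (MvPolynomial τ ℂ) A) = MvPolynomial.eval t → x y = 0 → x = x₀ := by
  classical
  have hfin := finite_fibre (A := A) t
  by_contra! hcon
  -- Prime avoidance: otherwise the kernel of `x₀` would lie in the kernel of another point of the
  -- finite fibre, and subtracting constants shows that the two points agree.
  have hsub : (RingHom.ker x₀ : Set A) ⊆
      ⋃ x ∈ (↑(hfin.toFinset.erase x₀) : Set (A →+* ℂ)), (RingHom.ker x : Set A) := by
    intro y hy
    obtain ⟨x, hx, hxy, hne⟩ := hcon y hy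
    simp only [Set.mem_iUnion]
    exact ⟨x, by simp [hx, hne], hxy⟩
  rw [Ideal.subset_union_prime x₀ x₀ fun i _ _ _ => RingHom.ker_isPrime i] at hsub
  obtain ⟨x, hx, hle⟩ := hsub
  simp only [Finset.mem_erase, Set.Finite.mem_toFinset, Set.mem_ofPred_eq] at hx
  refine hx.1 (RingHom.ext fun a => ?_)
  have hC : ∀ z : A →+* ℂ, z.comp (algebraMap (MvPolynomial τ ℂ) A) = MvPolynomial.eval t →
      z (algebraMap (MvPolynomial τ ℂ) A (MvPolynomial.C (x₀ a))) = x₀ a := fun z hz => by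
    have := congrArg (fun f => f (MvPolynomial.C (x₀ a))) hz
    simpa using this
  have h : a - algebraMap (MvPolynomial τ ℂ) A (MvPolynomial.C (x₀ a)) ∈ RingHom.ker x₀ := by
    rw [RingHom.mem_ker, map_sub, hC x₀ hx₀, sub_self]
  have h' := hle h
  rw [RingHom.mem_ker, map_sub, hC x hx.2, sub_eq_zero] at h'
  exact h'

/-- The values of an integral element stay bounded near a point of the base. -/
theorem eventually_norm_le_of_isIntegral {a : A} (ha : IsIntegral (MvPolynomial τ ℂ) a)
    (t₀ : τ → ℂ) : ∃ M : ℝ, ∀ᶠ t in 𝓝 t₀, ∀ x : A →+* ℂ,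
      x.comp (algebraMap (MvPolynomial τ ℂ) A) = MvPolynomial.eval t → ‖x a‖ ≤ M := by
  set p := minpoly (MvPolynomial τ ℂ) a with hp
  have hpm : p.Monic := minpoly.monic ha
  let M : (τ → ℂ) → ℝ := fun t => ∑ i ∈ Finset.range p.natDegree, ‖MvPolynomial.eval t (p.coeff i)‖
  have hMc : Continuous M := continuous_finsetSum _ fun i _ => (MvPolynomial.continuous_eval _).norm
  refine ⟨M t₀ + 1 + 1, ?_⟩
  have : ∀ᶠ t in 𝓝 t₀, M t < M t₀ + 1 := hMc.continuousAt.eventually_lt_const (lt_add_one _)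
  filter_upwards [this] with t ht x hx
  have h := norm_root_le (hpm.map (MvPolynomial.eval t)) (M := M t)
    (Finset.sum_nonneg fun _ _ => norm_nonneg _) ?_ (minpoly_eval_of_comp_eq hx a)
  · linarith
  · intro i hi
    rw [hpm.natDegree_map] at hi
    rw [Polynomial.coeff_map]
    exact Finset.single_le_sum (f := fun i => ‖MvPolynomial.eval t (p.coeff i)‖)
      (fun _ _ => norm_nonneg _) (Finset.mem_range.2 hi)

/-- A finite dominant map to affine space has a section through every point which is continuous
at that point. -/
theorem exists_section_of_finite [IsDomain A] [FaithfulSMul (MvPolynomial τ ℂ) A]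
    [Module.Finite (MvPolynomial τ ℂ) A] {t₀ : τ → ℂ} {x₀ : A →+* ℂ}
    (hx₀ : x₀.comp (algebraMap (MvPolynomial τ ℂ) A) = MvPolynomial.eval t₀) :
    ∃ x : (τ → ℂ) → (A →+* ℂ),
      (∀ t, (x t).comp (algebraMap (MvPolynomial τ ℂ) A) = MvPolynomial.eval t) ∧
      ∀ a, Filter.Tendsto (fun t => x t a) (𝓝 t₀) (𝓝 (x₀ a)) := by
  obtain ⟨y, hy0, hy⟩ := exists_separating hx₀
  set p := minpoly (MvPolynomial τ ℂ) y with hp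
  have hpm : p.Monic := minpoly.monic (Algebra.IsIntegral.isIntegral _)
  have hdeg : p.natDegree ≠ 0 :=
    (minpoly.natDegree_pos (Algebra.IsIntegral.isIntegral _)).ne'
  -- Over each `t` take a point at which `y` has the smallest possible value; it is controlled by
  -- the constant coefficient of `p`.
  have h1 : ∀ t : τ → ℂ, ∃ x : A →+* ℂ,
      x.comp (algebraMap (MvPolynomial τ ℂ) A) = MvPolynomial.eval t ∧
      ‖x y‖ ^ p.natDegree ≤ ‖MvPolynomial.eval t (p.coeff 0)‖ := by
    intro t
    obtain ⟨η, hη, hle⟩ := exists_root_norm_pow_le (p.map (MvPolynomial.eval t)) (hpm.map _)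
      (by rwa [hpm.natDegree_map])
    rw [hpm.natDegree_map, Polynomial.coeff_map] at hle
    obtain ⟨x, hx, hxy⟩ := exists_ringHom_of_root y (MvPolynomial.eval t)
      (fun c => ⟨MvPolynomial.C c, by simp⟩) (η := η) (by rwa [← Polynomial.eval_map])
    exact ⟨x, hx, by rwa [hxy]⟩
  choose x hx hxy using h1
  -- Along an ultrafilter the bounded values converge, and their limits form a ring homomorphism
  -- over `t₀`. It kills `y`, since `p.coeff 0` vanishes at `t₀`, so it is `x₀` by the choice of
  -- `y`.
  refine ⟨x, hx, fun a => (Filter.tendsto_iff_ultrafilter _ _ _).2 fun u hu => ?_⟩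
  have hlim : ∀ b : A, ∃ l : ℂ, Filter.Tendsto (fun t => x t b) u (𝓝 l) := by
    intro b
    obtain ⟨M, hM⟩ := eventually_norm_le_of_isIntegral
      (Algebra.IsIntegral.isIntegral (R := MvPolynomial τ ℂ) b) t₀
    have hb : ∀ᶠ t in (u : Filter (τ → ℂ)), x t b ∈ Metric.closedBall (0 : ℂ) M := by
      filter_upwards [hu hM] with t ht
      simpa using ht _ (hx t)
    obtain ⟨l, -, hl⟩ := (isCompact_closedBall (0 : ℂ) M).ultrafilter_le_nhds
      (u.map fun t => x t b) (Filter.le_principal_iff.2 hb)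
    exact ⟨l, hl⟩
  choose l hl using hlim
  let xl : A →+* ℂ :=
    { toFun := l
      map_one' := tendsto_nhds_unique (hl 1) (by simp)
      map_zero' := tendsto_nhds_unique (hl 0) (by simp)
      map_add' := fun a b => tendsto_nhds_unique (hl (a + b)) (by simpa using (hl a).add (hl b))
      map_mul' := fun a b => tendsto_nhds_unique (hl (a * b)) (by simpa using (hl a).mul (hl b)) }
  have hxl : xl.comp (algebraMap (MvPolynomial τ ℂ) A) = MvPolynomial.eval t₀ := by
    refine RingHom.ext fun r => tendsto_nhds_unique (hl (algebraMap _ _ r)) ?_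
    have : (fun t => x t (algebraMap _ _ r)) = fun t => MvPolynomial.eval t r := by
      funext t
      exact congrArg (fun f => f r) (hx t)
    rw [this]
    exact (MvPolynomial.continuous_eval r).continuousAt.mono_left hu
  have hc0 : MvPolynomial.eval t₀ (p.coeff 0) = 0 := by
    have h := minpoly_eval_of_comp_eq hx₀ y
    rw [hy0] at h
    rw [← Polynomial.coeff_map, Polynomial.coeff_zero_eq_eval_zero]
    exact h
  have hxly : xl y = 0 := by
    have h2 : Filter.Tendsto (fun t => ‖x t y‖ ^ p.natDegree) u (𝓝 (‖l y‖ ^ p.natDegree)) :=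
      ((hl y).norm).pow _
    have h3 : Filter.Tendsto (fun t : τ → ℂ => ‖MvPolynomial.eval t (p.coeff 0)‖) u (𝓝 0) := by
      have := ((MvPolynomial.continuous_eval (p.coeff 0)).norm.continuousAt (x := t₀)).mono_left hu
      simpa [ContinuousAt, hc0] using this
    have h4 := le_of_tendsto_of_tendsto' h2 h3 hxy
    have h5 : ‖l y‖ ^ p.natDegree = 0 := le_antisymm h4 (by positivity)
    exact norm_eq_zero.1 (pow_eq_zero_iff hdeg |>.1 h5)
  have := hy xl hxl hxly
  rw [← this]
  exact hl a

end Sections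

/-! ## Local sections of quasi-finite maps -/

section Points

variable {σ : Type}

/-- A ring homomorphism to `ℂ` need not be `ℂ`-linear; the hypothesis on constants is what turns it
into a point. -/
theorem ringHom_mk_eq {I : Ideal (MvPolynomial σ ℂ)} {ψ : (MvPolynomial σ ℂ ⧸ I) →+* ℂ}
    (hψ : ∀ z, ψ (Ideal.Quotient.mk I (MvPolynomial.C z)) = z) (p : MvPolynomial σ ℂ) :
    ψ (Ideal.Quotient.mk I p) =
      MvPolynomial.eval (fun j => ψ (Ideal.Quotient.mk I (MvPolynomial.X j))) p := by
  have : ψ.comp (Ideal.Quotient.mk I) =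
      MvPolynomial.eval (fun j => ψ (Ideal.Quotient.mk I (MvPolynomial.X j))) :=
    MvPolynomial.ringHom_ext (by simpa using hψ) (by simp)
  exact congrArg (fun f => f p) this

theorem mem_zeroLocus_of_ringHom {I : Ideal (MvPolynomial σ ℂ)}
    {ψ : (MvPolynomial σ ℂ ⧸ I) →+* ℂ}
    (hψ : ∀ z, ψ (Ideal.Quotient.mk I (MvPolynomial.C z)) = z) :
    (fun j => ψ (Ideal.Quotient.mk I (MvPolynomial.X j))) ∈ MvPolynomial.zeroLocus ℂ I := by
  intro p hp
  rw [MvPolynomial.aeval_eq_eval, ← ringHom_mk_eq hψ,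
    Ideal.Quotient.eq_zero_iff_mem.2 hp, map_zero]

/-- Evaluation of functions on a variety at one of its points. -/
noncomputable def evalAt (I : Ideal (MvPolynomial σ ℂ)) {x : σ → ℂ} (hx : x ∈ MvPolynomial.zeroLocus ℂ I) :
    (MvPolynomial σ ℂ ⧸ I) →+* ℂ :=
  Ideal.Quotient.lift I (MvPolynomial.eval x) fun p hp => by
    simpa [MvPolynomial.aeval_eq_eval] using hx p hp

theorem evalAt_mk {I : Ideal (MvPolynomial σ ℂ)} {x : σ → ℂ}
    (hx : x ∈ MvPolynomial.zeroLocus ℂ I) (p : MvPolynomial σ ℂ) :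
    evalAt I hx (Ideal.Quotient.mk I p) = MvPolynomial.eval x p := rfl

end Points

/-- Noether normalisation makes `B` finite over a polynomial ring, in at least one variable since
`B` is not a field. The section through `ev` then consists of points that differ from `ev` because
they lie over other parameters. -/
theorem exists_approximation_of_not_isField {B : Type} [CommRing B] [IsDomain B] [Algebra ℂ B]
    [Algebra.FiniteType ℂ B] (hB : ¬ IsField B) (ev : B →+* ℂ)
    (hev : ∀ z, ev (algebraMap ℂ B z) = z) :
    ∃ (s : ℕ) (t₀ : Fin s → ℂ) (x : (Fin s → ℂ) → (B →+* ℂ)), Nonempty (Fin s) ∧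
      (∀ t, t ≠ t₀ → x t ≠ ev) ∧ (∀ t z, x t (algebraMap ℂ B z) = z) ∧
      ∀ b, Filter.Tendsto (fun t => x t b) (𝓝 t₀) (𝓝 (ev b)) := by
  obtain ⟨s, g, hg, hfin⟩ := exists_finite_inj_algHom_of_fg ℂ B
  algebraize [g.toRingHom]
  have : FaithfulSMul (MvPolynomial (Fin s) ℂ) B :=
    (faithfulSMul_iff_algebraMap_injective _ _).2 hg
  have hfin' : Module.Finite (MvPolynomial (Fin s) ℂ) B := hfin
  have hs : Nonempty (Fin s) := by
    by_contra h
    rw [not_nonempty_iff] at h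
    have h1 : IsField (MvPolynomial (Fin s) ℂ) :=
      MulEquiv.isField (Field.toIsField ℂ) (MvPolynomial.isEmptyAlgEquiv ℂ (Fin s)).toMulEquiv
    exact hB (isField_of_isIntegral_of_isField' h1)
  have hgC : ∀ z, algebraMap (MvPolynomial (Fin s) ℂ) B (MvPolynomial.C z) = algebraMap ℂ B z :=
    fun z => g.commutes z
  set t₀ : Fin s → ℂ :=
    fun i => ev (algebraMap (MvPolynomial (Fin s) ℂ) B (MvPolynomial.X i)) with ht₀
  obtain ⟨x, hx, hxlim⟩ := exists_section_of_finite (t₀ := t₀) (x₀ := ev) (by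
    refine MvPolynomial.ringHom_ext (fun z => ?_) (fun i => ?_)
    · rw [RingHom.comp_apply, hgC, hev]; simp
    · simp [ht₀])
  refine ⟨s, t₀, x, hs, fun t ht h => ht ?_, fun t z => ?_, hxlim⟩
  · funext i
    have := congrArg (fun f => f (MvPolynomial.X i)) (hx t)
    simpa [h, ht₀] using this.symm
  · rw [← hgC, ← RingHom.comp_apply, hx, MvPolynomial.eval_C]

/-- A variety of positive dimension has no isolated points. -/
theorem frequently_ne_of_not_isMaximal {σ : Type} [Finite σ] {Q : Ideal (MvPolynomial σ ℂ)}
    (hQ : Q.IsPrime) (hQm : ¬ Q.IsMaximal) {x₀ : σ → ℂ}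
    (hx₀ : x₀ ∈ MvPolynomial.zeroLocus ℂ Q) :
    ∃ᶠ x in 𝓝 x₀, x ∈ MvPolynomial.zeroLocus ℂ Q ∧ x ≠ x₀ := by
  obtain ⟨s, t₀, x, hs, hne, hxC, hxlim⟩ := exists_approximation_of_not_isField
    (B := MvPolynomial σ ℂ ⧸ Q) (fun h => hQm (Ideal.Quotient.maximal_of_isField _ h))
    (evalAt Q hx₀) (fun z => by
      change evalAt Q hx₀ (Ideal.Quotient.mk Q (MvPolynomial.C z)) = z
      rw [evalAt_mk, MvPolynomial.eval_C])
  have hxC : ∀ t z, x t (Ideal.Quotient.mk Q (MvPolynomial.C z)) = z := hxC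
  have hlim : Filter.Tendsto
      (fun t => fun j => x t (Ideal.Quotient.mk Q (MvPolynomial.X j))) (𝓝[≠] t₀) (𝓝 x₀) := by
    refine tendsto_pi_nhds.2 fun j => ?_
    have := (hxlim (Ideal.Quotient.mk Q (MvPolynomial.X j))).mono_left
      (nhdsWithin_le_nhds (s := {t₀}ᶜ))
    simpa [evalAt_mk] using this
  refine hlim.frequently (Filter.Eventually.frequently ?_)
  filter_upwards [self_mem_nhdsWithin] with t ht
  refine ⟨mem_zeroLocus_of_ringHom (hxC t), fun h => hne t ht ?_⟩
  refine Ideal.Quotient.ringHom_ext (RingHom.ext fun p => ?_)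
  rw [RingHom.comp_apply, RingHom.comp_apply, ringHom_mk_eq (hxC t), h, evalAt_mk]

/-- The hypothesis makes `m` a minimal prime over the ideal of its fibre. Avoiding the finitely many
other minimal primes gives a basic open set that meets the fibre in `m` alone, and an isolated point
of the fibre is a point of quasi-finiteness. -/
theorem quasiFiniteAt_of_minimal {R A : Type} [CommRing R] [CommRing A] [Algebra R A]
    [Algebra.FiniteType R A] [IsNoetherianRing A] (m : Ideal A) [hm : m.IsMaximal]
    (h : ∀ P : Ideal A, P.IsPrime → P ≤ m → (m.comap (algebraMap R A)).map (algebraMap R A) ≤ P →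
      P = m) : Algebra.QuasiFiniteAt R m := by
  classical
  set n := (m.comap (algebraMap R A)).map (algebraMap R A) with hn
  have hnm : n ≤ m := Ideal.map_comap_le
  have hfin := n.finite_minimalPrimes_of_isNoetherianRing
  have h1 : ∃ a : A, a ∉ m ∧ ∀ P ∈ n.minimalPrimes, P ≠ m → a ∈ P := by
    have : ∀ P : n.minimalPrimes, ∃ a : A, a ∉ m ∧ (P.1 ≠ m → a ∈ P.1) := by
      rintro ⟨P, hP⟩
      by_cases hPm : P = m
      · exact ⟨1, (Ideal.ne_top_iff_one m).1 hm.ne_top, fun h => absurd hPm h⟩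
      · have : ¬ P ≤ m := fun hle => hPm (h P hP.1.1 hle hP.1.2)
        obtain ⟨a, ha, ham⟩ := SetLike.not_le_iff_exists.1 this
        exact ⟨a, ham, fun _ => ha⟩
    choose a ham haP using this
    have := hfin.to_subtype
    have := Fintype.ofFinite n.minimalPrimes
    refine ⟨∏ P, a P, fun hmem => ?_, fun P hP hne => ?_⟩
    · obtain ⟨P, -, hP⟩ := (Ideal.IsPrime.prod_mem_iff (hp := hm.isPrime)).1 hmem
      exact ham P hP
    · exact Ideal.prod_mem _ (Finset.mem_univ (⟨P, hP⟩ : n.minimalPrimes)) (haP ⟨P, hP⟩ hne)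
  obtain ⟨a, ham, haP⟩ := h1
  refine Algebra.QuasiFiniteAt.of_isOpen_singleton_fiber (R := R) ⟨m, hm.isPrime⟩ ?_
  have h2 : IsOpen ((Subtype.val : (PrimeSpectrum.comap (algebraMap R A)) ⁻¹'
      {PrimeSpectrum.comap (algebraMap R A) ⟨m, hm.isPrime⟩} → PrimeSpectrum A) ⁻¹'
      (PrimeSpectrum.basicOpen a : Set (PrimeSpectrum A))) :=
    (PrimeSpectrum.basicOpen a).isOpen.preimage continuous_subtype_val
  convert h2
  ext ⟨q, hq⟩
  simp only [Set.mem_singleton_iff, Set.mem_preimage, SetLike.mem_coe,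
    PrimeSpectrum.mem_basicOpen]
  constructor
  · intro h
    rw [show q = ⟨m, hm.isPrime⟩ from congrArg Subtype.val h]
    exact ham
  · intro haq
    have hq' : q.asIdeal.comap (algebraMap R A) = m.comap (algebraMap R A) :=
      congrArg PrimeSpectrum.asIdeal hq
    have hnq : n ≤ q.asIdeal := by
      rw [hn, Ideal.map_le_iff_le_comap, hq']
    obtain ⟨P, hP, hPq⟩ := Ideal.exists_minimalPrimes_le hnq
    by_cases hPm : P = m
    · refine Subtype.ext (PrimeSpectrum.ext ?_)
      exact (hm.eq_of_le q.isPrime.ne_top (hPm ▸ hPq)).symm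
    · exact absurd (hPq (haP P hP hPm)) haq

section LocalSection

variable {τ : Type} [Finite τ]

/-- By Zariski's main theorem `A` becomes, after inverting one `r` with `ev r ≠ 0`, a finite
subalgebra `S`. Thus `A` is algebraic over the image of the polynomial ring. If the transcendence
degree is large enough the polynomial ring injects, and the section for `S` extends to `A` wherever
`r` does not vanish. -/
theorem trdeg_le_and_exists_section_of_quasiFiniteAt {A : Type} [CommRing A] [IsDomain A]
    [Algebra ℂ A] [Algebra (MvPolynomial τ ℂ) A] [IsScalarTower ℂ (MvPolynomial τ ℂ) A]
    [Algebra.FiniteType (MvPolynomial τ ℂ) A] {t₀ : τ → ℂ} {ev : A →+* ℂ}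
    [(RingHom.ker ev).IsPrime]
    (hev : ev.comp (algebraMap (MvPolynomial τ ℂ) A) = MvPolynomial.eval t₀)
    (hqf : Algebra.QuasiFiniteAt (MvPolynomial τ ℂ) (RingHom.ker ev)) :
    Algebra.trdeg ℂ A ≤ Nat.card τ ∧
    (Nat.card τ ≤ Algebra.trdeg ℂ A → ∃ x : (τ → ℂ) → (A →+* ℂ),
      (∀ t z, x t (algebraMap ℂ A z) = z) ∧
      (∀ᶠ t in 𝓝 t₀, (x t).comp (algebraMap (MvPolynomial τ ℂ) A) = MvPolynomial.eval t) ∧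
      ∀ a, Filter.Tendsto (fun t => x t a) (𝓝 t₀) (𝓝 (ev a))) := by
  classical
  have hgC : ∀ z, algebraMap (MvPolynomial τ ℂ) A (MvPolynomial.C z) = algebraMap ℂ A z :=
    fun z => (IsScalarTower.algebraMap_apply ℂ (MvPolynomial τ ℂ) A z).symm
  have haev : ∀ q, MvPolynomial.aeval
      (fun i => algebraMap (MvPolynomial τ ℂ) A (MvPolynomial.X i)) q =
      algebraMap (MvPolynomial τ ℂ) A q := by
    intro q
    have : MvPolynomial.aeval (fun i => algebraMap (MvPolynomial τ ℂ) A (MvPolynomial.X i)) =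
        IsScalarTower.toAlgHom ℂ (MvPolynomial τ ℂ) A := by
      ext i; simp
    rw [this]; rfl
  obtain ⟨S, hSfg, r, hr, hbij⟩ :=
    Algebra.QuasiFiniteAt.exists_fg_and_exists_notMem_and_awayMap_bijective (R := MvPolynomial τ ℂ)
      (RingHom.ker ev)
  have hSfin : Module.Finite (MvPolynomial τ ℂ) S := ⟨(Submodule.fg_top _).mpr hSfg⟩
  have hS : ∀ a : A, ∃ k : ℕ, (r : A) ^ k * a ∈ S := by
    intro a
    obtain ⟨b, k, h⟩ := Localization.awayMap_surjective_iff.1 hbij.2 a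
    exact ⟨k, by
      have h' : (b : A) = (r : A) ^ k * a := h
      rw [← h']; exact b.2⟩
  have hr0 : (r : A) ≠ 0 := fun h => hr (h ▸ (RingHom.ker ev).zero_mem)
  -- `A` is algebraic over the image of the polynomial ring
  have halg : Algebra.IsAlgebraic
      (Algebra.adjoin ℂ (Set.range fun i => algebraMap (MvPolynomial τ ℂ) A (MvPolynomial.X i))) A := by
    set B := Algebra.adjoin ℂ (Set.range fun i => algebraMap (MvPolynomial τ ℂ) A (MvPolynomial.X i)) with hB
    have hint : ∀ s : S, IsAlgebraic B (s : A) := by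
      intro s
      have h1 : IsIntegral (MvPolynomial τ ℂ) (s : A) :=
        (Algebra.IsIntegral.isIntegral (R := MvPolynomial τ ℂ) s).map S.val
      obtain ⟨p, hp, hps⟩ := h1
      have hmem : ∀ q, algebraMap (MvPolynomial τ ℂ) A q ∈ B := fun q => by
        rw [hB, Algebra.adjoin_range_eq_range_aeval]
        exact ⟨q, haev q⟩
      let j : MvPolynomial τ ℂ →+* B := (algebraMap (MvPolynomial τ ℂ) A).codRestrict B hmem
      refine (show IsIntegral B (s : A) from ⟨p.map j, hp.map _, ?_⟩).isAlgebraic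
      rw [Polynomial.eval₂_map]
      exact hps
    refine ⟨fun a => ?_⟩
    obtain ⟨k, hk⟩ := hS a
    refine IsAlgebraic.of_mul (y := (r : A) ^ k)
      (mem_nonZeroDivisors_of_ne_zero (pow_ne_zero _ hr0)) ?_ (hint ⟨_, hk⟩)
    exact (hint r).pow k
  have hle : Algebra.trdeg ℂ A ≤ Nat.card τ := by
    refine (Algebra.IsAlgebraic.trdeg_le_cardinalMk ℂ
      (Set.range fun i => algebraMap (MvPolynomial τ ℂ) A (MvPolynomial.X i))).trans ?_
    refine Cardinal.mk_range_le.trans ?_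
    rw [Nat.cast_card]
  refine ⟨hle, fun hge => ?_⟩
  have hbasis := Algebra.IsAlgebraic.isTranscendenceBasis_of_le_trdeg_of_finite ℂ
    (fun i => algebraMap (MvPolynomial τ ℂ) A (MvPolynomial.X i)) (by rwa [Nat.cast_card] at hge)
  have hinj : Function.Injective (algebraMap (MvPolynomial τ ℂ) A) := fun p q hpq =>
    hbasis.1 ((haev p).trans (hpq.trans (haev q).symm))
  have : FaithfulSMul (MvPolynomial τ ℂ) S := by
    refine (faithfulSMul_iff_algebraMap_injective _ _).2 fun a b hab => hinj ?_
    exact congrArg Subtype.val hab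
  obtain ⟨x, hx, hxlim⟩ := exists_section_of_finite (A := S) (t₀ := t₀)
    (x₀ := ev.comp S.val.toRingHom) (by rw [← hev]; rfl)
  have hne : ∀ᶠ t in 𝓝 t₀, x t r ≠ 0 := (hxlim r).eventually_ne hr
  have hext : ∀ t, ∃ ψ : A →+* ℂ, (∀ z, ψ (algebraMap ℂ A z) = z) ∧
      (x t r ≠ 0 → ∀ s : S, ψ s = x t s) := by
    intro t
    by_cases h : x t r = 0
    -- Where `r` vanishes the value is irrelevant; `ev` keeps the map `ℂ`-linear for every `t`.
    · refine ⟨ev, fun z => ?_, fun h' => absurd h h'⟩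
      rw [← hgC, ← RingHom.comp_apply, hev, MvPolynomial.eval_C]
    · obtain ⟨ψ, hψ⟩ := exists_ringHom_extension_of_away S r hS (x t) h
      refine ⟨ψ, fun z => ?_, fun _ => hψ⟩
      rw [← hgC]
      refine (hψ (algebraMap (MvPolynomial τ ℂ) S (MvPolynomial.C z))).trans ?_
      rw [← RingHom.comp_apply, hx, MvPolynomial.eval_C]
  choose ψ hψC hψ using hext
  refine ⟨ψ, hψC, ?_, fun a => ?_⟩
  · filter_upwards [hne] with t ht
    rw [← hx t]
    exact RingHom.ext fun p => hψ t ht (algebraMap _ S p)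
  · obtain ⟨k, hk⟩ := hS a
    have h1 : Filter.Tendsto (fun t => x t ⟨_, hk⟩ / x t r ^ k) (𝓝 t₀)
        (𝓝 (ev ((r : A) ^ k * a) / ev r ^ k)) :=
      (hxlim ⟨_, hk⟩).div ((hxlim r).pow k) (pow_ne_zero _ hr)
    rw [map_mul, map_pow, mul_div_cancel_left₀ _ (pow_ne_zero _ hr)] at h1
    refine h1.congr' ?_
    filter_upwards [hne] with t ht
    rw [div_eq_iff (pow_ne_zero _ ht), ← hψ t ht ⟨_, hk⟩, ← hψ t ht r]
    simp [mul_comm]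

variable {σ : Type} [Finite σ] {I : Ideal (MvPolynomial σ ℂ)}

/-- Let `g` be a map from the variety of `I` to affine space, and `x₀` an isolated point of a fibre.
The dimension of the variety is at most that of the affine space, and if they are equal then the
map has near `x₀` a section which is continuous at `g x₀`. -/
theorem trdeg_le_and_exists_section (hI : I.IsPrime) (g : τ → MvPolynomial σ ℂ) {x₀ : σ → ℂ}
    (hx₀ : x₀ ∈ MvPolynomial.zeroLocus ℂ I)
    (hiso : ∀ᶠ x in 𝓝 x₀, x ∈ MvPolynomial.zeroLocus ℂ I →
      (∀ i, MvPolynomial.eval x (g i) = MvPolynomial.eval x₀ (g i)) → x = x₀) :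
    Algebra.trdeg ℂ (MvPolynomial σ ℂ ⧸ I) ≤ Nat.card τ ∧
    (Nat.card τ ≤ Algebra.trdeg ℂ (MvPolynomial σ ℂ ⧸ I) →
      ∃ x : (τ → ℂ) → (σ → ℂ), (∀ t, x t ∈ MvPolynomial.zeroLocus ℂ I) ∧
        (∀ᶠ t in 𝓝 (fun i => MvPolynomial.eval x₀ (g i)),
          ∀ i, MvPolynomial.eval (x t) (g i) = t i) ∧
        Filter.Tendsto x (𝓝 (fun i => MvPolynomial.eval x₀ (g i))) (𝓝 x₀)) := by
  classical
  set A := MvPolynomial σ ℂ ⧸ I with hA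
  let g' : MvPolynomial τ ℂ →ₐ[ℂ] A := MvPolynomial.aeval fun i => Ideal.Quotient.mk I (g i)
  algebraize [g'.toRingHom]
  have hst : IsScalarTower ℂ (MvPolynomial τ ℂ) A := .of_algebraMap_eq' g'.comp_algebraMap.symm
  have hft : Algebra.FiniteType (MvPolynomial τ ℂ) A := .of_restrictScalars_finiteType ℂ _ _
  have hgX : ∀ i, algebraMap (MvPolynomial τ ℂ) A (MvPolynomial.X i) = Ideal.Quotient.mk I (g i) :=
    fun i => MvPolynomial.aeval_X _ _
  have hgC : ∀ z, algebraMap (MvPolynomial τ ℂ) A (MvPolynomial.C z) =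
      Ideal.Quotient.mk I (MvPolynomial.C z) := fun z => g'.commutes z
  set t₀ : τ → ℂ := fun i => MvPolynomial.eval x₀ (g i) with ht₀
  have hev : (evalAt I hx₀).comp (algebraMap (MvPolynomial τ ℂ) A) = MvPolynomial.eval t₀ := by
    refine MvPolynomial.ringHom_ext (fun z => ?_) (fun i => ?_)
    · rw [RingHom.comp_apply, hgC, evalAt_mk]; simp
    · rw [RingHom.comp_apply, hgX, evalAt_mk]; simp [ht₀]
  have hsurj : Function.Surjective (evalAt I hx₀) :=
    fun z => ⟨Ideal.Quotient.mk I (MvPolynomial.C z), by rw [evalAt_mk]; simp⟩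
  let m : Ideal A := RingHom.ker (evalAt I hx₀)
  have hm : m.IsMaximal := RingHom.ker_isMaximal_of_surjective _ hsurj
  -- A prime strictly below `m` that contains the fibre ideal would be a subvariety of positive
  -- dimension in the fibre through `x₀`, which then would not be isolated.
  have hqf : Algebra.QuasiFiniteAt (MvPolynomial τ ℂ) m := by
    refine quasiFiniteAt_of_minimal m fun P hP hPm hnP => ?_
    by_contra hne
    have hPmax : ¬ P.IsMaximal := fun h => hne (h.eq_of_le hm.ne_top hPm)
    let Q := P.comap (Ideal.Quotient.mk I)
    have hQ : Q.IsPrime := Ideal.comap_isPrime _ _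
    have hQmax : ¬ Q.IsMaximal := fun h =>
      hPmax (by
        have := Ideal.map_eq_top_or_isMaximal_of_surjective (Ideal.Quotient.mk I)
          Ideal.Quotient.mk_surjective h
        rw [Ideal.map_comap_of_surjective _ Ideal.Quotient.mk_surjective] at this
        exact this.resolve_left hP.ne_top)
    have hx₀Q : x₀ ∈ MvPolynomial.zeroLocus ℂ Q := fun p hp => by
      have : Ideal.Quotient.mk I p ∈ m := hPm hp
      rwa [RingHom.mem_ker, evalAt_mk] at this
    refine (frequently_ne_of_not_isMaximal hQ hQmax hx₀Q) ?_
    filter_upwards [hiso] with x hx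
    rintro ⟨hxQ, hxne⟩
    refine hxne (hx (fun p hp => hxQ p ?_) fun i => ?_)
    · change Ideal.Quotient.mk I p ∈ P
      rw [Ideal.Quotient.eq_zero_iff_mem.2 hp]
      exact P.zero_mem
    · have h1 : g i - MvPolynomial.C (t₀ i) ∈ Q := by
        apply hnP
        rw [map_sub, ← hgX, ← hgC, ← map_sub]
        refine Ideal.mem_map_of_mem _ ?_
        rw [Ideal.mem_comap, RingHom.mem_ker, ← RingHom.comp_apply, hev]
        simp
      have h2 := hxQ _ h1
      rw [MvPolynomial.aeval_eq_eval, map_sub, MvPolynomial.eval_C,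
        sub_eq_zero] at h2
      exact h2
  obtain ⟨h1, h2⟩ := trdeg_le_and_exists_section_of_quasiFiniteAt hev hqf
  refine ⟨h1, fun hge => ?_⟩
  obtain ⟨x, hxC, hx, hxlim⟩ := h2 hge
  have hxC : ∀ t z, x t (Ideal.Quotient.mk I (MvPolynomial.C z)) = z := hxC
  refine ⟨fun t j => x t (Ideal.Quotient.mk I (MvPolynomial.X j)),
    fun t => mem_zeroLocus_of_ringHom (hxC t), ?_, tendsto_pi_nhds.2 fun j => ?_⟩
  · filter_upwards [hx] with t ht i
    rw [← ringHom_mk_eq (hxC t), ← hgX, ← RingHom.comp_apply, ht, MvPolynomial.eval_X]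
  · have := hxlim (Ideal.Quotient.mk I (MvPolynomial.X j))
    rwa [evalAt_mk, MvPolynomial.eval_X] at this

end LocalSection

/-! ## Minors and rank -/

section Minors

variable {K ι κ : Type} [Field K] [Fintype κ]

theorem le_rank_of_det_ne_zero {M : Matrix ι κ K} {k : ℕ} {a : Fin k → ι} {b : Fin k → κ}
    (h : (M.submatrix a b).det ≠ 0) : k ≤ M.rank := by
  have h1 := Matrix.rank_of_isUnit (M.submatrix a b)
    ((Matrix.isUnit_iff_isUnit_det _).2 (isUnit_iff_ne_zero.2 h))
  rw [Fintype.card_fin] at h1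
  rw [← h1]
  exact M.rank_submatrix_le a b

theorem exists_submatrix_det_ne_zero [Finite ι] {M : Matrix ι κ K} {k : ℕ} (h : k ≤ M.rank) :
    ∃ (a : Fin k → ι) (b : Fin k → κ), (M.submatrix a b).det ≠ 0 := by
  -- Stated for all index types, so that it selects first rows and then, by transposition, columns.
  have key : ∀ {ι κ : Type} [Finite ι] [Fintype κ] (M : Matrix ι κ K), k ≤ M.rank →
      ∃ a : Fin k → ι, LinearIndependent K fun i => M (a i) := by
    intro ι κ _ _ M hk
    rw [Matrix.rank_eq_finrank_span_row] at hk
    obtain ⟨f, hf, -, hli⟩ := Submodule.exists_fun_fin_finrank_span_eq K (Set.range M.row)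
    choose a ha using hf
    refine ⟨fun i => a (Fin.castLE hk i), ?_⟩
    have h : (fun i => M (a (Fin.castLE hk i))) = f ∘ Fin.castLE hk := funext fun i => ha _
    rw [h]
    exact hli.comp (Fin.castLE hk) (Fin.castLE_injective hk)
  obtain ⟨a, ha⟩ := key M h
  have h2 : ((M.submatrix a id).transpose).rank = k := by
    rw [Matrix.rank_transpose]
    have : LinearIndependent K (M.submatrix a id).row := ha
    rw [this.rank_matrix, Fintype.card_fin]
  obtain ⟨b, hb⟩ := key (M.submatrix a id).transpose h2.ge
  refine ⟨a, b, ?_⟩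
  have : LinearIndependent K (M.submatrix a b).transpose.row := hb
  rw [Matrix.linearIndependent_rows_iff_isUnit, Matrix.isUnit_iff_isUnit_det,
    Matrix.det_transpose] at this
  exact this.ne_zero

theorem rank_le_iff_forall_det_eq_zero [Finite ι] {M : Matrix ι κ K} {k : ℕ} :
    M.rank ≤ k ↔
      ∀ (a : Fin (k + 1) → ι) (b : Fin (k + 1) → κ), (M.submatrix a b).det = 0 := by
  constructor
  · intro h a b
    by_contra hne
    have := le_rank_of_det_ne_zero hne
    omega
  · intro h
    by_contra! hlt
    obtain ⟨a, b, hab⟩ := exists_submatrix_det_ne_zero (show k + 1 ≤ M.rank from hlt)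
    exact hab (h a b)

end Minors

/-! ## Derivatives of polynomials -/

theorem hasFDerivAt_eval {ι : Type} [Fintype ι] (p : MvPolynomial ι ℂ) (z : ι → ℂ) :
    HasFDerivAt (fun x : ι → ℂ => MvPolynomial.eval x p)
      (∑ j, MvPolynomial.eval z (MvPolynomial.pderiv j p) •
        (ContinuousLinearMap.proj j : (ι → ℂ) →L[ℂ] ℂ)) z := by
  classical
  induction p using MvPolynomial.induction_on with
  | C a =>
    refine ((hasFDerivAt_const a z).congr_of_eventuallyEq (.of_forall fun x => by simp)).congr_fderiv
      ?_
    ext v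
    simp
  | add p q hp hq =>
    refine ((hp.add hq).congr_of_eventuallyEq (.of_forall fun x => by simp)).congr_fderiv ?_
    ext v
    simp [add_mul, Finset.sum_add_distrib]
  | mul_X p i hp =>
    have hX : HasFDerivAt (fun x : ι → ℂ => x i) (ContinuousLinearMap.proj (R := ℂ) i) z :=
      hasFDerivAt_apply i z
    refine ((hp.mul hX).congr_of_eventuallyEq (.of_forall fun x => by simp)).congr_fderiv ?_
    ext v
    simp [MvPolynomial.pderiv_X, Pi.single_apply, add_mul, Finset.sum_add_distrib,
      Finset.mul_sum, apply_ite, mul_assoc]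

/-! ## Derivations and algebraic elements -/

/-- Applying `D` to `p(y) = 0` gives `p'(y) · D y = 0`. If `p'(y) = 0`, the nonzero polynomial `p'`
of smaller degree takes the place of `p`. -/
theorem derivation_eq_zero_of_isAlgebraic {B A : Type} [CommRing B] [CommRing A] [IsDomain A]
    [CharZero A] [Algebra B A] [FaithfulSMul B A] (D : Derivation B A A) {y : A}
    (hy : IsAlgebraic B y) : D y = 0 := by
  have hinj := FaithfulSMul.algebraMap_injective B A
  have : IsDomain B := hinj.isDomain
  have : CharZero B := ⟨fun m n h => Nat.cast_injective (R := A) (by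
    simpa using congrArg (algebraMap B A) h)⟩
  obtain ⟨p, hp, hpy⟩ := hy
  induction hk : p.natDegree using Nat.strong_induction_on generalizing p with
  | _ k ih =>
    have h1 := D.map_aeval p y
    rw [hpy, map_zero, smul_eq_mul, eq_comm, mul_eq_zero] at h1
    refine h1.elim (fun h2 => ?_) id
    by_cases h0 : p.natDegree = 0
    · rw [Polynomial.eq_C_of_natDegree_eq_zero h0, Polynomial.aeval_C] at hpy
      have h3 := hinj (hpy.trans (map_zero _).symm)
      rw [Polynomial.eq_C_of_natDegree_eq_zero h0, h3] at hp
      simp at hp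
    · have hd : p.derivative ≠ 0 := fun h => h0 (Polynomial.derivative_eq_zero.1 h)
      have hlt : p.derivative.natDegree < p.natDegree := Polynomial.natDegree_derivative_lt h0
      exact ih _ (hk ▸ hlt) _ hd h2 rfl

/-! ## The Jacobian matrix along the variety -/

/-- A kernel vector of the Jacobian over the function field is, up to a denominator, a derivation of
`A`. A derivation that vanishes on a transcendence basis is zero, so the kernel has dimension at
most `d`. -/
theorem card_le_trdeg_add_rank {n s : ℕ} (f : Fin s → RingZ n) {A : Type} [CommRing A] [IsDomain A]
    [Algebra ℂ A] (π : RingZ n →ₐ[ℂ] A) (hπ : Function.Surjective π)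
    (hker : RingHom.ker π = idealX f) {d : ℕ} (hd : Algebra.trdeg ℂ A = d) :
    n ≤ d + ((jacobian f).map (fun p => algebraMap A (FractionRing A) (π p))).rank := by
  classical
  set K := FractionRing A
  set M := (jacobian f).map (fun p => algebraMap A K (π p)) with hM
  have hAinj : Function.Injective (algebraMap A K) := IsFractionRing.injective A K
  have : CharZero A := charZero_of_injective_algebraMap (algebraMap ℂ A).injective
  have htop : Algebra.adjoin ℂ (Set.range fun j => π (MvPolynomial.X j)) = ⊤ := by
    rw [Algebra.adjoin_range_eq_range_aeval, eq_top_iff]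
    rintro a -
    obtain ⟨p, rfl⟩ := hπ a
    refine ⟨p, ?_⟩
    have : MvPolynomial.aeval (fun j => π (MvPolynomial.X j)) = π := by ext; simp
    rw [this]; rfl
  have halg : Algebra.IsAlgebraic
      (Algebra.adjoin ℂ (Set.range fun j => π (MvPolynomial.X j))) A := by
    rw [htop]
    exact ⟨fun a => isAlgebraic_algebraMap (⟨a, trivial⟩ : (⊤ : Subalgebra ℂ A))⟩
  -- The basis is taken among the coordinate functions, so that vanishing on it means vanishing of
  -- some entries of the vector.
  obtain ⟨t, ht, hbasis⟩ := exists_isTranscendenceBasis_subset (R := ℂ)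
    (Set.range fun j => π (MvPolynomial.X j))
  have hfin : Finite t := ((Set.finite_range _).subset ht).to_subtype
  have := Fintype.ofFinite t
  have hcard : Fintype.card t = d := by
    have := hbasis.cardinalMk_eq_trdeg
    rw [hd, Cardinal.mk_fintype] at this
    exact_mod_cast this
  have hidx : ∀ a : t, ∃ j, π (MvPolynomial.X j) = a := fun a => ht a.2
  choose idx hidx using hidx
  have halgB : Algebra.IsAlgebraic (Algebra.adjoin ℂ (Set.range ((↑) : t → A))) A :=
    hbasis.isAlgebraic
  let res : LinearMap.ker M.mulVecLin →ₗ[K] (t → K) :=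
    (LinearMap.funLeft K K idx).comp (Submodule.subtype _)
  have hres : Function.Injective res := by
    rw [← LinearMap.ker_eq_bot, LinearMap.ker_eq_bot']
    rintro ⟨v, hv⟩ hv0
    obtain ⟨b, hb⟩ := IsLocalization.exist_integer_multiples_of_finite (nonZeroDivisors A) v
    choose w hw using hb
    choose p hp using fun j => hπ (w j)
    have hb0 : algebraMap A K b ≠ 0 := by
      rw [Ne, map_eq_zero_iff _ hAinj]
      exact nonZeroDivisors.ne_zero b.2
    have hw' : ∀ j, algebraMap A K (w j) = algebraMap A K b * v j := fun j => by
      rw [hw]; exact Algebra.smul_def _ _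
    let δ := MvPolynomial.mkDerivation ℂ p
    have hδ : ∀ q, δ q = ∑ j, MvPolynomial.pderiv j q * p j := fun q => by
      induction q using MvPolynomial.induction_on with
      | C a => simp
      | add q r hq hr => simp [hq, hr, add_mul, Finset.sum_add_distrib]
      | mul_X q i hq =>
        rw [Derivation.leibniz, hq]
        simp only [Derivation.leibniz, smul_eq_mul, add_mul, Finset.sum_add_distrib,
          MvPolynomial.pderiv_X, δ, MvPolynomial.mkDerivation_X, Finset.mul_sum]
        congr 1
        · simp [Pi.single_apply]
        · exact Finset.sum_congr rfl fun j _ => by ring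
    -- The kernel equations say that `δ` maps the generators of the ideal into the ideal, so it
    -- descends to `A`.
    have hδI : ∀ q, π q = 0 → π (δ q) = 0 := by
      intro q hq
      have hq' : q ∈ Ideal.span (Set.range f) := by
        rw [← RingHom.mem_ker, hker] at hq
        exact hq
      clear hq
      induction hq' using Submodule.span_induction with
      | mem q hq =>
        obtain ⟨i, rfl⟩ := hq
        apply hAinj
        have h1 := congrFun (LinearMap.mem_ker.1 hv) i
        rw [hδ, map_sum, map_sum, map_zero]
        have h2 : ∀ j, algebraMap A K (π (MvPolynomial.pderiv j (f i) * p j)) =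
            algebraMap A K b * (M i j * v j) := fun j => by
          rw [map_mul, map_mul, hp, hw']
          simp only [hM, Matrix.map_apply, jacobian, Matrix.of_apply]
          ring
        rw [Finset.sum_congr rfl fun j _ => h2 j, ← Finset.mul_sum]
        have h3 : ∑ j, M i j * v j = 0 := h1
        rw [h3, mul_zero]
      | zero => simp
      | add x y hx hy ihx ihy =>
        rw [map_add, map_add, ihx, ihy, add_zero]
      | smul r x hx ih =>
        have hx' : π x = 0 := by rw [← RingHom.mem_ker, hker]; exact hx
        simp [smul_eq_mul, Derivation.leibniz, hx', ih]
    let DA : Derivation ℂ A A := Derivation.liftOfSurjective hπ hδI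
    have hDA : ∀ q, DA (π q) = π (δ q) := Derivation.liftOfSurjective_apply hπ hδI
    have hDX : ∀ j, DA (π (MvPolynomial.X j)) = w j := fun j => by
      rw [hDA, MvPolynomial.mkDerivation_X, hp]
    have hDt : ∀ a : t, DA a = 0 := by
      intro a
      rw [← hidx a, hDX]
      apply hAinj
      have : v (idx a) = 0 := congrFun hv0 a
      rw [hw', this, mul_zero, map_zero]
    have hDB : ∀ a ∈ Algebra.adjoin ℂ (Set.range ((↑) : t → A)), DA a = 0 := fun a ha =>
      Derivation.eqOn_adjoin (D1 := DA) (D2 := 0) (by rintro _ ⟨a, rfl⟩; exact hDt a) ha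
    let DB : Derivation (Algebra.adjoin ℂ (Set.range ((↑) : t → A))) A A :=
      Derivation.mk'
        { toFun := DA
          map_add' := map_add DA
          map_smul' := fun b a => by
            rw [Algebra.smul_def, DA.leibniz]
            have := hDB b b.2
            simp [Algebra.smul_def, this] }
        (fun a b => DA.leibniz a b)
    have hD0 : ∀ a, DA a = 0 := fun a =>
      derivation_eq_zero_of_isAlgebraic DB (Algebra.IsAlgebraic.isAlgebraic a)
    ext j
    have h1 := hw' j
    rw [← hDX, hD0, map_zero, eq_comm, mul_eq_zero] at h1
    exact h1.resolve_left hb0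
  have h1 := LinearMap.finrank_le_finrank_of_injective hres
  rw [Module.finrank_fintype_fun_eq_card, hcard] at h1
  have h2 := M.mulVecLin.finrank_range_add_finrank_ker
  rw [Module.finrank_fintype_fun_eq_card, Fintype.card_fin] at h2
  have h3 : M.rank = Module.finrank K (LinearMap.range M.mulVecLin) := rfl
  omega

/-! ### Rank of the Jacobian at points, and curves through regular points -/

section Jacobian

variable {n s : ℕ} (f : Fin s → RingZ n) (c : ℕ)

/-- The value of the Jacobian matrix at a point. -/
noncomputable def jacAt (z : Fin n → ℂ) : Matrix (Fin s) (Fin n) ℂ :=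
  (jacobian f).map (MvPolynomial.eval z)

theorem mem_varX_iff {z : Fin n → ℂ} : z ∈ varX f ↔ ∀ i, MvPolynomial.eval z (f i) = 0 := by
  rw [varX, idealX, MvPolynomial.zeroLocus_span]
  simp [MvPolynomial.aeval_eq_eval]

theorem mem_tangentSpace_iff {z t : Fin n → ℂ} :
    t ∈ tangentSpace f z ↔ (jacAt f z).mulVec t = 0 :=
  ⟨fun h => funext h, fun h i => congrFun h i⟩

theorem isClosed_varX : IsClosed (varX f) := by
  have : varX f = ⋂ i, {z | MvPolynomial.eval z (f i) = 0} := by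
    ext z; simp [mem_varX_iff]
  rw [this]
  exact isClosed_iInter fun i =>
    isClosed_eq (MvPolynomial.continuous_eval _) continuous_const

variable {f c}

theorem exists_trdeg_eq (hprime : (idealX f).IsPrime)
    (hc : dimension (varX f) + (c : WithBot ℕ∞) = (n : WithBot ℕ∞)) :
    ∃ d : ℕ, Algebra.trdeg ℂ (RingZ n ⧸ idealX f) = d ∧ d + c = n := by
  obtain ⟨d, hd, htr⟩ := exists_ringKrullDim_eq_trdeg ℂ (RingZ n ⧸ idealX f)
  refine ⟨d, htr, ?_⟩
  rw [dimension, varX, MvPolynomial.IsPrime.vanishingIdeal_zeroLocus, hd] at hc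
  exact_mod_cast hc

/-- Some `c`-minor of the Jacobian matrix does not vanish on the variety. -/
theorem exists_minor_notMem (hprime : (idealX f).IsPrime)
    (hc : dimension (varX f) + (c : WithBot ℕ∞) = (n : WithBot ℕ∞)) :
    ∃ a b, ((jacobian f).submatrix a b : Matrix (Fin c) (Fin c) (RingZ n)).det ∉ idealX f := by
  obtain ⟨d, hd, hdc⟩ := exists_trdeg_eq hprime hc
  have h := card_le_trdeg_add_rank f (Ideal.Quotient.mkₐ ℂ (idealX f))
    (Ideal.Quotient.mkₐ_surjective ℂ (idealX f)) (Ideal.Quotient.mkₐ_ker ℂ (idealX f)) hd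
  obtain ⟨a, b, hab⟩ := exists_submatrix_det_ne_zero (k := c) (by omega :
    c ≤ ((jacobian f).map (fun p => algebraMap _ (FractionRing (RingZ n ⧸ idealX f))
      (Ideal.Quotient.mkₐ ℂ (idealX f) p))).rank)
  refine ⟨a, b, fun hmem => hab ?_⟩
  have h1 := RingHom.map_det ((algebraMap _ (FractionRing (RingZ n ⧸ idealX f))).comp
    (Ideal.Quotient.mk (idealX f))) ((jacobian f).submatrix a b)
  rw [RingHom.comp_apply, Ideal.Quotient.eq_zero_iff_mem.2 hmem, map_zero] at h1
  exact h1.symm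

theorem hasFDerivAt_jacAt (z : Fin n → ℂ) :
    HasFDerivAt (fun x => fun i => MvPolynomial.eval x (f i))
      (jacAt f z).mulVecLin.toContinuousLinearMap z := by
  refine (hasFDerivAt_pi.2 fun i => hasFDerivAt_eval (f i) z).congr_fderiv ?_
  ext v i
  simp [jacAt, jacobian, Matrix.mulVec, dotProduct]

theorem hasFDerivAt_jacAt_prod {k : ℕ} (L : (Fin n → ℂ) →ₗ[ℂ] (Fin k → ℂ)) (z : Fin n → ℂ) :
    HasFDerivAt (fun x => ((fun i => MvPolynomial.eval x (f i), L x) : (Fin s → ℂ) × (Fin k → ℂ)))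
      ((jacAt f z).mulVecLin.toContinuousLinearMap.prod L.toContinuousLinearMap) z :=
  (hasFDerivAt_jacAt z).prodMk L.toContinuousLinearMap.hasFDerivAt

theorem exists_antilipschitz {k : ℕ} {L : (Fin n → ℂ) →ₗ[ℂ] (Fin k → ℂ)} {z : Fin n → ℂ}
    (hL : ∀ t, (jacAt f z).mulVec t = 0 → L t = 0 → t = 0) :
    ∃ C, AntilipschitzWith C
      ((jacAt f z).mulVecLin.toContinuousLinearMap.prod L.toContinuousLinearMap) := by
  obtain ⟨C, -, hC⟩ := LinearMap.exists_antilipschitzWith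
    (((jacAt f z).mulVecLin.toContinuousLinearMap.prod L.toContinuousLinearMap) :
      (Fin n → ℂ) →ₗ[ℂ] (Fin s → ℂ) × (Fin k → ℂ)) (by
    rw [LinearMap.ker_eq_bot']
    intro t ht
    have h := Prod.ext_iff.1 ht
    exact hL t h.1 h.2)
  exact ⟨C, hC⟩

/-- The coordinates of a linear map as polynomials. -/
noncomputable def linearPoly {k : ℕ} (L : (Fin n → ℂ) →ₗ[ℂ] (Fin k → ℂ)) (i : Fin k) : RingZ n :=
  ∑ j, MvPolynomial.C (L (Pi.single j 1) i) * MvPolynomial.X j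

theorem eval_linearPoly {k : ℕ} (L : (Fin n → ℂ) →ₗ[ℂ] (Fin k → ℂ)) (i : Fin k) (x : Fin n → ℂ) :
    MvPolynomial.eval x (linearPoly L i) = L x i := by
  conv_rhs => rw [← Finset.univ_sum_single x]
  simp only [linearPoly, map_sum, map_mul, MvPolynomial.eval_C, MvPolynomial.eval_X, Finset.sum_apply]
  refine Finset.sum_congr rfl fun j _ => ?_
  have : Pi.single j (x j) = x j • (Pi.single j 1 : Fin n → ℂ) := by
    rw [← Pi.single_smul, smul_eq_mul, mul_one]
  rw [this, map_smul, Pi.smul_apply, smul_eq_mul, mul_comm]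

/-- The map `x ↦ (f x, L x)` has injective derivative at `z`, so near `z` it takes its value there
only once; on the variety its first component is zero. -/
theorem eventually_eq_of_linear {k : ℕ} {L : (Fin n → ℂ) →ₗ[ℂ] (Fin k → ℂ)} {z : Fin n → ℂ}
    (hL : ∀ t, (jacAt f z).mulVec t = 0 → L t = 0 → t = 0) :
    ∀ᶠ x in 𝓝 z, x ∈ varX f → (∀ i, MvPolynomial.eval x (linearPoly L i) =
      MvPolynomial.eval z (linearPoly L i)) → x = z := by
  have h := (hasFDerivAt_jacAt_prod (f := f) L z).eventually_ne (c := (0, L z))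
    (exists_antilipschitz hL)
  rw [eventually_nhdsWithin_iff] at h
  filter_upwards [h] with x hx hxX hxL
  by_contra hne
  refine hx hne (Prod.ext (funext fun i => ?_) (funext fun i => ?_))
  · exact (mem_varX_iff f).1 hxX i
  · simpa [eval_linearPoly] using hxL i

/-- Linear coordinates on the kernel, composed with a projection onto it. They serve as local
parameters of the variety. -/
theorem exists_linearMap_injOn_ker (M : Matrix (Fin s) (Fin n) ℂ) :
    ∃ (k : ℕ) (L : (Fin n → ℂ) →ₗ[ℂ] (Fin k → ℂ)), k + M.rank = n ∧
      ∀ t, M.mulVec t = 0 → L t = 0 → t = 0 := by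
  let T := LinearMap.ker M.mulVecLin
  obtain ⟨p, hp⟩ := T.subtype.exists_leftInverse_of_injective (by simp)
  let e : T ≃ₗ[ℂ] (Fin (Module.finrank ℂ T) → ℂ) := (Module.finBasis ℂ T).equivFun
  refine ⟨Module.finrank ℂ T, e.toLinearMap.comp p, ?_, fun t ht hLt => ?_⟩
  · have h2 := M.mulVecLin.finrank_range_add_finrank_ker
    rw [Module.finrank_fintype_fun_eq_card, Fintype.card_fin] at h2
    rw [add_comm]
    exact h2
  · have h1 : p t = 0 := by simpa using hLt
    have h2 := LinearMap.congr_fun hp ⟨t, ht⟩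
    have h3 : p t = ⟨t, ht⟩ := h2
    rw [h1] at h3
    exact (congrArg Subtype.val h3).symm

/-- At every point of the variety the rank of the Jacobian matrix is at most the codimension. -/
theorem rank_jacAt_le (hprime : (idealX f).IsPrime)
    (hc : dimension (varX f) + (c : WithBot ℕ∞) = (n : WithBot ℕ∞)) {z : Fin n → ℂ}
    (hz : z ∈ varX f) : (jacAt f z).rank ≤ c := by
  obtain ⟨d, hd, hdc⟩ := exists_trdeg_eq hprime hc
  obtain ⟨k, L, hk, hL⟩ := exists_linearMap_injOn_ker (jacAt f z)
  -- The point is isolated in a fibre of the `k` functions `L`, so `d ≤ k = n - rank`.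
  have h := (trdeg_le_and_exists_section hprime (linearPoly L) hz
    (eventually_eq_of_linear hL)).1
  rw [hd, Nat.card_fin] at h
  have : d ≤ k := by exact_mod_cast h
  omega

/-- Every tangent vector at a regular point is the velocity of a curve in the variety. -/
theorem exists_curve (hprime : (idealX f).IsPrime)
    (hc : dimension (varX f) + (c : WithBot ℕ∞) = (n : WithBot ℕ∞)) {z : Fin n → ℂ}
    (hz : z ∈ varX f) (hrank : c ≤ (jacAt f z).rank) {τ : Fin n → ℂ}
    (hτ : (jacAt f z).mulVec τ = 0) :
    ∃ γ : ℝ → (Fin n → ℂ), (∀ ε, γ ε ∈ varX f) ∧ γ 0 = z ∧ HasDerivAt γ τ 0 := by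
  obtain ⟨d, hd, hdc⟩ := exists_trdeg_eq hprime hc
  obtain ⟨k, L, hk, hL⟩ := exists_linearMap_injOn_ker (jacAt f z)
  have hrank' := rank_jacAt_le hprime hc hz
  have hdk : d = k := by omega
  obtain ⟨-, hsec⟩ := trdeg_le_and_exists_section hprime (linearPoly L) hz
    (eventually_eq_of_linear hL)
  obtain ⟨x, hxX, hx, hxlim⟩ := hsec (by rw [hd, Nat.card_fin, hdk])
  have hLz : (fun i => MvPolynomial.eval z (linearPoly L i)) = L z :=
    funext fun i => eval_linearPoly L i z
  rw [hLz] at hx hxlim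
  have hxz : x (L z) = z := (eq_of_tendsto_nhds hxlim)
  have hline : Filter.Tendsto (fun ε : ℝ => L z + (ε : ℂ) • L τ) (𝓝 0) (𝓝 (L z)) := by
    have : Continuous (fun ε : ℝ => L z + (ε : ℂ) • L τ) := by fun_prop
    simpa using this.tendsto 0
  -- The curve is the section of `L` over the line through `L z` in direction `L τ`. The section is
  -- only known to be continuous at `L z`; differentiability comes from injectivity of `F'`.
  refine ⟨fun ε => x (L z + (ε : ℂ) • L τ), fun ε => hxX _, by simp [hxz], ?_⟩
  have hγlim : Filter.Tendsto (fun ε : ℝ => x (L z + (ε : ℂ) • L τ)) (𝓝 0) (𝓝 z) :=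
    hxlim.comp hline
  obtain ⟨C, hC⟩ := exists_antilipschitz hL
  have hF := (hasFDerivAt_jacAt_prod (f := f) L z).isLittleO.comp_tendsto hγlim
  set F' := (jacAt f z).mulVecLin.toContinuousLinearMap.prod L.toContinuousLinearMap with hF'
  have h1 : (fun ε : ℝ => x (L z + (ε : ℂ) • L τ) - z - (ε : ℂ) • τ) =O[𝓝 0]
      (fun ε : ℝ => F' (x (L z + (ε : ℂ) • L τ) - z - (ε : ℂ) • τ)) := by
    refine Asymptotics.IsBigO.of_bound C (.of_forall fun ε => ?_)
    have := hC.le_mul_dist (x (L z + (ε : ℂ) • L τ) - z - (ε : ℂ) • τ) 0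
    simpa using this
  -- Since `f` vanishes along the curve and `τ` is tangent, this is minus the linearisation error.
  have h2 : (fun ε : ℝ => F' (x (L z + (ε : ℂ) • L τ) - z - (ε : ℂ) • τ)) =o[𝓝 0]
      (fun ε : ℝ => x (L z + (ε : ℂ) • L τ) - z) := by
    refine hF.neg_left.congr' ?_ .rfl
    filter_upwards [hline.eventually hx] with ε hε
    have hLx : L (x (L z + (ε : ℂ) • L τ)) = L z + (ε : ℂ) • L τ :=
      funext fun i => by rw [← eval_linearPoly]; exact hε i
    have hfx : (fun i => MvPolynomial.eval (x (L z + (ε : ℂ) • L τ)) (f i)) = 0 :=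
      funext fun i => (mem_varX_iff f).1 (hxX _) i
    have hfz : (fun i => MvPolynomial.eval z (f i)) = 0 :=
      funext fun i => (mem_varX_iff f).1 hz i
    simp only [Function.comp_apply]
    generalize x (L z + (ε : ℂ) • L τ) = y at hLx hfx ⊢
    generalize (ε : ℂ) = e at hLx ⊢
    refine Prod.ext ?_ ?_
    · simp [hF', hfx, hfz, Matrix.mulVec_sub, Matrix.mulVec_smul, hτ]
    · simp [hF', hLx]
  have h3 := h1.trans_isLittleO h2
  -- The error is small compared with the displacement, so displacement and `ε • τ` have the same
  -- order and the error is `o(ε)`.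
  have h4 : (fun ε : ℝ => x (L z + (ε : ℂ) • L τ) - z) =O[𝓝 0] (fun ε : ℝ => (ε : ℂ) • τ) := by
    have := h3.right_isBigO_sub
    simpa using this
  have h5 : (fun ε : ℝ => (ε : ℂ) • τ) =O[𝓝 0] (fun ε : ℝ => ε) := by
    refine Asymptotics.IsBigO.of_bound ‖τ‖ (.of_forall fun ε => ?_)
    rw [norm_smul, mul_comm]
    simp
  rw [hasDerivAt_iff_isLittleO]
  refine ((h3.trans_isBigO h4).trans_isBigO h5).congr' (.of_forall fun ε => ?_) (.of_forall ?_)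
  · simp [hxz]
  · simp

end Jacobian

/-! ## Zero sets of the ideals -/

section ZeroLocus

variable {σ τ : Type}

theorem mem_zeroLocus_iff_le_ker {I : Ideal (MvPolynomial σ ℂ)} {x : σ → ℂ} :
    x ∈ MvPolynomial.zeroLocus ℂ I ↔ I ≤ RingHom.ker (MvPolynomial.eval x) := by
  simp [MvPolynomial.mem_zeroLocus_iff, MvPolynomial.aeval_eq_eval, SetLike.le_def]

theorem mem_zariskiClosure_iff {S : Set (σ → ℂ)} {x : σ → ℂ} :
    x ∈ zariskiClosure S ↔
      ∀ q : MvPolynomial σ ℂ, (∀ y ∈ S, MvPolynomial.eval y q = 0) → MvPolynomial.eval x q = 0 := by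
  simp [zariskiClosure, MvPolynomial.mem_zeroLocus_iff, MvPolynomial.mem_vanishingIdeal_iff,
    MvPolynomial.aeval_eq_eval]

theorem subset_zariskiClosure (S : Set (σ → ℂ)) : S ⊆ zariskiClosure S :=
  MvPolynomial.zeroLocus_vanishingIdeal_le S

theorem zariskiClosure_subset_iff {S : Set (σ → ℂ)} {I : Ideal (MvPolynomial σ ℂ)} :
    zariskiClosure S ⊆ MvPolynomial.zeroLocus ℂ I ↔ S ⊆ MvPolynomial.zeroLocus ℂ I := by
  refine ⟨(subset_zariskiClosure S).trans, fun h => MvPolynomial.zeroLocus_anti_mono ?_⟩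
  exact MvPolynomial.le_zeroLocus_iff_le_vanishingIdeal.1 h

theorem mem_saturation_iff {R : Type} [CommRing R] {I J : Ideal R} {r : R} :
    r ∈ saturation I J ↔ ∃ k : ℕ, ∀ a ∈ J ^ k, r * a ∈ I := by
  rw [saturation, Submodule.mem_iSup_of_directed]
  · simp [Submodule.mem_colon]
  · exact Monotone.directed_le fun k l hkl =>
      Submodule.colon_mono le_rfl (Ideal.pow_le_pow_right hkl)

theorem le_saturation {R : Type} [CommRing R] (I J : Ideal R) : I ≤ saturation I J := fun _ hr =>
  mem_saturation_iff.2 ⟨0, fun a _ => I.mul_mem_right a hr⟩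

/-- The zero set of a saturation is a Zariski closure. -/
theorem zeroLocus_saturation [Finite σ] (I J : Ideal (MvPolynomial σ ℂ)) :
    MvPolynomial.zeroLocus ℂ (saturation I J) =
      zariskiClosure (MvPolynomial.zeroLocus ℂ I \ MvPolynomial.zeroLocus ℂ J) := by
  apply Set.Subset.antisymm
  · intro x hx
    rw [mem_zariskiClosure_iff]
    intro g hg
    -- Nullstellensatz: `g` vanishes on the zeros of `I` outside those of `J`, so `g * j` vanishes
    -- on all zeros of `I`. A power of `g` then lies in the saturation.
    have hle : Ideal.span {g} * J ≤ I.radical := by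
      rw [← MvPolynomial.vanishingIdeal_zeroLocus_eq_radical (K := ℂ), Ideal.span_singleton_mul_le_iff]
      intro j hj
      rw [MvPolynomial.mem_vanishingIdeal_iff]
      intro y hy
      rw [MvPolynomial.aeval_eq_eval, map_mul]
      by_cases hyJ : y ∈ MvPolynomial.zeroLocus ℂ J
      · rw [show MvPolynomial.eval y j = 0 from mem_zeroLocus_iff_le_ker.1 hyJ hj, mul_zero]
      · rw [hg y ⟨hy, hyJ⟩, zero_mul]
    obtain ⟨k, hk⟩ := Ideal.exists_pow_le_of_le_radical_of_fg hle
      (IsNoetherian.noetherian _)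
    have h1 : g ^ k ∈ saturation I J := by
      refine mem_saturation_iff.2 ⟨k, fun a ha => hk ?_⟩
      rw [mul_pow]
      exact Ideal.mul_mem_mul (Ideal.pow_mem_pow (Ideal.mem_span_singleton_self g) k) ha
    have h2 : MvPolynomial.eval x (g ^ k) = 0 := mem_zeroLocus_iff_le_ker.1 hx h1
    rw [map_pow] at h2
    exact eq_zero_of_pow_eq_zero h2
  · rw [zariskiClosure_subset_iff]
    rintro x ⟨hxI, hxJ⟩
    rw [mem_zeroLocus_iff_le_ker] at hxI hxJ ⊢
    obtain ⟨j, hj, hjx⟩ := SetLike.not_le_iff_exists.1 hxJ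
    intro r hr
    obtain ⟨k, hk⟩ := mem_saturation_iff.1 hr
    have h := hxI (hk _ (Ideal.pow_mem_pow hj k))
    rw [RingHom.mem_ker] at hjx h ⊢
    rw [map_mul, map_pow] at h
    exact (mul_eq_zero.1 h).resolve_right (pow_ne_zero k hjx)

theorem mem_zeroLocus_saturation_iff [Finite σ] {I J : Ideal (MvPolynomial σ ℂ)} {x : σ → ℂ}
    (hx : x ∉ MvPolynomial.zeroLocus ℂ J) :
    x ∈ MvPolynomial.zeroLocus ℂ (saturation I J) ↔ x ∈ MvPolynomial.zeroLocus ℂ I := by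
  refine ⟨fun h => MvPolynomial.zeroLocus_anti_mono (le_saturation I J) h, fun h => ?_⟩
  rw [zeroLocus_saturation]
  exact subset_zariskiClosure _ ⟨h, hx⟩

end ZeroLocus

/-! ### Zeros of conjugated and specialised ideals -/

section Evaluation

variable {n : ℕ}

theorem eval_map_conj {σ : Type} (x : σ → ℂ) (q : MvPolynomial σ ℂ) :
    MvPolynomial.eval x (MvPolynomial.map (starRingEnd ℂ) q) =
      starRingEnd ℂ (MvPolynomial.eval (fun i => starRingEnd ℂ (x i)) q) := by
  induction q using MvPolynomial.induction_on with
  | C a => simp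
  | add p q hp hq => simp [hp, hq]
  | mul_X p i hp => simp [hp]

theorem eval_comp_inclZ (p : QuadIdx n → ℂ) :
    (MvPolynomial.eval p).comp inclZ = MvPolynomial.eval (fun i => p (Sum.inl (Sum.inl i))) := by
  ext <;> simp [inclZ]

/-- The anti-linear involution of the space of the `(z, w, u, v)` belonging to `conjMap`. -/
def conjPoint (p : QuadIdx n → ℂ) : QuadIdx n → ℂ :=
  fun i => starRingEnd ℂ (p (Sum.map Sum.swap Sum.swap i))

theorem eval_comp_conjMap (p : QuadIdx n → ℂ) :
    (MvPolynomial.eval p).comp conjMap =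
      (starRingEnd ℂ).comp (MvPolynomial.eval (conjPoint p)) := by
  ext <;> simp [conjMap, conjPoint]

theorem eval_comp_specialize (uv x : PairIdx n → ℂ) :
    (MvPolynomial.eval x).comp (specialize uv) = MvPolynomial.eval (Sum.elim x uv) := by
  refine MvPolynomial.ringHom_ext (fun a => by simp [specialize]) fun i => ?_
  cases i <;> simp [specialize]

theorem ker_conj_comp {R : Type} [CommRing R] (φ : R →+* ℂ) :
    RingHom.ker ((starRingEnd ℂ).comp φ) = RingHom.ker φ := by
  ext a; simp [RingHom.mem_ker]

theorem mem_zeroLocus_map_inclZ {I : Ideal (RingZ n)} {p : QuadIdx n → ℂ} :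
    p ∈ MvPolynomial.zeroLocus ℂ (I.map inclZ) ↔
      (fun i => p (Sum.inl (Sum.inl i))) ∈ MvPolynomial.zeroLocus ℂ I := by
  rw [mem_zeroLocus_iff_le_ker, mem_zeroLocus_iff_le_ker, Ideal.map_le_iff_le_comap,
    RingHom.comap_ker, eval_comp_inclZ]

theorem mem_zeroLocus_map_conjMap {I : Ideal (RingZWUV n)} {p : QuadIdx n → ℂ} :
    p ∈ MvPolynomial.zeroLocus ℂ (I.map conjMap) ↔ conjPoint p ∈ MvPolynomial.zeroLocus ℂ I := by
  rw [mem_zeroLocus_iff_le_ker, mem_zeroLocus_iff_le_ker, Ideal.map_le_iff_le_comap,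
    RingHom.comap_ker, eval_comp_conjMap, ker_conj_comp]

theorem mem_zeroLocus_map_specialize {I : Ideal (RingZWUV n)} {uv x : PairIdx n → ℂ} :
    x ∈ MvPolynomial.zeroLocus ℂ (I.map (specialize uv)) ↔
      Sum.elim x uv ∈ MvPolynomial.zeroLocus ℂ I := by
  rw [mem_zeroLocus_iff_le_ker, mem_zeroLocus_iff_le_ker, Ideal.map_le_iff_le_comap,
    RingHom.comap_ker, eval_comp_specialize]

end Evaluation

/-! ## The vHD correspondence over the regular locus -/

section Normal

theorem mem_zeroLocus_minorsIdeal_iff {σ ι κ : Type} {k : ℕ}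
    {M : Matrix ι κ (MvPolynomial σ ℂ)} {x : σ → ℂ} :
    x ∈ MvPolynomial.zeroLocus ℂ (minorsIdeal k M) ↔
      ∀ (a : Fin k → ι) (b : Fin k → κ),
        ((M.map (MvPolynomial.eval x)).submatrix a b).det = 0 := by
  rw [minorsIdeal, MvPolynomial.zeroLocus_span]
  constructor
  · intro h a b
    have := h _ ⟨a, b, rfl⟩
    rw [MvPolynomial.aeval_eq_eval, RingHom.map_det] at this
    exact this
  · rintro h _ ⟨a, b, rfl⟩
    rw [MvPolynomial.aeval_eq_eval, RingHom.map_det]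
    exact h a b

/-- Translates the vanishing of the `(c+1)`-minors of the augmented matrix into a linear condition
on the added row. -/
theorem rank_cons_le_iff {n s : ℕ} {M : Matrix (Fin s) (Fin n) ℂ} {r : Fin n → ℂ} :
    (Matrix.of (Fin.cons r M : Fin (s + 1) → Fin n → ℂ)).rank ≤ M.rank ↔
      r ∈ LinearMap.range M.vecMulLinear := by
  have hrow : Submodule.span ℂ
      (Set.range (Matrix.of (Fin.cons r M : Fin (s + 1) → Fin n → ℂ)).row) =
      Submodule.span ℂ {r} ⊔ Submodule.span ℂ (Set.range M.row) := by
    rw [← Submodule.span_union]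
    congr 1
    exact Fin.range_cons r M
  rw [Matrix.rank_eq_finrank_span_row, Matrix.rank_eq_finrank_span_row, hrow,
    _root_.range_vecMulLinear]
  constructor
  · intro h
    have := Submodule.eq_of_le_of_finrank_le le_sup_right h
    rw [this]
    exact Submodule.mem_sup_left (Submodule.mem_span_singleton_self r)
  · intro h
    rw [sup_eq_right.2 (by rwa [Submodule.span_singleton_le_iff_mem])]

variable {n s : ℕ} (f : Fin s → RingZ n) (c : ℕ)

theorem mem_regX_iff {z : Fin n → ℂ} : z ∈ regX f c ↔ z ∈ varX f ∧ c ≤ (jacAt f z).rank := by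
  have h1 : z ∈ MvPolynomial.zeroLocus ℂ (singIdeal f c) ↔
      z ∈ varX f ∧ z ∈ MvPolynomial.zeroLocus ℂ (minorsIdeal c (jacobian f)) := by
    simp only [varX, mem_zeroLocus_iff_le_ker, singIdeal, sup_le_iff]
  rw [regX, Set.mem_sdiff, h1, mem_zeroLocus_minorsIdeal_iff]
  refine and_congr_right fun hz => ?_
  rw [not_and]
  constructor
  · intro h
    have := h hz
    push Not at this
    obtain ⟨a, b, hab⟩ := this
    exact le_rank_of_det_ne_zero hab
  · intro h _ h2
    obtain ⟨a, b, hab⟩ := exists_submatrix_det_ne_zero h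
    exact hab (h2 a b)

/-- The row space of the Jacobian matrix. -/
noncomputable def normalSpace (z : Fin n → ℂ) : Submodule ℂ (Fin n → ℂ) :=
  LinearMap.range (jacAt f z).vecMulLinear

/-- The points of the vHD correspondence over the regular locus. -/
def critSet : Set (QuadIdx n → ℂ) :=
  {p | (fun i => p (Sum.inl (Sum.inl i))) ∈ regX f c ∧
    (fun i => starRingEnd ℂ (p (Sum.inl (Sum.inr i)))) ∈ regX f c ∧
    (fun i => p (Sum.inr (Sum.inr i)) - p (Sum.inl (Sum.inr i))) ∈
      normalSpace f (fun i => p (Sum.inl (Sum.inl i))) ∧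
    (fun i => starRingEnd ℂ (p (Sum.inr (Sum.inl i)) - p (Sum.inl (Sum.inl i)))) ∈
      normalSpace f (fun i => starRingEnd ℂ (p (Sum.inl (Sum.inr i))))}

variable {f c}

theorem augmentedJacobian_map (p : QuadIdx n → ℂ) :
    (augmentedJacobian f).map (MvPolynomial.eval p) =
      Matrix.of (Fin.cons (fun i => p (Sum.inr (Sum.inr i)) - p (Sum.inl (Sum.inr i)))
        (jacAt f (fun i => p (Sum.inl (Sum.inl i)))) : Fin (s + 1) → Fin n → ℂ) := by
  ext i j
  refine Fin.cases ?_ (fun i => ?_) i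
  · simp [augmentedJacobian, vVar, wVar, Fin.cons_zero]
    rfl
  · simp only [augmentedJacobian, Matrix.map_apply, Matrix.of_apply, Fin.cons_succ, jacAt]
    exact RingHom.congr_fun (eval_comp_inclZ p) _

theorem mem_zeroLocus_rankIdeal_iff (hprime : (idealX f).IsPrime)
    (hc : dimension (varX f) + (c : WithBot ℕ∞) = (n : WithBot ℕ∞)) {p : QuadIdx n → ℂ}
    (hp : (fun i => p (Sum.inl (Sum.inl i))) ∈ regX f c) :
    p ∈ MvPolynomial.zeroLocus ℂ (rankIdeal f c) ↔
      (fun i => p (Sum.inr (Sum.inr i)) - p (Sum.inl (Sum.inr i))) ∈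
        normalSpace f (fun i => p (Sum.inl (Sum.inl i))) := by
  rw [rankIdeal, mem_zeroLocus_minorsIdeal_iff, ← rank_le_iff_forall_det_eq_zero,
    augmentedJacobian_map, normalSpace, ← rank_cons_le_iff]
  obtain ⟨h1, h2⟩ := (mem_regX_iff f c).1 hp
  rw [le_antisymm (rank_jacAt_le hprime hc h1) h2]

theorem mem_zeroLocus_preCriticalIdeal_iff {p : QuadIdx n → ℂ} :
    p ∈ MvPolynomial.zeroLocus ℂ (preCriticalIdeal f c) ↔ p ∘ Sum.inl ∈ prodX f ∧
      p ∈ MvPolynomial.zeroLocus ℂ (rankIdeal f c) ∧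
      conjPoint p ∈ MvPolynomial.zeroLocus ℂ (rankIdeal f c) := by
  have h : p ∈ MvPolynomial.zeroLocus ℂ (preCriticalIdeal f c) ↔
      ((p ∈ MvPolynomial.zeroLocus ℂ ((idealX f).map inclZ) ∧
      p ∈ MvPolynomial.zeroLocus ℂ (((idealX f).map inclZ).map conjMap)) ∧
      p ∈ MvPolynomial.zeroLocus ℂ (rankIdeal f c)) ∧
      p ∈ MvPolynomial.zeroLocus ℂ ((rankIdeal f c).map conjMap) := by
    simp only [mem_zeroLocus_iff_le_ker, preCriticalIdeal, sup_le_iff]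
  rw [h, mem_zeroLocus_map_conjMap, mem_zeroLocus_map_conjMap, mem_zeroLocus_map_inclZ,
    mem_zeroLocus_map_inclZ, and_assoc]
  rfl

theorem mem_zeroLocus_singProductIdeal_iff {p : QuadIdx n → ℂ} :
    p ∈ MvPolynomial.zeroLocus ℂ (singProductIdeal f c) ↔
      (fun i => p (Sum.inl (Sum.inl i))) ∈ MvPolynomial.zeroLocus ℂ (singIdeal f c) ∨
      (fun i => starRingEnd ℂ (p (Sum.inl (Sum.inr i)))) ∈
        MvPolynomial.zeroLocus ℂ (singIdeal f c) := by
  rw [mem_zeroLocus_iff_le_ker, singProductIdeal,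
    Ideal.IsPrime.mul_le (RingHom.ker_isPrime _), ← mem_zeroLocus_iff_le_ker,
    ← mem_zeroLocus_iff_le_ker, mem_zeroLocus_map_conjMap, mem_zeroLocus_map_inclZ,
    mem_zeroLocus_map_inclZ]
  rfl

/-- Off the zeros of the product ideal both `z` and `w̄` are regular and the ranks are exactly `c`.
The starred equations are the unstarred ones at `conjPoint p`. -/
theorem zeroLocus_diff_eq_critSet (hprime : (idealX f).IsPrime)
    (hc : dimension (varX f) + (c : WithBot ℕ∞) = (n : WithBot ℕ∞)) :
    MvPolynomial.zeroLocus ℂ (preCriticalIdeal f c) \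
      MvPolynomial.zeroLocus ℂ (singProductIdeal f c) = critSet f c := by
  ext p
  rw [Set.mem_sdiff, mem_zeroLocus_preCriticalIdeal_iff, mem_zeroLocus_singProductIdeal_iff]
  constructor
  · rintro ⟨⟨⟨h1, h2⟩, h3, h4⟩, h5⟩
    rw [not_or] at h5
    have hz : (fun i => p (Sum.inl (Sum.inl i))) ∈ regX f c := ⟨h1, h5.1⟩
    have hw : (fun i => conjPoint p (Sum.inl (Sum.inl i))) ∈ regX f c := ⟨h2, h5.2⟩
    refine ⟨hz, hw, (mem_zeroLocus_rankIdeal_iff hprime hc hz).1 h3, ?_⟩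
    simpa [conjPoint] using (mem_zeroLocus_rankIdeal_iff hprime hc hw).1 h4
  · rintro ⟨hz, hw, h3, h4⟩
    refine ⟨⟨⟨hz.1, hw.1⟩, (mem_zeroLocus_rankIdeal_iff hprime hc hz).2 h3, ?_⟩,
      not_or.2 ⟨hz.2, hw.2⟩⟩
    rw [mem_zeroLocus_rankIdeal_iff hprime hc (p := conjPoint p) hw]
    simpa [conjPoint] using h4

theorem vHDCorrespondence_eq (hprime : (idealX f).IsPrime)
    (hc : dimension (varX f) + (c : WithBot ℕ∞) = (n : WithBot ℕ∞)) :
    vHDCorrespondence f c = zariskiClosure (critSet f c) := by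
  rw [vHDCorrespondence, hermitianCriticalIdeal, zeroLocus_saturation,
    zeroLocus_diff_eq_critSet hprime hc]

/-- The closure adds no points over `X_∘`: a saturation does not change zeros outside the zeros of
the ideal saturated by. -/
theorem vHDCorrespondenceReg_eq (hprime : (idealX f).IsPrime)
    (hc : dimension (varX f) + (c : WithBot ℕ∞) = (n : WithBot ℕ∞)) :
    vHDCorrespondenceReg f c = critSet f c := by
  rw [← zeroLocus_diff_eq_critSet hprime hc]
  ext p
  have hsing := mem_zeroLocus_singProductIdeal_iff (f := f) (c := c) (p := p)
  constructor
  · rintro ⟨h1, h2⟩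
    have h3 : p ∉ MvPolynomial.zeroLocus ℂ (singProductIdeal f c) := by
      rw [hsing, not_or]; exact ⟨h2.1.2, h2.2.2⟩
    exact ⟨(mem_zeroLocus_saturation_iff h3).1 h1, h3⟩
  · rintro ⟨h1, h2⟩
    refine ⟨(mem_zeroLocus_saturation_iff h2).2 h1, ?_⟩
    have h3 := (mem_zeroLocus_preCriticalIdeal_iff.1 h1).1
    rw [hsing, not_or] at h2
    exact ⟨⟨h3.1, h2.1⟩, ⟨h3.2, h2.2⟩⟩

/-- This is the closure of a fibre of `critSet`, which need not be the fibre of the closure. The two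
are compared for generic `uv` in `encard_zeroLocus_hermitianCriticalIdealAt`. -/
theorem zeroLocus_hermitianCriticalIdealAt (hprime : (idealX f).IsPrime)
    (hc : dimension (varX f) + (c : WithBot ℕ∞) = (n : WithBot ℕ∞)) (uv : PairIdx n → ℂ) :
    MvPolynomial.zeroLocus ℂ (hermitianCriticalIdealAt f c uv) =
      zariskiClosure {x | Sum.elim x uv ∈ critSet f c} := by
  rw [hermitianCriticalIdealAt, zeroLocus_saturation, ← zeroLocus_diff_eq_critSet hprime hc]
  congr 1
  ext x
  simp only [Set.mem_sdiff, mem_zeroLocus_map_specialize, Set.mem_ofPred_eq]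

theorem vHDCorrespondence_subset {p : QuadIdx n → ℂ} (hp : p ∈ vHDCorrespondence f c) :
    p ∘ Sum.inl ∈ prodX f :=
  (mem_zeroLocus_preCriticalIdeal_iff.1
    (MvPolynomial.zeroLocus_anti_mono (le_saturation _ _) hp)).1

/-- The regular locus is not empty. More precisely, no polynomial outside of the ideal of the
variety vanishes on it. -/
theorem exists_mem_regX (hprime : (idealX f).IsPrime)
    (hc : dimension (varX f) + (c : WithBot ℕ∞) = (n : WithBot ℕ∞)) {q : RingZ n}
    (hq : q ∉ idealX f) : ∃ z ∈ regX f c, MvPolynomial.eval z q ≠ 0 := by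
  obtain ⟨a, b, hab⟩ := exists_minor_notMem hprime hc
  have h := hprime.mul_notMem hq hab
  rw [← MvPolynomial.IsPrime.vanishingIdeal_zeroLocus (K := ℂ) (idealX f),
    MvPolynomial.mem_vanishingIdeal_iff] at h
  push Not at h
  obtain ⟨z, hz, hzq⟩ := h
  rw [MvPolynomial.aeval_eq_eval, map_mul, RingHom.map_det] at hzq
  exact ⟨z, (mem_regX_iff f c).2 ⟨hz, le_rank_of_det_ne_zero (right_ne_zero_of_mul hzq)⟩,
    left_ne_zero_of_mul hzq⟩

end Normal

/-! ## The vector bundle -/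

section VectorBundle

theorem isRegularFunctionOn_of_eval_div {σ : Type} {S : Set (σ → ℂ)} {f : (σ → ℂ) → ℂ}
    (g h : MvPolynomial σ ℂ) (hh : ∀ p ∈ S, MvPolynomial.eval p h ≠ 0)
    (hf : ∀ x ∈ S, f x = MvPolynomial.eval x g / MvPolynomial.eval x h) :
    IsRegularFunctionOn S f :=
  fun p hp => ⟨g, h, hh p hp, fun x hx _ => hf x hx⟩

theorem isZariskiOpen_setOf_eval_ne_zero {σ : Type} (q : MvPolynomial σ ℂ) :
    IsZariskiOpen {x : σ → ℂ | MvPolynomial.eval x q ≠ 0} := by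
  refine ⟨Ideal.span {q}, ?_⟩
  ext x
  simp [MvPolynomial.zeroLocus_span, MvPolynomial.aeval_eq_eval]

/-- A trivialization of a family of affine subspaces, given by a matrix of polynomials with an
invertible square submatrix. -/
theorem exists_trivialization {σ ι : Type} [Finite σ] [Fintype ι] [DecidableEq ι] {r : ℕ}
    (e : ι ≃ Fin r) (P : Matrix ι σ (MvPolynomial σ ℂ)) (b : ι → σ) {B : Set (σ → ℂ)}
    {E : Set (σ ⊕ σ → ℂ)}
    (hE : ∀ x ∈ B, MvPolynomial.eval x (P.submatrix id b).det ≠ 0 → ∀ y, Sum.elim x y ∈ E ↔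
      ∃ t : ι → ℂ, y = x + Matrix.vecMul t (P.map (MvPolynomial.eval x)))
    {x₀ : σ → ℂ}
    (hx₀ : MvPolynomial.eval x₀ (P.submatrix id b).det ≠ 0) :
    ∃ U : Set (σ → ℂ), IsZariskiOpen U ∧ x₀ ∈ U ∧
    ∃ (φ : (σ → ℂ) → ((Fin r → ℂ) →ₗ[ℂ] (σ → ℂ))) (ψ : (σ ⊕ σ → ℂ) → (Fin r → ℂ)),
      IsRegularMapOn {p : σ ⊕ Fin r → ℂ | p ∘ Sum.inl ∈ B ∩ U}
        (fun p => p ∘ Sum.inl + φ (p ∘ Sum.inl) (p ∘ Sum.inr)) ∧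
      IsRegularMapOn {p : σ ⊕ σ → ℂ | p ∈ E ∧ p ∘ Sum.inl ∈ U} ψ ∧
      (∀ x ∈ B ∩ U, ∀ t, Sum.elim x (x + φ x t) ∈ E ∧
        ψ (Sum.elim x (x + φ x t)) = t) ∧
      (∀ x ∈ B ∩ U, ∀ y, Sum.elim x y ∈ E → x + φ x (ψ (Sum.elim x y)) = y) := by
  have hdet : ∀ x, MvPolynomial.eval x (P.submatrix id b).det =
      ((P.map (MvPolynomial.eval x)).submatrix id b).det := fun x => by
    rw [RingHom.map_det]; rfl
  let M : (σ → ℂ) → Matrix ι σ ℂ := fun x => P.map (MvPolynomial.eval x)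
  let φ : (σ → ℂ) → ((Fin r → ℂ) →ₗ[ℂ] (σ → ℂ)) := fun x =>
    (M x).vecMulLinear.comp (LinearMap.funLeft ℂ ℂ e)
  -- The inverse reads off the coordinates selected by `b` and solves the square system; Cramer's
  -- rule makes it regular.
  let ψ : (σ ⊕ σ → ℂ) → (Fin r → ℂ) := fun p i =>
    Matrix.vecMul (fun j => p (Sum.inr (b j)) - p (Sum.inl (b j)))
      ((M (p ∘ Sum.inl)).submatrix id b)⁻¹ (e.symm i)
  have key : ∀ x, MvPolynomial.eval x (P.submatrix id b).det ≠ 0 → ∀ t : Fin r → ℂ,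
      ψ (Sum.elim x (x + φ x t)) = t := by
    intro x hx t
    have hu : IsUnit ((M x).submatrix id b).det := by
      rw [hdet] at hx; exact isUnit_iff_ne_zero.2 hx
    ext i
    have h1 : (fun j => (Sum.elim x (x + φ x t) : σ ⊕ σ → ℂ) (Sum.inr (b j)) -
        (Sum.elim x (x + φ x t) : σ ⊕ σ → ℂ) (Sum.inl (b j))) =
        Matrix.vecMul (t ∘ e) ((M x).submatrix id b) := by
      ext j
      simp only [Sum.elim_inr, Sum.elim_inl, Pi.add_apply, add_sub_cancel_left]
      rfl
    change Matrix.vecMul _ ((M x).submatrix id b)⁻¹ (e.symm i) = t i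
    rw [h1, Matrix.vecMul_vecMul, Matrix.mul_nonsing_inv _ hu, Matrix.vecMul_one]
    simp
  refine ⟨{x | MvPolynomial.eval x (P.submatrix id b).det ≠ 0},
    isZariskiOpen_setOf_eval_ne_zero _, hx₀, φ, ψ, fun k => ?_, fun k => ?_, ?_, ?_⟩
  · refine isRegularFunctionOn_of_eval_div
      (MvPolynomial.X (Sum.inl k) + ∑ i, MvPolynomial.X (Sum.inr (e i)) *
        MvPolynomial.rename Sum.inl (P i k)) 1 (by simp) fun p hp => ?_
    simp [φ, M, Matrix.vecMul, dotProduct, LinearMap.funLeft, MvPolynomial.eval_rename]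
  · refine isRegularFunctionOn_of_eval_div
      (∑ j, (MvPolynomial.X (Sum.inr (b j)) - MvPolynomial.X (Sum.inl (b j))) *
        MvPolynomial.rename Sum.inl ((P.submatrix id b).adjugate j (e.symm k)))
      (MvPolynomial.rename Sum.inl (P.submatrix id b).det) ?_ fun p hp => ?_
    · intro p hp
      rw [MvPolynomial.eval_rename]
      exact hp.2
    · have hadj : ∀ j l, MvPolynomial.eval (p ∘ Sum.inl) ((P.submatrix id b).adjugate j l) =
          ((M (p ∘ Sum.inl)).submatrix id b).adjugate j l := fun j l => by
        have := RingHom.map_adjugate (MvPolynomial.eval (p ∘ Sum.inl)) (P.submatrix id b)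
        exact congrFun (congrFun this j) l
      have hinv : ((M (p ∘ Sum.inl)).submatrix id b)⁻¹ =
          (MvPolynomial.eval (p ∘ Sum.inl) (P.submatrix id b).det)⁻¹ •
            ((M (p ∘ Sum.inl)).submatrix id b).adjugate := by
        rw [Matrix.inv_def, Ring.inverse_eq_inv', hdet]
      simp only [ψ, hinv, Matrix.vecMul, dotProduct, Matrix.smul_apply, smul_eq_mul,
        MvPolynomial.eval_rename, map_sum, map_mul, map_sub, MvPolynomial.eval_X, hadj]
      rw [div_eq_inv_mul, Finset.mul_sum]
      exact Finset.sum_congr rfl fun j _ => by ring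
  · rintro x ⟨hxB, hxU⟩ t
    exact ⟨(hE x hxB hxU _).2 ⟨t ∘ e, rfl⟩, key x hxU t⟩
  · rintro x ⟨hxB, hxU⟩ y hy
    obtain ⟨t, rfl⟩ := (hE x hxB hxU y).1 hy
    have h1 : x + Matrix.vecMul t (P.map (MvPolynomial.eval x)) = x + φ x (t ∘ e.symm) := by
      simp [φ, M, LinearMap.funLeft, Function.comp_assoc]
    rw [h1, key x hxU]

variable {n s : ℕ} {f : Fin s → RingZ n} {c : ℕ}

/-- The `c` chosen rows are independent and the whole row space has dimension at most `c`. -/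
theorem normalSpace_eq_of_minor_ne_zero (hprime : (idealX f).IsPrime)
    (hc : dimension (varX f) + (c : WithBot ℕ∞) = (n : WithBot ℕ∞)) {z : Fin n → ℂ}
    (hz : z ∈ varX f) {a : Fin c → Fin s} {b : Fin c → Fin n}
    (hab : ((jacAt f z).submatrix a b).det ≠ 0) :
    normalSpace f z = LinearMap.range ((jacAt f z).submatrix a id).vecMulLinear := by
  have h1 : c ≤ ((jacAt f z).submatrix a id).rank :=
    le_rank_of_det_ne_zero (a := id) (b := b) hab
  have h2 := rank_jacAt_le hprime hc hz
  rw [normalSpace]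
  rw [Matrix.rank_eq_finrank_span_row] at h1 h2
  rw [range_vecMulLinear, range_vecMulLinear]
  refine (Submodule.eq_of_le_of_finrank_le (Submodule.span_mono ?_) (h2.trans h1)).symm
  rintro _ ⟨i, rfl⟩
  exact ⟨a i, rfl⟩

theorem isAlgebraicVectorBundle_vHDCorrespondenceReg (hprime : (idealX f).IsPrime)
    (hc : dimension (varX f) + (c : WithBot ℕ∞) = (n : WithBot ℕ∞)) :
    IsAlgebraicVectorBundle (prodReg f c) (vHDCorrespondenceReg f c) (fun zw => zw) (2 * c) := by
  refine ⟨fun x y h => h.2, fun x₀ hx₀ => ?_⟩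
  obtain ⟨a, b, hab⟩ := exists_submatrix_det_ne_zero ((mem_regX_iff f c).1 hx₀.1).2
  obtain ⟨a', b', hab'⟩ := exists_submatrix_det_ne_zero ((mem_regX_iff f c).1 hx₀.2).2
  let e : Fin c ⊕ Fin c ≃ Fin (2 * c) := finSumFinEquiv.trans (finCongr (two_mul c).symm)
  -- A frame of the bundle: Jacobian rows at `z` in the `v` directions, and conjugated Jacobian rows
  -- at `w̄`, which are polynomial in `w`, in the `u` directions.
  let P : Matrix (Fin c ⊕ Fin c) (PairIdx n) (RingZW n) := Matrix.of <| Sum.elim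
    (fun i => Sum.elim 0 (fun j => MvPolynomial.rename Sum.inl (jacobian f (a i) j)))
    (fun i => Sum.elim (fun j => MvPolynomial.rename Sum.inr
      (MvPolynomial.map (starRingEnd ℂ) (jacobian f (a' i) j))) 0)
  -- The `v` columns come first, which makes the square submatrix block diagonal.
  let β : Fin c ⊕ Fin c → PairIdx n := Sum.elim (fun i => Sum.inr (b i)) (fun i => Sum.inl (b' i))
  have hP : ∀ x : PairIdx n → ℂ, MvPolynomial.eval x (P.submatrix id β).det =
      ((jacAt f (x ∘ Sum.inl)).submatrix a b).det *
        starRingEnd ℂ ((jacAt f (fun i => starRingEnd ℂ (x (Sum.inr i)))).submatrix a' b').det := by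
    intro x
    have h1 : (P.submatrix id β).map (MvPolynomial.eval x) = Matrix.fromBlocks
        ((jacAt f (x ∘ Sum.inl)).submatrix a b) 0 0
        ((starRingEnd ℂ).mapMatrix
          ((jacAt f (fun i => starRingEnd ℂ (x (Sum.inr i)))).submatrix a' b')) := by
      ext i j
      cases i <;> cases j <;>
        simp [P, β, MvPolynomial.eval_rename, jacAt, eval_map_conj, Function.comp_def,
          -MvPolynomial.eval_map]
    rw [RingHom.map_det, RingHom.mapMatrix_apply, h1, Matrix.det_fromBlocks_zero₂₁,
      ← RingHom.map_det]
  refine exists_trivialization e P β (fun x hx hdet y => ?_) ?_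
  · rw [hP, mul_ne_zero_iff] at hdet
    have hn1 := normalSpace_eq_of_minor_ne_zero hprime hc hx.1.1 hdet.1
    have hn2 := normalSpace_eq_of_minor_ne_zero hprime hc hx.2.1
      (fun h => hdet.2 (by rw [h, map_zero]))
    rw [vHDCorrespondenceReg_eq hprime hc]
    have hvec : ∀ t : Fin c ⊕ Fin c → ℂ, Matrix.vecMul t (P.map (MvPolynomial.eval x)) =
        Sum.elim (fun j => starRingEnd ℂ (Matrix.vecMul (fun i => starRingEnd ℂ (t (Sum.inr i)))
          ((jacAt f (fun i => starRingEnd ℂ (x (Sum.inr i)))).submatrix a' id) j))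
        (Matrix.vecMul (t ∘ Sum.inl) ((jacAt f (x ∘ Sum.inl)).submatrix a id)) := by
      intro t
      ext j
      cases j <;> simp [P, Matrix.vecMul, dotProduct, MvPolynomial.eval_rename, jacAt,
        eval_map_conj, Function.comp_def,
          -MvPolynomial.eval_map]
    constructor
    · rintro ⟨-, -, h3, h4⟩
      simp only [Sum.elim_inl, Sum.elim_inr] at h3 h4
      change _ ∈ normalSpace f (x ∘ Sum.inl) at h3
      rw [hn1] at h3
      rw [hn2] at h4
      obtain ⟨t, ht⟩ := h3
      obtain ⟨t', ht'⟩ := h4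
      refine ⟨Sum.elim t (fun i => starRingEnd ℂ (t' i)), ?_⟩
      rw [hvec]
      ext j
      cases j with
      | inl j =>
        have := congrFun ht' j
        simp only [Matrix.vecMulLinear_apply] at this
        simp [this]
      | inr j =>
        have := congrFun ht j
        simp only [Matrix.vecMulLinear_apply] at this
        simp [this]
    · rintro ⟨t, rfl⟩
      refine ⟨hx.1, hx.2, ?_, ?_⟩
      · simp only [Sum.elim_inl, Sum.elim_inr]
        change _ ∈ normalSpace f (x ∘ Sum.inl)
        rw [hn1]
        refine ⟨t ∘ Sum.inl, ?_⟩
        rw [hvec]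
        ext j
        simp
      · simp only [Sum.elim_inl, Sum.elim_inr]
        rw [hn2]
        refine ⟨fun i => starRingEnd ℂ (t (Sum.inr i)), ?_⟩
        rw [hvec]
        ext j
        simp
  · rw [hP]
    exact mul_ne_zero hab ((map_ne_zero _).2 hab')

end VectorBundle

/-! ## Irreducibility -/

section Irreducible

variable {σ τ : Type}

/-- Two polynomials neither of which vanishes identically on `S` have a common point of `S` where
they do not vanish. -/
def IsPolyIrreducible (S : Set (σ → ℂ)) : Prop :=
  ∀ p q : MvPolynomial σ ℂ, (∃ x ∈ S, MvPolynomial.eval x p ≠ 0) →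
    (∃ x ∈ S, MvPolynomial.eval x q ≠ 0) →
    ∃ x ∈ S, MvPolynomial.eval x p ≠ 0 ∧ MvPolynomial.eval x q ≠ 0

theorem mem_vanishingIdeal_iff_eval {S : Set (σ → ℂ)} {p : MvPolynomial σ ℂ} :
    p ∈ MvPolynomial.vanishingIdeal ℂ S ↔ ∀ x ∈ S, MvPolynomial.eval x p = 0 := by
  simp [MvPolynomial.mem_vanishingIdeal_iff, MvPolynomial.aeval_eq_eval]

theorem IsPolyIrreducible.isPrime_vanishingIdeal {S : Set (σ → ℂ)} (hS : IsPolyIrreducible S)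
    (hne : S.Nonempty) : (MvPolynomial.vanishingIdeal ℂ S).IsPrime := by
  refine ⟨fun h => ?_, fun {p q} hpq => ?_⟩
  · obtain ⟨x, hx⟩ := hne
    have : (1 : MvPolynomial σ ℂ) ∈ MvPolynomial.vanishingIdeal ℂ S := h ▸ Submodule.mem_top
    simpa using mem_vanishingIdeal_iff_eval.1 this x hx
  · by_contra! hcon
    simp only [mem_vanishingIdeal_iff_eval] at hcon hpq
    push Not at hcon
    obtain ⟨x, hx, hp, hq⟩ := hS p q hcon.1 hcon.2
    have := hpq x hx
    rw [map_mul] at this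
    exact mul_ne_zero hp hq this

theorem isPolyIrreducible_univ [Finite σ] : IsPolyIrreducible (Set.univ : Set (σ → ℂ)) := by
  rintro p q ⟨x, -, hx⟩ ⟨y, -, hy⟩
  have hp : p ≠ 0 := by rintro rfl; simp at hx
  have hq : q ≠ 0 := by rintro rfl; simp at hy
  by_contra! hcon
  refine mul_ne_zero hp hq (MvPolynomial.funext fun z => ?_)
  by_cases h : MvPolynomial.eval z p = 0
  · simp [h]
  · simp [hcon z trivial h]

/-- Evaluation of a polynomial in some of its variables. -/
noncomputable def partialEval (y : τ → ℂ) : MvPolynomial (σ ⊕ τ) ℂ →ₐ[ℂ] MvPolynomial σ ℂ :=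
  MvPolynomial.aeval (Sum.elim MvPolynomial.X (fun i => MvPolynomial.C (y i)))

theorem eval_partialEval (x : σ → ℂ) (y : τ → ℂ) (p : MvPolynomial (σ ⊕ τ) ℂ) :
    MvPolynomial.eval x (partialEval y p) = MvPolynomial.eval (Sum.elim x y) p := by
  have : (MvPolynomial.eval x).comp (partialEval y).toRingHom =
      MvPolynomial.eval (Sum.elim x y) := by
    refine MvPolynomial.ringHom_ext (fun a => by simp [partialEval]) fun i => ?_
    cases i <;> simp [partialEval]
  exact RingHom.congr_fun this p

/-- Freeze the second block at a good point for each polynomial to find a common first block, then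
keep that one fixed and find a common second block. -/
theorem IsPolyIrreducible.prod {S : Set (σ → ℂ)} {T : Set (τ → ℂ)} (hS : IsPolyIrreducible S)
    (hT : IsPolyIrreducible T) :
    IsPolyIrreducible {p : σ ⊕ τ → ℂ | p ∘ Sum.inl ∈ S ∧ p ∘ Sum.inr ∈ T} := by
  rintro p q ⟨x, ⟨hxS, hxT⟩, hx⟩ ⟨y, ⟨hyS, hyT⟩, hy⟩
  have hswap : ∀ (a : σ → ℂ) (b : τ → ℂ) (r : MvPolynomial (σ ⊕ τ) ℂ),
      MvPolynomial.eval b (partialEval a (MvPolynomial.rename Sum.swap r)) =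
        MvPolynomial.eval (Sum.elim a b) r := fun a b r => by
    rw [eval_partialEval, MvPolynomial.eval_rename]
    congr 2
    ext i
    cases i <;> simp
  rw [← Sum.elim_comp_inl_inr x] at hx
  rw [← Sum.elim_comp_inl_inr y] at hy
  rw [← eval_partialEval] at hx hy
  obtain ⟨a, ha, h1, h2⟩ := hS _ _ ⟨_, hxS, hx⟩ ⟨_, hyS, hy⟩
  rw [eval_partialEval, ← hswap] at h1 h2
  obtain ⟨b, hb, h3, h4⟩ := hT _ _ ⟨_, hxT, h1⟩ ⟨_, hyT, h2⟩
  rw [hswap] at h3 h4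
  exact ⟨Sum.elim a b, ⟨by simpa using ha, by simpa using hb⟩, h3, h4⟩

theorem IsPolyIrreducible.image {S : Set (σ → ℂ)} (hS : IsPolyIrreducible S)
    (g : τ → MvPolynomial σ ℂ) :
    IsPolyIrreducible ((fun x i => MvPolynomial.eval x (g i)) '' S) := by
  have h : ∀ x p, MvPolynomial.eval (fun i => MvPolynomial.eval x (g i)) p =
      MvPolynomial.eval x (MvPolynomial.bind₁ g p) := fun x p => by
    have := MvPolynomial.eval₂Hom_bind₁ (RingHom.id ℂ) x g p
    exact this.symm
  rintro p q ⟨_, ⟨x, hxS, rfl⟩, hx⟩ ⟨_, ⟨y, hyS, rfl⟩, hy⟩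
  simp only [h] at hx hy
  obtain ⟨a, ha, h1, h2⟩ := hS _ _ ⟨_, hxS, hx⟩ ⟨_, hyS, hy⟩
  rw [← h] at h1 h2
  exact ⟨_, ⟨a, ha, rfl⟩, h1, h2⟩

theorem IsPolyIrreducible.conj {S : Set (σ → ℂ)} (hS : IsPolyIrreducible S) :
    IsPolyIrreducible {w : σ → ℂ | (fun i => starRingEnd ℂ (w i)) ∈ S} := by
  have h : ∀ (w : σ → ℂ) (p : MvPolynomial σ ℂ),
      MvPolynomial.eval (fun i => starRingEnd ℂ (w i)) (MvPolynomial.map (starRingEnd ℂ) p) ≠ 0 ↔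
        MvPolynomial.eval w p ≠ 0 := fun w p => by
    rw [eval_map_conj]; simp
  rintro p q ⟨x, hxS, hx⟩ ⟨y, hyS, hy⟩
  rw [← h] at hx hy
  obtain ⟨a, ha, h1, h2⟩ := hS _ _ ⟨_, hxS, hx⟩ ⟨_, hyS, hy⟩
  refine ⟨fun i => starRingEnd ℂ (a i), by simpa using ha, ?_, ?_⟩
  · rw [← h]; simpa using h1
  · rw [← h]; simpa using h2

theorem isIrreducibleVariety_zariskiClosure {S : Set (σ → ℂ)}
    (hS : (MvPolynomial.vanishingIdeal ℂ S).IsPrime) (hne : S.Nonempty) :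
    IsIrreducibleVariety (zariskiClosure S) := by
  refine ⟨⟨_, rfl⟩, hne.mono (subset_zariskiClosure S), ?_⟩
  rintro _ _ ⟨I, rfl⟩ ⟨J, rfl⟩ hIJ
  rw [zariskiClosure_subset_iff, zariskiClosure_subset_iff]
  by_contra! hcon
  obtain ⟨⟨x, hxS, hx⟩, ⟨y, hyS, hy⟩⟩ := hcon.imp Set.not_subset.1 Set.not_subset.1
  rw [mem_zeroLocus_iff_le_ker] at hx hy
  obtain ⟨p, hpI, hp⟩ := SetLike.not_le_iff_exists.1 hx
  obtain ⟨q, hqJ, hq⟩ := SetLike.not_le_iff_exists.1 hy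
  refine hS.mul_notMem (x := p) (y := q)
    (fun h => hp (mem_vanishingIdeal_iff_eval.1 h x hxS))
    (fun h => hq (mem_vanishingIdeal_iff_eval.1 h y hyS)) ?_
  rw [mem_vanishingIdeal_iff_eval]
  intro a ha
  rw [map_mul]
  rcases hIJ (subset_zariskiClosure S ha) with h | h
  · rw [show MvPolynomial.eval a p = 0 from mem_zeroLocus_iff_le_ker.1 h hpI, zero_mul]
  · rw [show MvPolynomial.eval a q = 0 from mem_zeroLocus_iff_le_ker.1 h hqJ, mul_zero]

end Irreducible

/-! ### Parametrisation and irreducibility of the correspondence -/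

section CritSet

variable {n s : ℕ} {f : Fin s → RingZ n} {c : ℕ}

theorem isPolyIrreducible_regX (hprime : (idealX f).IsPrime)
    (hc : dimension (varX f) + (c : WithBot ℕ∞) = (n : WithBot ℕ∞)) :
    IsPolyIrreducible (regX f c) := by
  have h : ∀ p : RingZ n, (∃ x ∈ regX f c, MvPolynomial.eval x p ≠ 0) → p ∉ idealX f := by
    rintro p ⟨x, hx, hxp⟩ hp
    exact hxp (mem_zeroLocus_iff_le_ker.1 hx.1 hp)
  intro p q hp hq
  obtain ⟨z, hz, hzpq⟩ := exists_mem_regX hprime hc (hprime.mul_notMem (h p hp) (h q hq))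
  rw [map_mul] at hzpq
  exact ⟨z, hz, left_ne_zero_of_mul hzpq, right_ne_zero_of_mul hzpq⟩

theorem regX_nonempty (hprime : (idealX f).IsPrime)
    (hc : dimension (varX f) + (c : WithBot ℕ∞) = (n : WithBot ℕ∞)) : (regX f c).Nonempty := by
  obtain ⟨z, hz, -⟩ := exists_mem_regX hprime hc
    (fun h => hprime.ne_top ((Ideal.eq_top_iff_one _).2 h))
  exact ⟨z, hz⟩

/-- The coordinates of the point of `critSet` with given `z`, `w` and given coefficients of the
normal vectors with respect to the rows of the Jacobian matrices. -/
noncomputable def critParam (f : Fin s → RingZ n) : QuadIdx n →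
    MvPolynomial (PairIdx n ⊕ PairIdx s) ℂ :=
  Sum.elim (fun i => MvPolynomial.X (Sum.inl i))
    (Sum.elim
      (fun j => MvPolynomial.X (Sum.inl (Sum.inl j)) + ∑ i, MvPolynomial.X (Sum.inr (Sum.inl i)) *
        MvPolynomial.rename (fun k => Sum.inl (Sum.inr k))
          (MvPolynomial.map (starRingEnd ℂ) (jacobian f i j)))
      (fun j => MvPolynomial.X (Sum.inl (Sum.inr j)) + ∑ i, MvPolynomial.X (Sum.inr (Sum.inr i)) *
        MvPolynomial.rename (fun k => Sum.inl (Sum.inl k)) (jacobian f i j)))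

/-- The coefficients of a normal vector are not unique, but surjectivity is all that irreducibility
needs. -/
theorem critSet_eq_image : critSet f c =
    (fun x i => MvPolynomial.eval x (critParam f i)) '' {p : PairIdx n ⊕ PairIdx s → ℂ |
      p ∘ Sum.inl ∈ {q : PairIdx n → ℂ | q ∘ Sum.inl ∈ regX f c ∧
        q ∘ Sum.inr ∈ {w | (fun i => starRingEnd ℂ (w i)) ∈ regX f c}} ∧
      p ∘ Sum.inr ∈ (Set.univ : Set (PairIdx s → ℂ))} := by
  ext p
  constructor
  · rintro ⟨hz, hw, ⟨t, ht⟩, ⟨t', ht'⟩⟩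
    refine ⟨Sum.elim (p ∘ Sum.inl) (Sum.elim (fun i => starRingEnd ℂ (t' i)) t),
      ⟨⟨hz, hw⟩, trivial⟩, ?_⟩
    ext i
    rcases i with (i | i) | (i | i)
    · simp [critParam]
    · simp [critParam]
    · have := congrArg (starRingEnd ℂ) (congrFun ht' i)
      simp only [Matrix.vecMulLinear_apply, Matrix.vecMul, dotProduct, map_sum, map_mul,
        map_sub, Complex.conj_conj, jacAt, Matrix.map_apply] at this
      simp [critParam, MvPolynomial.eval_rename, eval_map_conj, -MvPolynomial.eval_map,
        Function.comp_def, this]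
    · have := congrFun ht i
      simp only [Matrix.vecMulLinear_apply, Matrix.vecMul, dotProduct, jacAt,
        Matrix.map_apply] at this
      simp [critParam, MvPolynomial.eval_rename, Function.comp_def, this]
  · rintro ⟨x, ⟨⟨hz, hw⟩, -⟩, rfl⟩
    have hz' : (fun i => x (Sum.inl (Sum.inl i))) ∈ regX f c := hz
    have hw' : (fun i => starRingEnd ℂ (x (Sum.inl (Sum.inr i)))) ∈ regX f c := hw
    refine ⟨by simpa [critParam] using hz', by simpa [critParam] using hw',
      ⟨fun i => x (Sum.inr (Sum.inr i)), ?_⟩,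
      ⟨fun i => starRingEnd ℂ (x (Sum.inr (Sum.inl i))), ?_⟩⟩
    · ext j
      simp [critParam, MvPolynomial.eval_rename, Function.comp_def, Matrix.vecMul, dotProduct,
        jacAt]
    · ext j
      simp [critParam, MvPolynomial.eval_rename, Function.comp_def, Matrix.vecMul, dotProduct,
        jacAt, eval_map_conj, -MvPolynomial.eval_map]

theorem critSet_nonempty (hprime : (idealX f).IsPrime)
    (hc : dimension (varX f) + (c : WithBot ℕ∞) = (n : WithBot ℕ∞)) : (critSet f c).Nonempty := by
  obtain ⟨z, hz⟩ := regX_nonempty hprime hc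
  refine ⟨Sum.elim (Sum.elim z (fun i => starRingEnd ℂ (z i)))
    (Sum.elim z (fun i => starRingEnd ℂ (z i))), by simpa using hz, by simpa using hz, ?_, ?_⟩
  · simp only [Sum.elim_inl, Sum.elim_inr, sub_self]
    exact (normalSpace f _).zero_mem
  · simp only [Sum.elim_inl, Sum.elim_inr, sub_self, map_zero]
    exact (normalSpace f _).zero_mem

/-- The prime ideal of the vHD correspondence. -/
noncomputable abbrev critIdeal (f : Fin s → RingZ n) (c : ℕ) : Ideal (RingZWUV n) :=
  MvPolynomial.vanishingIdeal ℂ (critSet f c)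

theorem isPrime_critIdeal (hprime : (idealX f).IsPrime)
    (hc : dimension (varX f) + (c : WithBot ℕ∞) = (n : WithBot ℕ∞)) : (critIdeal f c).IsPrime := by
  refine IsPolyIrreducible.isPrime_vanishingIdeal ?_ (critSet_nonempty hprime hc)
  rw [critSet_eq_image]
  exact (((isPolyIrreducible_regX hprime hc).prod (isPolyIrreducible_regX hprime hc).conj).prod
    isPolyIrreducible_univ).image _

theorem isIrreducibleVariety_vHDCorrespondence (hprime : (idealX f).IsPrime)
    (hc : dimension (varX f) + (c : WithBot ℕ∞) = (n : WithBot ℕ∞)) :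
    IsIrreducibleVariety (vHDCorrespondence f c) := by
  rw [vHDCorrespondence_eq hprime hc]
  exact isIrreducibleVariety_zariskiClosure (isPrime_critIdeal hprime hc)
    (critSet_nonempty hprime hc)

end CritSet

/-! ## Critical points and nearest points -/

section Nearest

variable {n s : ℕ} {f : Fin s → RingZ n} {c : ℕ}

/-- If `r` kills the kernel, adding it as a row keeps the kernel, and by rank-nullity also the rank.
-/
theorem mem_normalSpace_iff {z r : Fin n → ℂ} :
    r ∈ normalSpace f z ↔ ∀ t, (jacAt f z).mulVec t = 0 → ∑ i, r i * t i = 0 := by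
  constructor
  · rintro ⟨a, rfl⟩ t ht
    change Matrix.vecMul a (jacAt f z) ⬝ᵥ t = 0
    rw [← Matrix.dotProduct_mulVec, ht, dotProduct_zero]
  · intro h
    rw [normalSpace, ← rank_cons_le_iff]
    set M' := Matrix.of (Fin.cons r (jacAt f z) : Fin (s + 1) → Fin n → ℂ)
    have h1 := M'.mulVecLin.finrank_range_add_finrank_ker
    have h2 := (jacAt f z).mulVecLin.finrank_range_add_finrank_ker
    have h3 : LinearMap.ker (jacAt f z).mulVecLin ≤ LinearMap.ker M'.mulVecLin := by
      intro t ht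
      rw [LinearMap.mem_ker] at ht ⊢
      ext i
      refine Fin.cases ?_ (fun i => ?_) i
      · exact h t ht
      · exact congrFun ht i
    have h4 := Submodule.finrank_mono h3
    change Module.finrank ℂ (LinearMap.range M'.mulVecLin) ≤
      Module.finrank ℂ (LinearMap.range (jacAt f z).mulVecLin)
    omega

theorem hasFDerivAt_sqDist (u z : Fin n → ℂ) : ∃ D : (Fin n → ℂ) →L[ℝ] ℝ,
    HasFDerivAt (sqDist u) D z ∧
      ∀ t, D t = -2 * (∑ i, starRingEnd ℂ (u i - z i) * t i).re := by
  have h : ∀ i : Fin n, HasFDerivAt (fun z : Fin n → ℂ => ‖u i - z i‖ ^ 2) _ z := fun i =>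
    ((hasFDerivAt_const (u i) z).sub
      (ContinuousLinearMap.proj (R := ℝ) (φ := fun _ : Fin n => ℂ) i).hasFDerivAt).norm_sq
  refine ⟨_, HasFDerivAt.fun_sum fun i _ => h i, fun t => ?_⟩
  simp only [sum_apply, Complex.re_sum, Finset.mul_sum]
  refine Finset.sum_congr rfl fun i _ => ?_
  simp [Complex.inner]
  ring

theorem mem_criticalPoints_iff {u z : Fin n → ℂ} :
    z ∈ criticalPoints f c u ↔
      z ∈ regX f c ∧ (fun i => starRingEnd ℂ (u i - z i)) ∈ normalSpace f z := by
  obtain ⟨D, hD, hDt⟩ := hasFDerivAt_sqDist u z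
  refine and_congr_right fun _ => ?_
  rw [mem_normalSpace_iff, hD.fderiv]
  simp only [mem_tangentSpace_iff, hDt]
  constructor
  · intro h t ht
    have h1 := h t ht
    -- The tangent space is complex: replacing `t` by `i t` gives the imaginary part.
    have h2 := h (Complex.I • t) (by rw [Matrix.mulVec_smul, ht, smul_zero])
    have h3 : ∑ i, starRingEnd ℂ (u i - z i) * (Complex.I • t) i =
        Complex.I * ∑ i, starRingEnd ℂ (u i - z i) * t i := by
      rw [Finset.mul_sum]
      exact Finset.sum_congr rfl fun i _ => by rw [Pi.smul_apply, smul_eq_mul]; ring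
    rw [h3] at h2
    apply Complex.ext
    · simpa using h1
    · simpa using h2
  · intro h t ht
    rw [h t ht]; simp

/-- The point of the space of the `(z, w, u, v)` that belongs to a pair `z, u`. -/
def realPoint (z u : Fin n → ℂ) : QuadIdx n → ℂ :=
  Sum.elim (Sum.elim z (fun i => starRingEnd ℂ (z i))) (Sum.elim u (fun i => starRingEnd ℂ (u i)))

theorem realPoint_mem_critSet_iff {u z : Fin n → ℂ} :
    realPoint z u ∈ critSet f c ↔ z ∈ criticalPoints f c u := by
  rw [mem_criticalPoints_iff]
  simp only [critSet, realPoint, Set.mem_ofPred_eq, Sum.elim_inl, Sum.elim_inr, Complex.conj_conj,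
    map_sub]
  tauto

/-- `z` is a point of `X` nearest to `u`. -/
def IsNearest (X : Set (Fin n → ℂ)) (u z : Fin n → ℂ) : Prop :=
  z ∈ X ∧ ∀ x ∈ X, sqDist u z ≤ sqDist u x

theorem continuous_sqDist : Continuous fun p : (Fin n → ℂ) × (Fin n → ℂ) => sqDist p.1 p.2 := by
  unfold sqDist; fun_prop

/-- The norm on `Fin n → ℂ` is the sup norm, so there is only an inequality; it suffices for
properness and for convergence. -/
theorem sq_norm_sub_le_sqDist (u z : Fin n → ℂ) : ‖u - z‖ ^ 2 ≤ sqDist u z := by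
  have h0 : 0 ≤ sqDist u z := Finset.sum_nonneg fun i _ => by positivity
  have : ‖u - z‖ ≤ √(sqDist u z) := (pi_norm_le_iff_of_nonneg (Real.sqrt_nonneg _)).2 fun i => by
    refine Real.le_sqrt_of_sq_le ?_
    exact Finset.single_le_sum (f := fun i => ‖u i - z i‖ ^ 2) (fun i _ => by positivity)
      (Finset.mem_univ i)
  calc ‖u - z‖ ^ 2 ≤ √(sqDist u z) ^ 2 := by gcongr
    _ = sqDist u z := Real.sq_sqrt h0

theorem exists_isNearest {X : Set (Fin n → ℂ)} (hX : IsClosed X) (hne : X.Nonempty)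
    (u : Fin n → ℂ) : ∃ z, IsNearest X u z := by
  obtain ⟨x₀, hx₀⟩ := hne
  have hcont : Continuous (sqDist u) := continuous_sqDist.comp (by fun_prop : Continuous (u, ·))
  have hlim : Filter.Tendsto (sqDist u) (Filter.cocompact _) Filter.atTop := by
    refine Filter.tendsto_atTop_mono (sq_norm_sub_le_sqDist u) ?_
    refine (Filter.tendsto_pow_atTop two_ne_zero).comp ?_
    have h1 : (fun z : Fin n → ℂ => ‖u - z‖) = fun z => dist z u := by
      ext z; rw [dist_comm, dist_eq_norm]
    rw [h1]
    exact tendsto_dist_right_cocompact_atTop u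
  obtain ⟨z, hz, hmin⟩ := hcont.continuousOn.exists_isMinOn' hX hx₀
    ((hlim.eventually_ge_atTop _).filter_mono inf_le_left)
  exact ⟨z, hz, fun x hx => hmin hx⟩

/-- A nearest point at which the Jacobian matrix has full rank is critical. -/
theorem IsNearest.mem_criticalPoints (hprime : (idealX f).IsPrime)
    (hc : dimension (varX f) + (c : WithBot ℕ∞) = (n : WithBot ℕ∞)) {u z : Fin n → ℂ}
    (hz : IsNearest (varX f) u z) (hrank : c ≤ (jacAt f z).rank) : z ∈ criticalPoints f c u := by
  refine ⟨(mem_regX_iff f c).2 ⟨hz.1, hrank⟩, fun t ht => ?_⟩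
  obtain ⟨γ, hγX, hγ0, hγ⟩ := exists_curve hprime hc hz.1 hrank ((mem_tangentSpace_iff f).1 ht)
  obtain ⟨D, hD, -⟩ := hasFDerivAt_sqDist u z
  rw [hD.fderiv]
  have h1 : HasDerivAt (sqDist u ∘ γ) (D t) 0 := by
    subst hγ0
    exact hD.comp_hasDerivAt 0 hγ
  refine IsLocalMin.hasDerivAt_eq_zero (.of_forall fun ε => ?_) h1
  simp only [Function.comp_apply, hγ0]
  exact hz.2 _ (hγX ε)

theorem eventually_le_rank_jacAt {z : Fin n → ℂ} (hz : c ≤ (jacAt f z).rank) :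
    ∀ᶠ x in 𝓝 z, c ≤ (jacAt f x).rank := by
  obtain ⟨a, b, hab⟩ := exists_submatrix_det_ne_zero hz
  have h : ∀ x, ((jacAt f x).submatrix a b).det =
      MvPolynomial.eval x ((jacobian f).submatrix a b).det := fun x => by
    rw [RingHom.map_det]; rfl
  have hcont : Continuous fun x => ((jacAt f x).submatrix a b).det := by
    simp only [h]; exact MvPolynomial.continuous_eval _
  filter_upwards [hcont.continuousAt.eventually_ne hab] with x hx
  exact le_rank_of_det_ne_zero hx

/-- Nearest points to points close to `z` are close to `z`. -/
theorem eventually_forall_isNearest {X : Set (Fin n → ℂ)} {z : Fin n → ℂ} (hz : z ∈ X)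
    {P : (Fin n → ℂ) → Prop} (hP : ∀ᶠ x in 𝓝 z, P x) :
    ∀ᶠ u in 𝓝 z, ∀ x, IsNearest X u x → P x := by
  obtain ⟨ε, hε, hball⟩ := Metric.eventually_nhds_iff.1 hP
  have hcont : Continuous fun u => sqDist u z :=
    continuous_sqDist.comp (by fun_prop : Continuous fun u : Fin n → ℂ => (u, z))
  have h0 : sqDist z z = 0 := by simp [sqDist]
  have h1 : ∀ᶠ u in 𝓝 z, sqDist u z < (ε / 2) ^ 2 :=
    hcont.continuousAt.eventually_lt continuousAt_const (by rw [h0]; positivity)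
  filter_upwards [h1] with u hu x hx
  have hd : ∀ y, sqDist u y < (ε / 2) ^ 2 → dist u y < ε / 2 := fun y hy => by
    rw [dist_eq_norm]
    exact lt_of_pow_lt_pow_left₀ 2 (by positivity) ((sq_norm_sub_le_sqDist u y).trans_lt hy)
  refine hball ?_
  have h2 := hd x ((hx.2 z hz).trans_lt hu)
  have h3 := hd z hu
  calc dist x z ≤ dist x u + dist u z := dist_triangle _ _ _
    _ < ε / 2 + ε / 2 := by rw [dist_comm x u]; exact add_lt_add h2 h3
    _ = ε := by ring

/-- Points close to a regular point have their nearest points close to it, where the rank of the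
Jacobian is still at least `c`. -/
theorem exists_open_criticalPoints_nonempty (hprime : (idealX f).IsPrime)
    (hc : dimension (varX f) + (c : WithBot ℕ∞) = (n : WithBot ℕ∞)) :
    ∃ O : Set (Fin n → ℂ), IsOpen O ∧ O.Nonempty ∧ ∀ u ∈ O, (criticalPoints f c u).Nonempty := by
  obtain ⟨z₀, hz₀⟩ := regX_nonempty hprime hc
  have h := eventually_forall_isNearest hz₀.1
    (eventually_le_rank_jacAt ((mem_regX_iff f c).1 hz₀).2)
  obtain ⟨O, hO, hOopen, hz₀O⟩ := eventually_nhds_iff.1 h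
  refine ⟨O, hOopen, ⟨z₀, hz₀O⟩, fun u hu => ?_⟩
  obtain ⟨z, hz⟩ := exists_isNearest (isClosed_varX f) ⟨z₀, hz₀.1⟩ u
  exact ⟨z, hz.mem_criticalPoints hprime hc (hO u hu z hz)⟩

/-- A nonzero polynomial in `u` and `v` does not vanish at all points `(u, ū)` with `u` in an open
set. -/
theorem exists_eval_conj_ne_zero {O : Set (Fin n → ℂ)} (hO : IsOpen O) (hne : O.Nonempty)
    {q : RingZW n} (hq : q ≠ 0) :
    ∃ u ∈ O, MvPolynomial.eval (Sum.elim u (fun i => starRingEnd ℂ (u i))) q ≠ 0 := by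
  by_contra! hcon
  obtain ⟨a, ha⟩ := hne
  obtain ⟨ε, hε, hball⟩ := Metric.isOpen_iff.1 hO a ha
  -- The substitution `u = a + ib`, `v = a - ib`. Real `a`, `b` give the pairs `(u, ū)`, and a
  -- polynomial vanishing on a product of infinite sets of real numbers is zero.
  let g : PairIdx n → RingZW n := Sum.elim
    (fun i => MvPolynomial.X (Sum.inl i) + MvPolynomial.C Complex.I * MvPolynomial.X (Sum.inr i))
    (fun i => MvPolynomial.X (Sum.inl i) - MvPolynomial.C Complex.I * MvPolynomial.X (Sum.inr i))
  have h : ∀ x p, MvPolynomial.eval x (MvPolynomial.bind₁ g p) =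
      MvPolynomial.eval (fun i => MvPolynomial.eval x (g i)) p := fun x p =>
    MvPolynomial.eval₂Hom_bind₁ (RingHom.id ℂ) x g p
  let I : ℝ → Set ℂ := fun r => Complex.ofReal '' Metric.ball r (ε / 2)
  have hI : ∀ r, (I r).Infinite := fun r => by
    refine Set.Infinite.image Complex.ofReal_injective.injOn ?_
    rw [Real.ball_eq_Ioo]
    exact Set.Ioo_infinite (by linarith)
  have h0 : MvPolynomial.bind₁ g q = 0 := by
    refine MvPolynomial.funext_set (Sum.elim (fun i => I (a i).re) (fun i => I (a i).im)) ?_ ?_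
    · rintro (i | i)
      · exact hI _
      · exact hI _
    · intro x hx
      have hx1 : ∀ i, ∃ r ∈ Metric.ball (a i).re (ε / 2), (r : ℂ) = x (Sum.inl i) :=
        fun i => hx (Sum.inl i) trivial
      have hx2 : ∀ i, ∃ r ∈ Metric.ball (a i).im (ε / 2), (r : ℂ) = x (Sum.inr i) :=
        fun i => hx (Sum.inr i) trivial
      choose r1 hr1 hr1x using hx1
      choose r2 hr2 hr2x using hx2
      rw [h, map_zero]
      let u : Fin n → ℂ := fun i => r1 i + Complex.I * r2 i
      have hu : u ∈ O := by
        refine hball ?_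
        rw [Metric.mem_ball, dist_pi_lt_iff hε]
        intro i
        have e1 : u i - a i = ((r1 i - (a i).re : ℝ) : ℂ) +
            Complex.I * ((r2 i - (a i).im : ℝ) : ℂ) := by
          apply Complex.ext <;> simp [u]
        rw [dist_eq_norm, e1]
        have b1 := hr1 i
        have b2 := hr2 i
        rw [Metric.mem_ball, Real.dist_eq] at b1 b2
        refine (norm_add_le _ _).trans_lt ?_
        rw [norm_mul, Complex.norm_I, one_mul, Complex.norm_real, Complex.norm_real,
          Real.norm_eq_abs, Real.norm_eq_abs]
        linarith
      rw [← hcon u hu]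
      refine congrArg (fun y => MvPolynomial.eval y q) (funext fun i => ?_)
      cases i with
      | inl i => simp [g, u, ← hr1x, ← hr2x]
      | inr i => simp [g, u, ← hr1x, ← hr2x, sub_eq_add_neg]
  apply hq
  refine MvPolynomial.funext fun y => ?_
  -- The substitution is invertible, with `a = (u + v)/2` and `b = -i(u - v)/2`.
  have h1 := h (Sum.elim (fun i => (y (Sum.inl i) + y (Sum.inr i)) / 2)
    (fun i => -(Complex.I * ((y (Sum.inl i) - y (Sum.inr i)) / 2)))) q
  rw [h0, map_zero] at h1
  rw [map_zero, h1]
  congr 2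
  ext i
  cases i with
  | inl i =>
    simp only [g, Sum.elim_inl, map_add, map_mul, MvPolynomial.eval_X, MvPolynomial.eval_C,
      Sum.elim_inr, mul_neg, ← mul_assoc, Complex.I_mul_I]
    ring
  | inr i =>
    simp only [g, Sum.elim_inl, map_sub, map_mul, MvPolynomial.eval_X, MvPolynomial.eval_C,
      Sum.elim_inr, mul_neg, ← mul_assoc, Complex.I_mul_I]
    ring

/-- A polynomial in `u` and `v` that vanishes on the image of `critSet` is zero. -/
theorem eq_zero_of_forall_critSet (hprime : (idealX f).IsPrime)
    (hc : dimension (varX f) + (c : WithBot ℕ∞) = (n : WithBot ℕ∞)) {q : RingZW n}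
    (hq : ∀ p ∈ critSet f c, MvPolynomial.eval (p ∘ Sum.inr) q = 0) : q = 0 := by
  by_contra hne
  obtain ⟨O, hO, hOne, hcrit⟩ := exists_open_criticalPoints_nonempty hprime hc
  obtain ⟨u, hu, hqu⟩ := exists_eval_conj_ne_zero hO hOne hne
  obtain ⟨z, hz⟩ := hcrit u hu
  have e : realPoint z u ∘ Sum.inr = Sum.elim u (fun i => starRingEnd ℂ (u i)) := rfl
  have h := hq _ (realPoint_mem_critSet_iff.2 hz)
  rw [e] at h
  exact hqu h

theorem zariskiClosure_image_vHDCorrespondence (hprime : (idealX f).IsPrime)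
    (hc : dimension (varX f) + (c : WithBot ℕ∞) = (n : WithBot ℕ∞)) :
    zariskiClosure ((fun p : QuadIdx n → ℂ => p ∘ Sum.inr) '' vHDCorrespondence f c) =
      Set.univ := by
  refine Set.eq_univ_of_forall fun x => mem_zariskiClosure_iff.2 fun q hq => ?_
  rw [eq_zero_of_forall_critSet hprime hc (q := q) fun p hp => hq _ ⟨p, ?_, rfl⟩, map_zero]
  rw [vHDCorrespondence_eq hprime hc]
  exact subset_zariskiClosure _ hp

end Nearest

/-! ## The number of points of a generic fibre -/

section GenericFibre

open scoped IntermediateField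

/-- The fraction field of `A` is finite over that of `R` and has a primitive element. A multiple of
it by an element of `R` lies in `A` and is integral, and it still generates the field. -/
theorem exists_integral_generator (R A : Type) [CommRing R] [IsDomain R]
    [CharZero R] [CommRing A] [IsDomain A] [Algebra R A] [FaithfulSMul R A]
    [Algebra.FiniteType R A] [Algebra.IsAlgebraic R A] :
    ∃ y : A, IsIntegral R y ∧ ∀ a : A, ∃ r : R, r ≠ 0 ∧ r • a ∈ Algebra.adjoin R {y} := by
  let K := FractionRing R
  let L := FractionRing A
  let : Algebra K L := FractionRing.liftAlgebra R L
  have : IsScalarTower R K L := FractionRing.isScalarTower_liftAlgebra R L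
  have hAL : Function.Injective (algebraMap A L) := IsFractionRing.injective A L
  have hRK : Function.Injective (algebraMap R K) := IsFractionRing.injective R K
  have hRA : Function.Injective (algebraMap R A) := FaithfulSMul.algebraMap_injective R A
  have : CharZero K := charZero_of_injective_algebraMap hRK
  have hals : ∀ r : R, algebraMap K L (algebraMap R K r) = algebraMap A L (algebraMap R A r) :=
    fun r => by rw [← IsScalarTower.algebraMap_apply, ← IsScalarTower.algebraMap_apply]
  have halg : Algebra.IsAlgebraic K L := by
    have h1 : Algebra.IsAlgebraic A L := IsLocalization.isAlgebraic L (nonZeroDivisors A)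
    have h2 : Algebra.IsAlgebraic R L := Algebra.IsAlgebraic.trans R A L
    exact (IsFractionRing.comap_isAlgebraic_iff (A := R) (K := K) (C := L)).1 h2
  have hess : Algebra.EssFiniteType K L := by
    have h1 : Algebra.EssFiniteType A L := .of_isLocalization L (nonZeroDivisors A)
    have h2 : Algebra.EssFiniteType R L := .comp R A L
    exact .of_comp R K L
  have hfin : FiniteDimensional K L := by
    obtain ⟨S, hS⟩ := IntermediateField.fg_top K L
    have h1 : FiniteDimensional K (IntermediateField.adjoin K (S : Set L)) :=
      IntermediateField.finiteDimensional_adjoin fun x _ =>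
        (Algebra.IsAlgebraic.isAlgebraic x).isIntegral
    rw [hS] at h1
    exact (IntermediateField.topEquiv (F := K) (E := L)).toLinearEquiv.finiteDimensional
  obtain ⟨α, hα⟩ := Field.exists_primitive_element K L
  obtain ⟨a, b, hb, hab⟩ := IsFractionRing.div_surjective (A := A) α
  obtain ⟨r, hr, b', hrb⟩ := (Algebra.IsAlgebraic.isAlgebraic (R := R) b).exists_nonzero_dvd hb
  obtain ⟨r', hr', hint⟩ :=
    (Algebra.IsAlgebraic.isAlgebraic (R := R) (a * b')).exists_integral_multiple
  have hbL : algebraMap A L b ≠ 0 := by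
    rw [Ne, map_eq_zero_iff _ hAL]; exact nonZeroDivisors.ne_zero hb
  have hy : algebraMap A L (r' • (a * b')) = algebraMap K L (algebraMap R K (r' * r)) * α := by
    have hαb : α * algebraMap A L b = algebraMap A L a := by rw [← hab, div_mul_cancel₀ _ hbL]
    rw [Algebra.smul_def, hals, map_mul (algebraMap R A), hrb]
    simp only [map_mul]
    rw [← hαb]
    ring
  have hc0 : algebraMap R K (r' * r) ≠ 0 := by
    rw [Ne, map_eq_zero_iff _ hRK]; exact mul_ne_zero hr' hr
  have htop : K⟮algebraMap A L (r' • (a * b'))⟯ = ⊤ := by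
    rw [eq_top_iff, ← hα, IntermediateField.adjoin_simple_le_iff]
    have h1 : α = (algebraMap K L (algebraMap R K (r' * r)))⁻¹ *
        algebraMap A L (r' • (a * b')) := by
      rw [hy, ← mul_assoc, inv_mul_cancel₀, one_mul]
      exact (map_ne_zero _).2 hc0
    rw [h1, ← map_inv₀]
    exact mul_mem (IntermediateField.algebraMap_mem _ _)
      (IntermediateField.mem_adjoin_simple_self _ _)
  refine ⟨_, hint, fun x => ?_⟩
  have h1 : algebraMap A L x ∈ Algebra.adjoin K {algebraMap A L (r' • (a * b'))} := by
    rw [← IntermediateField.adjoin_simple_toSubalgebra_of_isAlgebraic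
      (Algebra.IsAlgebraic.isAlgebraic _), htop]
    trivial
  rw [Algebra.adjoin_singleton_eq_range_aeval] at h1
  obtain ⟨p, hp⟩ := h1
  obtain ⟨d, hd, hdp⟩ := IsLocalization.integerNormalization_spec (nonZeroDivisors R) p
  set q := IsLocalization.integerNormalization (nonZeroDivisors R) p
  refine ⟨d, nonZeroDivisors.ne_zero hd, ?_⟩
  rw [Algebra.adjoin_singleton_eq_range_aeval]
  refine ⟨q, hAL ?_⟩
  have h2 := congrArg (Polynomial.aeval (algebraMap A L (r' • (a * b')))) hdp
  have h3 : Polynomial.aeval (algebraMap A L (r' • (a * b'))) p = algebraMap A L x := hp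
  rw [Polynomial.aeval_map_algebraMap, Polynomial.aeval_algebraMap_apply,
    ← algebraMap_smul K d p, map_smul, h3, Algebra.smul_def (algebraMap R K d), hals, ← map_mul,
    ← Algebra.smul_def] at h2
  exact h2

/-- Finitely many denominators have a common multiple. -/
theorem exists_away_of_finiteType {R A : Type} [CommRing R] [IsDomain R] [CommRing A]
    [Algebra R A] [Algebra.FiniteType R A] (S : Subalgebra R A)
    (hS : ∀ a : A, ∃ r : R, r ≠ 0 ∧ r • a ∈ S) :
    ∃ r : R, r ≠ 0 ∧ ∀ a : A, ∃ m : ℕ, algebraMap R A r ^ m * a ∈ S := by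
  obtain ⟨s, hs⟩ := Algebra.FiniteType.out (R := R) (A := A)
  choose d hd hdS using hS
  refine ⟨∏ a ∈ s, d a, Finset.prod_ne_zero_iff.2 fun a _ => hd a, fun a => ?_⟩
  have ha : a ∈ Algebra.adjoin R (s : Set A) := hs ▸ Algebra.mem_top
  set r := ∏ a ∈ s, d a
  have hmono : ∀ (k m : ℕ) (x : A), algebraMap R A r ^ k * x ∈ S →
      algebraMap R A r ^ (m + k) * x ∈ S := fun k m x hx => by
    rw [pow_add, mul_assoc]
    exact mul_mem (pow_mem (S.algebraMap_mem r) m) hx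
  induction ha using Algebra.adjoin_induction with
  | mem x hx =>
    refine ⟨1, ?_⟩
    obtain ⟨e, he⟩ : d x ∣ r := Finset.dvd_prod_of_mem d hx
    rw [pow_one, he, ← Algebra.smul_def, mul_comm, mul_smul]
    exact S.smul_mem (hdS x) e
  | algebraMap x => exact ⟨0, by simp⟩
  | add x y _ _ hx hy =>
    obtain ⟨k, hk⟩ := hx
    obtain ⟨l, hl⟩ := hy
    refine ⟨k + l, ?_⟩
    rw [mul_add]
    exact add_mem (by rw [add_comm k l]; exact hmono k l x hk) (hmono l k y hl)
  | mul x y _ _ hx hy =>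
    obtain ⟨k, hk⟩ := hx
    obtain ⟨l, hl⟩ := hy
    refine ⟨k + l, ?_⟩
    have : algebraMap R A r ^ (k + l) * (x * y) =
        (algebraMap R A r ^ k * x) * (algebraMap R A r ^ l * y) := by ring
    rw [this]
    exact mul_mem hk hl

/-- In characteristic zero the minimal polynomial is separable over the fraction field; clear
denominators in the Bézout identity. Like a discriminant, `g` detects where the specialised
polynomial may have multiple roots. -/
theorem exists_bezout_minpoly {R A : Type} [CommRing R] [IsDomain R] [IsIntegrallyClosed R]
    [CharZero R] [CommRing A] [IsDomain A] [Algebra R A] [FaithfulSMul R A] {y : A}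
    (hy : IsIntegral R y) : ∃ (g : R) (a b : Polynomial R), g ≠ 0 ∧
      a * minpoly R y + b * (minpoly R y).derivative = Polynomial.C g := by
  let K := FractionRing R
  let L := FractionRing A
  let : Algebra K L := FractionRing.liftAlgebra R L
  have : IsScalarTower R K L := FractionRing.isScalarTower_liftAlgebra R L
  have hRK : Function.Injective (algebraMap R K) := IsFractionRing.injective R K
  have hAL : Function.Injective (algebraMap A L) := IsFractionRing.injective A L
  have : CharZero K := charZero_of_injective_algebraMap hRK
  have hm : minpoly K (algebraMap A L y) = (minpoly R y).map (algebraMap R K) := by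
    rw [minpoly.isIntegrallyClosed_eq_field_fractions' K (hy.algebraMap (B := L)),
      minpoly.algebraMap_eq hAL]
  have hirr : Irreducible (minpoly K (algebraMap A L y)) :=
    minpoly.irreducible ((hy.algebraMap (B := L)).tower_top)
  obtain ⟨a, b, hab⟩ := hirr.separable
  obtain ⟨d, hd, hda⟩ := IsLocalization.integerNormalization_spec (nonZeroDivisors R) a
  obtain ⟨e, he, heb⟩ := IsLocalization.integerNormalization_spec (nonZeroDivisors R) b
  refine ⟨d * e, Polynomial.C e * IsLocalization.integerNormalization (nonZeroDivisors R) a,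
    Polynomial.C d * IsLocalization.integerNormalization (nonZeroDivisors R) b,
    mul_ne_zero (nonZeroDivisors.ne_zero hd) (nonZeroDivisors.ne_zero he),
    Polynomial.map_injective _ hRK ?_⟩
  rw [hm] at hab
  simp only [Polynomial.map_add, Polynomial.map_mul, Polynomial.map_C, hda, heb, map_mul,
    ← Polynomial.derivative_map]
  have hsm : ∀ (r : R) (p : Polynomial K), r • p = Polynomial.C (algebraMap R K r) * p :=
    fun r p => by rw [← Polynomial.smul_eq_C_mul, algebraMap_smul]
  rw [hsm, hsm]
  linear_combination (Polynomial.C (algebraMap R K d) * Polynomial.C (algebraMap R K e)) * hab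

/-- The number of points of a generic fibre of a generically finite morphism. -/
theorem exists_generic_encard (R A : Type) [CommRing R] [IsDomain R] [IsIntegrallyClosed R]
    [CharZero R] [CommRing A] [IsDomain A] [Algebra R A] [FaithfulSMul R A]
    [Algebra.FiniteType R A] [Algebra.IsAlgebraic R A] :
    ∃ (N : ℕ) (g : R), 0 < N ∧ g ≠ 0 ∧ ∀ ρ : R →+* ℂ, ρ g ≠ 0 →
      {ψ : A →+* ℂ | ψ.comp (algebraMap R A) = ρ}.encard = N := by
  classical
  obtain ⟨y, hy, hyA⟩ := exists_integral_generator R A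
  obtain ⟨r, hr, hrA⟩ := exists_away_of_finiteType (Algebra.adjoin R {y}) hyA
  obtain ⟨g, a, b, hg, hab⟩ := exists_bezout_minpoly hy
  -- Where `r` does not vanish a point is determined by its value at `y`; where `g` does not vanish
  -- there are as many possible values as the degree.
  refine ⟨(minpoly R y).natDegree, r * g, minpoly.natDegree_pos hy, mul_ne_zero hr hg,
    fun ρ hρ => ?_⟩
  rw [map_mul, mul_ne_zero_iff] at hρ
  set m := (minpoly R y).map ρ with hm
  have hmonic : m.Monic := (minpoly.monic hy).map ρ
  have hsep : m.Separable := by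
    refine ⟨Polynomial.C (ρ g)⁻¹ * a.map ρ, Polynomial.C (ρ g)⁻¹ * b.map ρ, ?_⟩
    have h := congrArg (Polynomial.map ρ) hab
    simp only [Polynomial.map_add, Polynomial.map_mul, Polynomial.map_C,
      ← Polynomial.derivative_map] at h
    rw [mul_assoc, mul_assoc, ← mul_add, h, ← Polynomial.C_mul, inv_mul_cancel₀ hρ.2,
      Polynomial.C_1]
  have hinj : Set.InjOn (fun ψ : A →+* ℂ => ψ y) {ψ | ψ.comp (algebraMap R A) = ρ} := by
    intro ψ₁ h₁ ψ₂ h₂ h12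
    have hψ : ∀ s ∈ Algebra.adjoin R {y}, ψ₁ s = ψ₂ s := by
      intro s hs
      induction hs using Algebra.adjoin_induction with
      | mem x hx => rw [Set.mem_singleton_iff.1 hx]; exact h12
      | algebraMap x => exact (RingHom.congr_fun h₁ x).trans (RingHom.congr_fun h₂ x).symm
      | add x z _ _ hx hz => rw [map_add, map_add, hx, hz]
      | mul x z _ _ hx hz => rw [map_mul, map_mul, hx, hz]
    ext x
    obtain ⟨k, hk⟩ := hrA x
    have h := hψ _ hk
    have e₁ : ψ₁ (algebraMap R A r) = ρ r := RingHom.congr_fun h₁ r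
    have e₂ : ψ₂ (algebraMap R A r) = ρ r := RingHom.congr_fun h₂ r
    rw [map_mul, map_mul, map_pow, map_pow, e₁, e₂] at h
    exact mul_left_cancel₀ (pow_ne_zero k hρ.1) h
  have himage : (fun ψ : A →+* ℂ => ψ y) '' {ψ | ψ.comp (algebraMap R A) = ρ} =
      (m.roots.toFinset : Set ℂ) := by
    ext η
    rw [Finset.mem_coe, Multiset.mem_toFinset, Polynomial.mem_roots hmonic.ne_zero,
      Polynomial.IsRoot.def, hm, Polynomial.eval_map]
    constructor
    · rintro ⟨ψ, hψ, rfl⟩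
      have hψ' : ψ.comp (algebraMap R A) = ρ := hψ
      rw [← hψ', ← Polynomial.hom_eval₂, ← Polynomial.aeval_def, minpoly.aeval, map_zero]
    · intro hη
      obtain ⟨x, hx, hxy⟩ := exists_ringHom_adjoin hy ρ hη
      obtain ⟨ψ, hψ⟩ := exists_ringHom_extension_of_away (Algebra.adjoin R {y})
        (algebraMap R (Algebra.adjoin R {y}) r) hrA x (by
          rw [show x (algebraMap R (Algebra.adjoin R {y}) r) = ρ r from RingHom.congr_fun hx r]
          exact hρ.1)
      refine ⟨ψ, RingHom.ext fun t => ?_, ?_⟩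
      · have := hψ (algebraMap R (Algebra.adjoin R {y}) t)
        exact this.trans (RingHom.congr_fun hx t)
      · exact (hψ ⟨y, Algebra.self_mem_adjoin_singleton R y⟩).trans hxy
  rw [← hinj.encard_image, himage, Set.encard_coe_eq_coe_finsetCard,
    Multiset.toFinset_card_of_nodup (Polynomial.nodup_roots hsep),
    IsAlgClosed.card_roots_eq_natDegree, hm, (minpoly.monic hy).natDegree_map]

end GenericFibre

/-! ### Projections of affine varieties: generic fibres and local sections -/

section FibreOfProjection

variable {σ τ : Type} [Finite τ]

theorem isAlgebraic_of_trdeg_le (R A : Type) [CommRing R] [IsDomain R] [Algebra ℂ R]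
    [CommRing A] [IsDomain A] [Algebra ℂ A] [Algebra R A] [IsScalarTower ℂ R A] [FaithfulSMul R A]
    {k : ℕ} (hR : Algebra.trdeg ℂ R = k) (hA : Algebra.trdeg ℂ A ≤ k) :
    Algebra.IsAlgebraic R A := by
  rw [← trdeg_eq_zero_iff]
  have h := trdeg_add_eq ℂ R (A := A)
  rw [hR] at h
  have h1 : (k : Cardinal) + Algebra.trdeg R A = k + 0 := by
    rw [add_zero]
    exact le_antisymm (h.trans_le hA) (self_le_add_right _ _)
  exact (Cardinal.add_nat_inj k).1 (by rw [add_comm _ (k : Cardinal), h1, add_comm])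

/-- Injectivity and the degree bound make `A` algebraic over `ℂ[τ]`, which gives the count. Moreover
a nonzero `h` of `A` divides a nonzero element `g` of the base, so its zeros lie over those of `g`.
-/
theorem generic_fibre_aux [Finite σ] {I : Ideal (MvPolynomial (σ ⊕ τ) ℂ)}
    (hinj : ∀ q : MvPolynomial τ ℂ, MvPolynomial.rename Sum.inr q ∈ I → q = 0)
    {A : Type} [CommRing A] [IsDomain A] [Algebra ℂ A] (π : MvPolynomial (σ ⊕ τ) ℂ →ₐ[ℂ] A)
    (hπ : Function.Surjective π) (hker : RingHom.ker π = I)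
    (htr : Algebra.trdeg ℂ A ≤ Nat.card τ) :
    (∃ (N : ℕ) (g : MvPolynomial τ ℂ), 0 < N ∧ g ≠ 0 ∧ ∀ t, MvPolynomial.eval t g ≠ 0 →
      {p | p ∈ MvPolynomial.zeroLocus ℂ I ∧ p ∘ Sum.inr = t}.encard = N) ∧
    ∀ h ∉ I, ∃ g : MvPolynomial τ ℂ, g ≠ 0 ∧ ∀ p ∈ MvPolynomial.zeroLocus ℂ I,
      MvPolynomial.eval (p ∘ Sum.inr) g ≠ 0 → MvPolynomial.eval p h ≠ 0 := by
  let φ : MvPolynomial τ ℂ →ₐ[ℂ] A := π.comp (MvPolynomial.rename Sum.inr)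
  have hφ : Function.Injective φ := by
    rw [injective_iff_map_eq_zero]
    intro q hq
    apply hinj
    rw [← hker]
    exact hq
  have hmem : ∀ q, π q = 0 ↔ q ∈ I := fun q => by rw [← hker]; rfl
  algebraize [φ.toRingHom]
  have : IsScalarTower ℂ (MvPolynomial τ ℂ) A := .of_algebraMap_eq' φ.comp_algebraMap.symm
  have : FaithfulSMul (MvPolynomial τ ℂ) A := (faithfulSMul_iff_algebraMap_injective _ _).2 hφ
  have hft : Algebra.FiniteType ℂ A := .of_surjective π hπ
  have : Algebra.FiniteType (MvPolynomial τ ℂ) A :=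
    .of_restrictScalars_finiteType ℂ (MvPolynomial τ ℂ) A
  have halg : Algebra.IsAlgebraic (MvPolynomial τ ℂ) A :=
    isAlgebraic_of_trdeg_le (MvPolynomial τ ℂ) A (k := Nat.card τ)
      (by rw [MvPolynomial.trdeg_of_isDomain, Cardinal.lift_id, Nat.cast_card]) htr
  constructor
  · obtain ⟨N, g, hN, hg, hfib⟩ := exists_generic_encard (MvPolynomial τ ℂ) A
    refine ⟨N, g, hN, hg, fun t ht => ?_⟩
    rw [← hfib (MvPolynomial.eval t) ht]
    symm
    have hC : ∀ ψ : A →+* ℂ, ψ.comp (algebraMap (MvPolynomial τ ℂ) A) = MvPolynomial.eval t →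
        (ψ.comp π.toRingHom) = MvPolynomial.eval (fun i => ψ (π (MvPolynomial.X i))) := by
      intro ψ hψ
      refine MvPolynomial.ringHom_ext (fun a => ?_) fun i => by simp
      have h1 := RingHom.congr_fun hψ (MvPolynomial.C a)
      have h2 : algebraMap (MvPolynomial τ ℂ) A (MvPolynomial.C a) = π (MvPolynomial.C a) := by
        change π (MvPolynomial.rename Sum.inr (MvPolynomial.C a)) = _
        rw [MvPolynomial.rename_C]
      rw [RingHom.comp_apply, h2, MvPolynomial.eval_C] at h1
      rw [MvPolynomial.eval_C]
      exact h1
    have hinj' : Set.InjOn (fun (ψ : A →+* ℂ) (i : σ ⊕ τ) => ψ (π (MvPolynomial.X i)))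
        {ψ | ψ.comp (algebraMap (MvPolynomial τ ℂ) A) = MvPolynomial.eval t} := by
      intro ψ₁ h₁ ψ₂ h₂ h12
      have e : ψ₁.comp π.toRingHom = ψ₂.comp π.toRingHom := by
        rw [hC ψ₁ h₁, hC ψ₂ h₂]
        exact congrArg _ h12
      ext x
      obtain ⟨q, rfl⟩ := hπ x
      exact RingHom.congr_fun e q
    rw [← hinj'.encard_image]
    congr 1
    ext p
    constructor
    · rintro ⟨ψ, hψ, rfl⟩
      refine ⟨mem_zeroLocus_iff_le_ker.2 fun q hq => ?_, ?_⟩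
      · have := RingHom.congr_fun (hC ψ hψ) q
        rw [RingHom.mem_ker, ← this]
        change ψ (π q) = 0
        rw [(hmem q).2 hq, map_zero]
      · ext i
        have := RingHom.congr_fun (show ψ.comp (algebraMap (MvPolynomial τ ℂ) A) =
          MvPolynomial.eval t from hψ) (MvPolynomial.X i)
        rw [MvPolynomial.eval_X] at this
        rw [← this]
        change _ = ψ (π (MvPolynomial.rename Sum.inr (MvPolynomial.X i)))
        rw [MvPolynomial.rename_X]
        rfl
    · rintro ⟨hp, rfl⟩
      have hle : RingHom.ker π.toRingHom ≤ RingHom.ker (MvPolynomial.eval p) := by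
        intro q hq
        exact mem_zeroLocus_iff_le_ker.1 hp ((hmem q).1 hq)
      let ψ : A →+* ℂ := RingHom.liftOfSurjective π.toRingHom hπ ⟨_, hle⟩
      have hψ : ∀ q, ψ (π q) = MvPolynomial.eval p q := fun q =>
        RingHom.congr_fun (RingHom.liftOfSurjective_comp π.toRingHom hπ ⟨_, hle⟩) q
      refine ⟨ψ, RingHom.ext fun q => ?_, funext fun i => by
        change ψ (π (MvPolynomial.X i)) = _; rw [hψ, MvPolynomial.eval_X]⟩
      change ψ (π (MvPolynomial.rename Sum.inr q)) = _
      rw [hψ, MvPolynomial.eval_rename]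
  · intro h hh
    have h0 : π h ≠ 0 := fun e => hh ((hmem h).1 e)
    obtain ⟨g, hg, a, ha⟩ := (halg.isAlgebraic (π h)).exists_nonzero_dvd
      (mem_nonZeroDivisors_of_ne_zero h0)
    obtain ⟨q, rfl⟩ := hπ a
    refine ⟨g, hg, fun p hp hgp hhp => hgp ?_⟩
    have h1 : MvPolynomial.rename Sum.inr g - h * q ∈ I := by
      rw [← hmem, map_sub, map_mul, sub_eq_zero]
      exact ha
    have h2 : MvPolynomial.eval p (MvPolynomial.rename Sum.inr g - h * q) = 0 :=
      mem_zeroLocus_iff_le_ker.1 hp h1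
    rw [map_sub, map_mul, hhp, zero_mul, sub_zero, MvPolynomial.eval_rename] at h2
    exact h2

theorem generic_fibre [Finite σ] {I : Ideal (MvPolynomial (σ ⊕ τ) ℂ)} (hI : I.IsPrime)
    (hinj : ∀ q : MvPolynomial τ ℂ, MvPolynomial.rename Sum.inr q ∈ I → q = 0)
    (htr : Algebra.trdeg ℂ (MvPolynomial (σ ⊕ τ) ℂ ⧸ I) ≤ Nat.card τ) :
    (∃ (N : ℕ) (g : MvPolynomial τ ℂ), 0 < N ∧ g ≠ 0 ∧ ∀ t, MvPolynomial.eval t g ≠ 0 →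
      {p | p ∈ MvPolynomial.zeroLocus ℂ I ∧ p ∘ Sum.inr = t}.encard = N) ∧
    ∀ h ∉ I, ∃ g : MvPolynomial τ ℂ, g ≠ 0 ∧ ∀ p ∈ MvPolynomial.zeroLocus ℂ I,
      MvPolynomial.eval (p ∘ Sum.inr) g ≠ 0 → MvPolynomial.eval p h ≠ 0 :=
  generic_fibre_aux hinj (Ideal.Quotient.mkₐ ℂ I) (Ideal.Quotient.mkₐ_surjective ℂ I)
    (Ideal.Quotient.mkₐ_ker ℂ I) htr

theorem card_le_trdeg {I : Ideal (MvPolynomial (σ ⊕ τ) ℂ)}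
    (hinj : ∀ q : MvPolynomial τ ℂ, MvPolynomial.rename Sum.inr q ∈ I → q = 0) :
    (Nat.card τ : Cardinal) ≤ Algebra.trdeg ℂ (MvPolynomial (σ ⊕ τ) ℂ ⧸ I) := by
  have h := trdeg_le_of_injective
    ((Ideal.Quotient.mkₐ ℂ I).comp (MvPolynomial.rename (Sum.inr : τ → σ ⊕ τ))) (by
      rw [injective_iff_map_eq_zero]
      intro q hq
      exact hinj q (Ideal.Quotient.eq_zero_iff_mem.1 hq))
  rwa [MvPolynomial.trdeg_of_isDomain, Cardinal.lift_id, ← Nat.cast_card] at h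

/-- If the number of points in the fibres of a projection is finite and constant near `t₀`, then
near `t₀` these points are given by sections. -/
theorem exists_local_sections [Finite σ] {I : Ideal (MvPolynomial (σ ⊕ τ) ℂ)} (hI : I.IsPrime)
    (hinj : ∀ q : MvPolynomial τ ℂ, MvPolynomial.rename Sum.inr q ∈ I → q = 0)
    {N : ℕ} {t₀ : τ → ℂ} (hN : ∀ᶠ t in 𝓝 t₀,
      {p | p ∈ MvPolynomial.zeroLocus ℂ I ∧ p ∘ Sum.inr = t}.encard = N) :
    ∃ x : (σ ⊕ τ → ℂ) → (τ → ℂ) → (σ ⊕ τ → ℂ),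
      (∀ p ∈ MvPolynomial.zeroLocus ℂ I, p ∘ Sum.inr = t₀ →
        Filter.Tendsto (x p) (𝓝 t₀) (𝓝 p)) ∧
      ∀ᶠ t in 𝓝 t₀, (∀ p ∈ MvPolynomial.zeroLocus ℂ I, p ∘ Sum.inr = t₀ →
          x p t ∈ MvPolynomial.zeroLocus ℂ I ∧ x p t ∘ Sum.inr = t) ∧
        ∀ q ∈ MvPolynomial.zeroLocus ℂ I, q ∘ Sum.inr = t →
          ∃ p ∈ MvPolynomial.zeroLocus ℂ I, p ∘ Sum.inr = t₀ ∧ x p t = q := by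
  set F : (τ → ℂ) → Set (σ ⊕ τ → ℂ) := fun t =>
    {p | p ∈ MvPolynomial.zeroLocus ℂ I ∧ p ∘ Sum.inr = t} with hF
  have hfin : (F t₀).Finite := Set.finite_of_encard_eq_coe hN.self_of_nhds
  have hsec : ∀ p, ∃ x : (τ → ℂ) → (σ ⊕ τ → ℂ), p ∈ F t₀ →
      (∀ᶠ t in 𝓝 t₀, x t ∈ F t) ∧ Filter.Tendsto x (𝓝 t₀) (𝓝 p) := by
    intro p
    by_cases hp : p ∈ F t₀
    · have hev : (fun i : τ => MvPolynomial.eval p (MvPolynomial.X (Sum.inr i))) = t₀ := by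
        rw [← hp.2]; ext i; simp
      obtain ⟨-, h⟩ := trdeg_le_and_exists_section hI
        (fun i : τ => (MvPolynomial.X (Sum.inr i) : MvPolynomial (σ ⊕ τ) ℂ)) hp.1 (by
          have : ∀ᶠ x in 𝓝 p, x ∉ F t₀ \ {p} :=
            (hfin.subset Set.sdiff_subset).isClosed.isOpen_compl.mem_nhds (by simp)
          filter_upwards [this] with x hx hxI hxt
          by_contra hne
          refine hx ⟨⟨hxI, ?_⟩, hne⟩
          rw [← hp.2]
          ext i
          simpa using hxt i)
      obtain ⟨x, hxI, hx, hlim⟩ := h (card_le_trdeg hinj)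
      rw [hev] at hx hlim
      refine ⟨x, fun _ => ⟨?_, hlim⟩⟩
      filter_upwards [hx] with t ht
      exact ⟨hxI t, funext fun i => by simpa using ht i⟩
    · exact ⟨fun _ => p, fun h => absurd h hp⟩
  choose x hx using hsec
  refine ⟨x, fun p hpI hpt => (hx p ⟨hpI, hpt⟩).2, ?_⟩
  have h1 : ∀ᶠ t in 𝓝 t₀, ∀ p ∈ F t₀, x p t ∈ F t :=
    (Filter.eventually_all_finite hfin).2 fun p hp => (hx p hp).1
  have h2 : ∀ᶠ t in 𝓝 t₀, ∀ p ∈ F t₀, ∀ q ∈ F t₀, x p t = x q t → p = q := by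
    refine (Filter.eventually_all_finite hfin).2 fun p hp =>
      (Filter.eventually_all_finite hfin).2 fun q hq => ?_
    by_cases hpq : p = q
    · exact .of_forall fun _ _ => hpq
    · filter_upwards [((hx p hp).2.prodMk_nhds (hx q hq).2).eventually
        ((isOpen_ne_fun continuous_fst continuous_snd).mem_nhds hpq)] with t ht h
      exact absurd h ht
  filter_upwards [h1, h2, hN] with t ht1 ht2 htN
  refine ⟨fun p hpI hpt => ht1 p ⟨hpI, hpt⟩, ?_⟩
  -- The sections stay distinct near `t₀`, so `N` of them exhaust a fibre with `N` points.
  have himg : (fun p => x p t) '' F t₀ = F t := by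
    refine (hfin.image _).eq_of_subset_of_encard_le ?_ ?_
    · rintro _ ⟨p, hp, rfl⟩; exact ht1 p hp
    · rw [Set.InjOn.encard_image fun p hp q hq h => ht2 p hp q hq h]
      rw [show (F t).encard = N from htN, show (F t₀).encard = N from hN.self_of_nhds]
  intro q hqI hqt
  have : q ∈ (fun p => x p t) '' F t₀ := himg ▸ ⟨hqI, hqt⟩
  obtain ⟨p, hp, hpq⟩ := this
  exact ⟨p, hp.1, hp.2, hpq⟩

end FibreOfProjection

/-! ## The dimension of the vHD correspondence and its generic fibres -/

section CritIdeal

variable {n s : ℕ} {f : Fin s → RingZ n} {c : ℕ}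

theorem vHDCorrespondence_eq_zeroLocus (hprime : (idealX f).IsPrime)
    (hc : dimension (varX f) + (c : WithBot ℕ∞) = (n : WithBot ℕ∞)) :
    vHDCorrespondence f c = MvPolynomial.zeroLocus ℂ (critIdeal f c) :=
  vHDCorrespondence_eq hprime hc

theorem mem_critSet_of_mem_prodReg (hprime : (idealX f).IsPrime)
    (hc : dimension (varX f) + (c : WithBot ℕ∞) = (n : WithBot ℕ∞)) {p : QuadIdx n → ℂ}
    (hp : p ∈ MvPolynomial.zeroLocus ℂ (critIdeal f c)) (hreg : p ∘ Sum.inl ∈ prodReg f c) :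
    p ∈ critSet f c := by
  rw [← vHDCorrespondenceReg_eq hprime hc]
  exact ⟨by rwa [vHDCorrespondence_eq_zeroLocus hprime hc], hreg⟩

theorem critSet_subset_zeroLocus {p : QuadIdx n → ℂ} (hp : p ∈ critSet f c) :
    p ∈ MvPolynomial.zeroLocus ℂ (critIdeal f c) :=
  subset_zariskiClosure _ hp

theorem mem_prodX_of_mem_zeroLocus (hprime : (idealX f).IsPrime)
    (hc : dimension (varX f) + (c : WithBot ℕ∞) = (n : WithBot ℕ∞)) {p : QuadIdx n → ℂ}
    (hp : p ∈ MvPolynomial.zeroLocus ℂ (critIdeal f c)) : p ∘ Sum.inl ∈ prodX f := by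
  rw [← vHDCorrespondence_eq_zeroLocus hprime hc] at hp
  exact vHDCorrespondence_subset hp

theorem eq_zero_of_rename_mem_critIdeal (hprime : (idealX f).IsPrime)
    (hc : dimension (varX f) + (c : WithBot ℕ∞) = (n : WithBot ℕ∞)) (q : RingZW n)
    (hq : MvPolynomial.rename Sum.inr q ∈ critIdeal f c) : q = 0 := by
  refine eq_zero_of_forall_critSet hprime hc fun p hp => ?_
  rw [← MvPolynomial.eval_rename]
  exact mem_vanishingIdeal_iff_eval.1 hq p hp

theorem eq_zero_of_mem_normalSpace (hprime : (idealX f).IsPrime)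
    (hc : dimension (varX f) + (c : WithBot ℕ∞) = (n : WithBot ℕ∞)) {z r : Fin n → ℂ}
    (hz : z ∈ varX f) {a : Fin c → Fin s} {b : Fin c → Fin n}
    (hab : ((jacAt f z).submatrix a b).det ≠ 0) (hr : r ∈ normalSpace f z)
    (hrb : ∀ i, r (b i) = 0) : r = 0 := by
  rw [normalSpace_eq_of_minor_ne_zero hprime hc hz hab] at hr
  obtain ⟨t, rfl⟩ := hr
  have h : Matrix.vecMul t ((jacAt f z).submatrix a b) = 0 := funext hrb
  rw [Matrix.eq_zero_of_vecMul_eq_zero hab h, map_zero]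

/-- It suffices to find `2n` functions whose common level through one point `(z, z̄, z, z̄)` is
isolated. -/
theorem trdeg_critIdeal_le (hprime : (idealX f).IsPrime)
    (hc : dimension (varX f) + (c : WithBot ℕ∞) = (n : WithBot ℕ∞)) :
    Algebra.trdeg ℂ (RingZWUV n ⧸ critIdeal f c) ≤ Nat.card (PairIdx n) := by
  obtain ⟨z, hz⟩ := regX_nonempty hprime hc
  have hzX := ((mem_regX_iff f c).1 hz).1
  obtain ⟨a, b, hab⟩ := exists_submatrix_det_ne_zero ((mem_regX_iff f c).1 hz).2
  obtain ⟨k, L, hk, hL⟩ := exists_linearMap_injOn_ker (jacAt f z)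
  have hkc : k + c = n := by
    rw [← le_antisymm (rank_jacAt_le hprime hc hzX) ((mem_regX_iff f c).1 hz).2]
    exact hk
  -- The `2k` linear coordinates fix `z` and `w`; then the `2c` coordinates of `u` and `v` selected
  -- by a nonzero minor fix the normal vectors.
  let g : (Fin k ⊕ Fin k) ⊕ (Fin c ⊕ Fin c) → RingZWUV n := Sum.elim
    (Sum.elim (fun i => MvPolynomial.rename (fun j => Sum.inl (Sum.inl j)) (linearPoly L i))
      (fun i => MvPolynomial.rename (fun j => Sum.inl (Sum.inr j))
        (MvPolynomial.map (starRingEnd ℂ) (linearPoly L i))))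
    (Sum.elim (fun i => MvPolynomial.X (Sum.inr (Sum.inl (b i))))
      (fun i => MvPolynomial.X (Sum.inr (Sum.inr (b i)))))
  have hp₀ : realPoint z z ∈ MvPolynomial.zeroLocus ℂ (critIdeal f c) := by
    refine critSet_subset_zeroLocus (realPoint_mem_critSet_iff.2 (mem_criticalPoints_iff.2 ⟨hz, ?_⟩))
    simp only [sub_self, map_zero]
    exact (normalSpace f z).zero_mem
  have hiso : ∀ᶠ x in 𝓝 (realPoint z z), x ∈ MvPolynomial.zeroLocus ℂ (critIdeal f c) →
      (∀ i, MvPolynomial.eval x (g i) = MvPolynomial.eval (realPoint z z) (g i)) →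
        x = realPoint z z := by
    have hlin := eventually_eq_of_linear (f := f) hL
    have h1 : Filter.Tendsto (fun (x : QuadIdx n → ℂ) i => x (Sum.inl (Sum.inl i)))
        (𝓝 (realPoint z z)) (𝓝 z) :=
      (by fun_prop : Continuous fun (x : QuadIdx n → ℂ) i => x (Sum.inl (Sum.inl i))).tendsto _
    have h2 : Filter.Tendsto (fun (x : QuadIdx n → ℂ) i => starRingEnd ℂ (x (Sum.inl (Sum.inr i))))
        (𝓝 (realPoint z z)) (𝓝 z) := by
      have := (continuous_pi fun i => Complex.continuous_conj.comp
        (continuous_apply (Sum.inl (Sum.inr i)))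
        : Continuous fun (x : QuadIdx n → ℂ) i => starRingEnd ℂ (x (Sum.inl (Sum.inr i)))).tendsto
          (realPoint z z)
      simpa [realPoint] using this
    filter_upwards [h1.eventually hlin, h2.eventually hlin] with x hx1 hx2 hxV hxg
    obtain ⟨hX1, hX2⟩ := mem_prodX_of_mem_zeroLocus hprime hc hxV
    have e1 := hx1 hX1 fun i => by
      have := hxg (Sum.inl (Sum.inl i))
      simp only [g, Sum.elim_inl, MvPolynomial.eval_rename] at this
      exact this
    have e2 := hx2 hX2 fun i => by
      have := hxg (Sum.inl (Sum.inr i))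
      simp only [g, Sum.elim_inl, Sum.elim_inr, MvPolynomial.eval_rename, eval_map_conj] at this
      have h3 := (starRingEnd ℂ).injective this
      simpa [Function.comp_def, realPoint] using h3
    have hreg : x ∘ Sum.inl ∈ prodReg f c := by
      refine ⟨?_, ?_⟩
      · change (fun i => x (Sum.inl (Sum.inl i))) ∈ _
        rw [e1]; exact hz
      · change (fun i => starRingEnd ℂ (x (Sum.inl (Sum.inr i)))) ∈ _
        rw [e2]; exact hz
    obtain ⟨-, -, hn1, hn2⟩ := mem_critSet_of_mem_prodReg hprime hc hxV hreg
    rw [e1] at hn1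
    rw [e2] at hn2
    have e1' := congrFun e1
    have e2' : ∀ i, x (Sum.inl (Sum.inr i)) = starRingEnd ℂ (z i) := fun i => by
      rw [← congrFun e2 i, Complex.conj_conj]
    have e3 := eq_zero_of_mem_normalSpace hprime hc hzX hab hn1 fun i => by
      have := hxg (Sum.inr (Sum.inr i))
      simp only [g, Sum.elim_inr, MvPolynomial.eval_X] at this
      rw [this, e2', sub_eq_zero]
      rfl
    have e4 := eq_zero_of_mem_normalSpace hprime hc hzX hab hn2 fun i => by
      have := hxg (Sum.inr (Sum.inl i))
      simp only [g, Sum.elim_inr, Sum.elim_inl, MvPolynomial.eval_X] at this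
      rw [this, e1', map_eq_zero, sub_eq_zero]
      rfl
    ext i
    rcases i with (i | i) | (i | i)
    · exact e1' i
    · exact e2' i
    · have := congrFun e4 i
      simp only [Pi.zero_apply, map_eq_zero, sub_eq_zero] at this
      rw [this]; exact e1' i
    · have := congrFun e3 i
      simp only [Pi.zero_apply, sub_eq_zero] at this
      rw [this]; exact e2' i
  have h := (trdeg_le_and_exists_section (isPrime_critIdeal hprime hc) g hp₀ hiso).1
  have hcard : Nat.card ((Fin k ⊕ Fin k) ⊕ (Fin c ⊕ Fin c)) = Nat.card (PairIdx n) := by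
    simp only [Nat.card_sum, Nat.card_fin]; omega
  rwa [hcard] at h

theorem dimension_vHDCorrespondence (hprime : (idealX f).IsPrime)
    (hc : dimension (varX f) + (c : WithBot ℕ∞) = (n : WithBot ℕ∞)) :
    dimension (vHDCorrespondence f c) = ((2 * n : ℕ) : WithBot ℕ∞) := by
  have hI := isPrime_critIdeal hprime hc
  rw [dimension, vHDCorrespondence_eq_zeroLocus hprime hc,
    MvPolynomial.IsPrime.vanishingIdeal_zeroLocus]
  obtain ⟨d, hd, htr⟩ := exists_ringKrullDim_eq_trdeg ℂ (RingZWUV n ⧸ critIdeal f c)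
  have h1 := trdeg_critIdeal_le hprime hc
  have h2 := card_le_trdeg (eq_zero_of_rename_mem_critIdeal hprime hc)
  rw [htr] at h1 h2
  rw [hd]
  have h3 : Nat.card (PairIdx n) = 2 * n := by
    simp only [Nat.card_sum, Nat.card_fin]; omega
  rw [h3] at h1 h2
  have : d = 2 * n := le_antisymm (by exact_mod_cast h1) (by exact_mod_cast h2)
  rw [this]

/-- The fibres of the vHD correspondence over a generic point lie over the regular locus, and
all of them have the same positive number of points. -/
theorem exists_generic_number (hprime : (idealX f).IsPrime)
    (hc : dimension (varX f) + (c : WithBot ℕ∞) = (n : WithBot ℕ∞)) :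
    ∃ (N : ℕ) (g : RingZW n), 0 < N ∧ g ≠ 0 ∧ ∀ uv, MvPolynomial.eval uv g ≠ 0 →
      (vHDFibre f c uv).encard = N ∧ vHDFibre f c uv ⊆ critSet f c := by
  have hI := isPrime_critIdeal hprime hc
  obtain ⟨⟨N, g, hN, hg, hcount⟩, havoid⟩ := generic_fibre hI
    (eq_zero_of_rename_mem_critIdeal hprime hc) (trdeg_critIdeal_le hprime hc)
  obtain ⟨z, hz⟩ := regX_nonempty hprime hc
  obtain ⟨a, b, hab⟩ := exists_submatrix_det_ne_zero ((mem_regX_iff f c).1 hz).2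
  have hdet : ∀ z, MvPolynomial.eval z ((jacobian f).submatrix a b).det =
      ((jacAt f z).submatrix a b).det := fun z => by rw [RingHom.map_det]; rfl
  let m := ((jacobian f).submatrix a b).det
  -- Where this product of minors does not vanish both components are regular, so generic fibres
  -- avoid the singular part.
  let h : RingZWUV n := MvPolynomial.rename (fun j => Sum.inl (Sum.inl j)) m *
    MvPolynomial.rename (fun j => Sum.inl (Sum.inr j)) (MvPolynomial.map (starRingEnd ℂ) m)
  have heval : ∀ p, MvPolynomial.eval p h = ((jacAt f fun i => p (Sum.inl (Sum.inl i))).submatrix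
      a b).det * starRingEnd ℂ ((jacAt f fun i => starRingEnd ℂ (p (Sum.inl (Sum.inr i)))).submatrix
        a b).det := fun p => by
    rw [map_mul, MvPolynomial.eval_rename, MvPolynomial.eval_rename, eval_map_conj, hdet, hdet]
    rfl
  have hh : h ∉ critIdeal f c := by
    intro hmem
    have hp : realPoint z z ∈ critSet f c := by
      refine realPoint_mem_critSet_iff.2 (mem_criticalPoints_iff.2 ⟨hz, ?_⟩)
      simp only [sub_self, map_zero]
      exact (normalSpace f z).zero_mem
    have := mem_vanishingIdeal_iff_eval.1 hmem _ hp
    rw [heval] at this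
    simp only [realPoint, Sum.elim_inl, Sum.elim_inr, Complex.conj_conj] at this
    exact mul_ne_zero hab ((map_ne_zero _).2 hab) this
  obtain ⟨g', hg', hgh⟩ := havoid h hh
  refine ⟨N, g * g', hN, mul_ne_zero hg hg', fun uv huv => ?_⟩
  rw [map_mul, mul_ne_zero_iff] at huv
  have hfib : vHDFibre f c uv =
      {p | p ∈ MvPolynomial.zeroLocus ℂ (critIdeal f c) ∧ p ∘ Sum.inr = uv} := by
    rw [vHDFibre, vHDCorrespondence_eq_zeroLocus hprime hc]
  refine ⟨by rw [hfib]; exact hcount uv huv.1, ?_⟩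
  rw [hfib]
  rintro p ⟨hp, rfl⟩
  have h1 := hgh p hp huv.2
  rw [heval, mul_ne_zero_iff, map_ne_zero] at h1
  obtain ⟨hX1, hX2⟩ := mem_prodX_of_mem_zeroLocus hprime hc hp
  exact mem_critSet_of_mem_prodReg hprime hc hp
    ⟨(mem_regX_iff f c).2 ⟨hX1, le_rank_of_det_ne_zero h1.1⟩,
      (mem_regX_iff f c).2 ⟨hX2, le_rank_of_det_ne_zero h1.2⟩⟩

/-- A fibre lying inside `critSet` is already Zariski closed, so taking its closure changes nothing.
-/
theorem encard_zeroLocus_hermitianCriticalIdealAt (hprime : (idealX f).IsPrime)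
    (hc : dimension (varX f) + (c : WithBot ℕ∞) = (n : WithBot ℕ∞)) {uv : PairIdx n → ℂ}
    (huv : vHDFibre f c uv ⊆ critSet f c) :
    (MvPolynomial.zeroLocus ℂ (hermitianCriticalIdealAt f c uv)).encard =
      (vHDFibre f c uv).encard := by
  have h1 : {x | Sum.elim x uv ∈ critSet f c} =
      MvPolynomial.zeroLocus ℂ ((critIdeal f c).map (specialize uv)) := by
    ext x
    rw [mem_zeroLocus_map_specialize]
    refine ⟨critSet_subset_zeroLocus, fun h => huv ⟨?_, ?_⟩⟩
    · rwa [vHDCorrespondence_eq_zeroLocus hprime hc]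
    · simp
  have h2 : zariskiClosure {x | Sum.elim x uv ∈ critSet f c} =
      {x | Sum.elim x uv ∈ critSet f c} := by
    refine Set.Subset.antisymm ?_ (subset_zariskiClosure _)
    conv_rhs => rw [h1]
    rw [zariskiClosure_subset_iff, h1]
  rw [zeroLocus_hermitianCriticalIdealAt hprime hc, h2]
  have hinj : Function.Injective (fun x : PairIdx n → ℂ => (Sum.elim x uv : QuadIdx n → ℂ)) :=
    fun x y hxy => by simpa using congrArg (· ∘ Sum.inl) hxy
  rw [← hinj.encard_image]
  congr 1
  ext p
  constructor
  · rintro ⟨x, hx, rfl⟩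
    refine ⟨?_, by simp⟩
    rw [vHDCorrespondence_eq_zeroLocus hprime hc]
    exact critSet_subset_zeroLocus hx
  · intro hp
    have e : Sum.elim (p ∘ Sum.inl) uv = p := by rw [← hp.2, Sum.elim_comp_inl_inr]
    refine ⟨p ∘ Sum.inl, ?_, e⟩
    rw [Set.mem_ofPred_eq, e]
    exact huv hp

theorem exists_eval_ne_zero_of_isZariskiOpen {σ : Type} {U : Set (σ → ℂ)} (hU : IsZariskiOpen U)
    (hne : U.Nonempty) : ∃ q : MvPolynomial σ ℂ, q ≠ 0 ∧ ∀ x, MvPolynomial.eval x q ≠ 0 → x ∈ U := by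
  obtain ⟨I, hI⟩ := hU
  obtain ⟨x, hx⟩ := hne
  have hxI : x ∉ MvPolynomial.zeroLocus ℂ I := hI ▸ fun h => h hx
  rw [mem_zeroLocus_iff_le_ker] at hxI
  obtain ⟨q, hq, hqx⟩ := SetLike.not_le_iff_exists.1 hxI
  refine ⟨q, by rintro rfl; simp at hqx, fun y hy => ?_⟩
  by_contra hyU
  have : y ∈ MvPolynomial.zeroLocus ℂ I := hI ▸ hyU
  exact hy (mem_zeroLocus_iff_le_ker.1 this hq)

theorem exists_eval_ne_zero {σ : Type} {q : MvPolynomial σ ℂ} (hq : q ≠ 0) :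
    ∃ x, MvPolynomial.eval x q ≠ 0 := by
  by_contra! h
  exact hq (MvPolynomial.funext fun x => by rw [h x, map_zero])

theorem IsGenericSolutionNumber.unique {N M : ℕ} (hN : IsGenericSolutionNumber f c N)
    (hM : IsGenericSolutionNumber f c M) : N = M := by
  obtain ⟨U, hU, hUne, hUN⟩ := hN
  obtain ⟨V, hV, hVne, hVM⟩ := hM
  obtain ⟨p, hp, hpU⟩ := exists_eval_ne_zero_of_isZariskiOpen hU hUne
  obtain ⟨q, hq, hqV⟩ := exists_eval_ne_zero_of_isZariskiOpen hV hVne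
  obtain ⟨x, hx⟩ := exists_eval_ne_zero (mul_ne_zero hp hq)
  rw [map_mul, mul_ne_zero_iff] at hx
  have h := (hUN x (hpU x hx.1)).symm.trans (hVM x (hqV x hx.2))
  exact_mod_cast h

theorem isGenericSolutionNumber_vHD (hprime : (idealX f).IsPrime)
    (hc : dimension (varX f) + (c : WithBot ℕ∞) = (n : WithBot ℕ∞)) :
    IsGenericSolutionNumber f c (vHD f c) ∧
    (∃ U : Set (PairIdx n → ℂ), IsZariskiOpen U ∧ U.Nonempty ∧
      ∀ uv ∈ U, (vHDFibre f c uv).encard = (vHD f c : ℕ∞)) := by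
  obtain ⟨N, g, -, hg, hfib⟩ := exists_generic_number hprime hc
  have hopen := isZariskiOpen_setOf_eval_ne_zero g
  have hne : {x | MvPolynomial.eval x g ≠ 0}.Nonempty := exists_eval_ne_zero hg
  have hN : IsGenericSolutionNumber f c N := by
    refine ⟨_, hopen, hne, fun uv huv => ?_⟩
    rw [encard_zeroLocus_hermitianCriticalIdealAt hprime hc (hfib uv huv).2]
    exact (hfib uv huv).1
  have hv : IsGenericSolutionNumber f c (vHD f c) :=
    Nat.sInf_mem (s := {N | IsGenericSolutionNumber f c N}) ⟨N, hN⟩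
  refine ⟨hv, _, hopen, hne, fun uv huv => ?_⟩
  rw [hv.unique hN]
  exact (hfib uv huv).1

end CritIdeal

/-! ## Critical points depend continuously on a generic point -/

section CriticalSections

variable {n s : ℕ} {f : Fin s → RingZ n} {c : ℕ}

/-- The pair of a point and its conjugate. -/
def realPair (u : Fin n → ℂ) : PairIdx n → ℂ := Sum.elim u (fun i => starRingEnd ℂ (u i))

theorem continuous_realPair : Continuous (realPair (n := n)) := by
  refine continuous_pi fun i => ?_
  cases i with
  | inl i => exact continuous_apply i
  | inr i => exact Complex.continuous_conj.comp (continuous_apply i)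

theorem continuous_realPoint :
    Continuous fun p : (Fin n → ℂ) × (Fin n → ℂ) => realPoint p.1 p.2 := by
  refine continuous_pi fun i => ?_
  cases i with
  | inl i => exact (continuous_apply i).comp (continuous_realPair.comp continuous_fst)
  | inr i => exact (continuous_apply i).comp (continuous_realPair.comp continuous_snd)

theorem continuous_conjPoint : Continuous (conjPoint (n := n)) :=
  continuous_pi fun _ => Complex.continuous_conj.comp (continuous_apply _)

theorem conjPoint_realPoint (z u : Fin n → ℂ) : conjPoint (realPoint z u) = realPoint z u := by
  ext i
  rcases i with (i | i) | (i | i) <;> simp [conjPoint, realPoint]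

theorem conjPoint_mem_critSet {p : QuadIdx n → ℂ} (hp : p ∈ critSet f c) :
    conjPoint p ∈ critSet f c := by
  obtain ⟨h1, h2, h3, h4⟩ := hp
  refine ⟨h2, ?_, ?_, ?_⟩
  · simpa [conjPoint] using h1
  · simpa [conjPoint] using h4
  · simpa [conjPoint] using h3

theorem eq_realPoint_of_conjPoint_eq {p : QuadIdx n → ℂ} {u : Fin n → ℂ} (hp : conjPoint p = p)
    (hu : p ∘ Sum.inr = realPair u) : p = realPoint (fun i => p (Sum.inl (Sum.inl i))) u := by
  ext i
  rcases i with (i | i) | i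
  · rfl
  · exact (congrFun hp (Sum.inl (Sum.inr i))).symm
  · exact congrFun hu i

/-- Over a generic point there are finitely many critical points, and each of them extends in a
unique way to a continuous family of critical points. -/
theorem exists_criticalPoint_sections (hprime : (idealX f).IsPrime)
    (hc : dimension (varX f) + (c : WithBot ℕ∞) = (n : WithBot ℕ∞)) :
    ∃ (N : ℕ) (g : RingZW n), g ≠ 0 ∧ ∀ u, MvPolynomial.eval (realPair u) g ≠ 0 →
      (criticalPoints f c u).encard ≤ N ∧ ∀ z ∈ criticalPoints f c u,
        ∃ ζ : (Fin n → ℂ) → (Fin n → ℂ), Filter.Tendsto ζ (𝓝 u) (𝓝 z) ∧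
          (∀ᶠ u' in 𝓝 u, ζ u' ∈ criticalPoints f c u') ∧
          ∀ᶠ p in 𝓝 z ×ˢ 𝓝 u, p.1 ∈ criticalPoints f c p.2 → p.1 = ζ p.2 := by
  obtain ⟨N, g, -, hg, hfib⟩ := exists_generic_number hprime hc
  refine ⟨N, g, hg, fun u hu => ?_⟩
  have hmemF : ∀ {z' u' : Fin n → ℂ}, z' ∈ criticalPoints f c u' →
      realPoint z' u' ∈ vHDFibre f c (realPair u') := fun {z' u'} hz' => by
    refine ⟨?_, rfl⟩
    rw [vHDCorrespondence_eq_zeroLocus hprime hc]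
    exact critSet_subset_zeroLocus (realPoint_mem_critSet_iff.2 hz')
  have hinj : ∀ u' : Fin n → ℂ, Function.Injective fun z' => realPoint z' u' := fun u' x y hxy =>
    funext fun i => congrFun hxy (Sum.inl (Sum.inl i))
  refine ⟨?_, fun z hz => ?_⟩
  · rw [← (hfib _ hu).1, ← (hinj u).encard_image]
    refine Set.encard_le_encard ?_
    rintro _ ⟨z', hz', rfl⟩
    exact hmemF hz'
  have hF : ∀ uv, vHDFibre f c uv =
      {p | p ∈ MvPolynomial.zeroLocus ℂ (critIdeal f c) ∧ p ∘ Sum.inr = uv} := fun uv => by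
    rw [vHDFibre, vHDCorrespondence_eq_zeroLocus hprime hc]
  have hgev : ∀ᶠ uv in 𝓝 (realPair u), MvPolynomial.eval uv g ≠ 0 :=
    (MvPolynomial.continuous_eval g).continuousAt.eventually_ne hu
  obtain ⟨x, hxlim, hx⟩ := exists_local_sections (isPrime_critIdeal hprime hc)
    (eq_zero_of_rename_mem_critIdeal hprime hc) (t₀ := realPair u) (N := N) (by
      filter_upwards [hgev] with uv huv
      rw [← hF]
      exact (hfib uv huv).1)
  set p := realPoint z u with hp
  have hpF : p ∈ vHDFibre f c (realPair u) := hmemF hz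
  have hpI : p ∈ MvPolynomial.zeroLocus ℂ (critIdeal f c) := by rw [hF] at hpF; exact hpF.1
  have hfin : (vHDFibre f c (realPair u)).Finite := Set.finite_of_encard_eq_coe (hfib _ hu).1
  -- The radius `δ` separates `p` from the other points of its finite fibre.
  obtain ⟨δ, hδ, hball⟩ := Metric.isOpen_iff.1
    ((hfin.subset (Set.sdiff_subset (t := {p}))).isClosed.isOpen_compl) p (by simp)
  have hsep : ∀ᶠ t in 𝓝 (realPair u), ∀ q ∈ vHDFibre f c (realPair u), q ≠ p →
      δ / 2 < dist (x q t) p := by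
    refine (Filter.eventually_all_finite hfin).2 fun q hq => ?_
    by_cases hqp : q = p
    · exact .of_forall fun _ h => absurd hqp h
    have hd : δ ≤ dist q p := by
      by_contra hlt
      exact hball (Metric.mem_ball.2 (not_le.1 hlt)) ⟨hq, hqp⟩
    have hq' := hq
    rw [hF] at hq'
    filter_upwards [(hxlim q hq'.1 hq'.2).eventually (Metric.ball_mem_nhds q (half_pos hδ))]
      with t ht _
    have h1 := dist_triangle q (x q t) p
    have ht' : dist q (x q t) < δ / 2 := by rw [dist_comm]; exact ht
    linarith
  have huniq : ∀ᶠ t in 𝓝 (realPair u), ∀ q ∈ vHDFibre f c t, dist q p < δ / 2 → q = x p t := by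
    filter_upwards [hx, hsep] with t ht1 ht2 q hq hqp
    rw [hF] at hq
    obtain ⟨p', hp'I, hp't, rfl⟩ := ht1.2 q hq.1 hq.2
    by_cases hpp : p' = p
    · rw [hpp]
    · have := ht2 p' (by rw [hF]; exact ⟨hp'I, hp't⟩) hpp
      linarith
  have hxp : Filter.Tendsto (fun u' => x p (realPair u')) (𝓝 u) (𝓝 p) :=
    (hxlim p hpI rfl).comp (continuous_realPair.tendsto u)
  have hcx : Filter.Tendsto (fun u' => conjPoint (x p (realPair u'))) (𝓝 u) (𝓝 p) := by
    have := (continuous_conjPoint.tendsto p).comp hxp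
    rwa [hp, conjPoint_realPoint, ← hp] at this
  refine ⟨fun u' i => x p (realPair u') (Sum.inl (Sum.inl i)), ?_, ?_, ?_⟩
  · exact tendsto_pi_nhds.2 fun i => ((continuous_apply (Sum.inl (Sum.inl i))).tendsto p).comp hxp
  · have hcont := continuous_realPair.tendsto u
    filter_upwards [hcont.eventually hgev, hcont.eventually hx, hcont.eventually huniq,
      hcx.eventually (Metric.ball_mem_nhds p (half_pos hδ))] with u' h1 h2 h3 h4
    obtain ⟨h5, h6⟩ := h2.1 p hpI rfl
    have h7 : x p (realPair u') ∈ critSet f c :=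
      (hfib _ h1).2 (by rw [hF]; exact ⟨h5, h6⟩)
    -- The involution preserves the fibre over a real pair and fixes `p`, so it moves the section to
    -- a fibre point near `p`; by uniqueness the section is real and consists of critical points.
    have h8 : conjPoint (x p (realPair u')) = x p (realPair u') := by
      refine h3 _ ?_ h4
      rw [hF]
      refine ⟨critSet_subset_zeroLocus (conjPoint_mem_critSet h7), funext fun i => ?_⟩
      change starRingEnd ℂ ((x p (realPair u') ∘ Sum.inr) (Sum.swap i)) = _
      rw [h6]
      cases i <;> simp [realPair]
    rw [eq_realPoint_of_conjPoint_eq h8 h6] at h7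
    exact realPoint_mem_critSet_iff.1 h7
  · have h1 : ∀ᶠ q in 𝓝 z ×ˢ 𝓝 u, dist (realPoint q.1 q.2) p < δ / 2 := by
      rw [← nhds_prod_eq]
      exact (continuous_realPoint.tendsto (z, u)).eventually (Metric.ball_mem_nhds p (half_pos hδ))
    have h2 := (continuous_realPair.tendsto u).eventually huniq
    filter_upwards [h1, h2.prod_inr (𝓝 z)] with q hq1 hq2 hqc
    have := hq2 _ (hmemF hqc) hq1
    rw [← this]
    rfl

theorem exists_realPair_eval_ne_zero {O : Set (Fin n → ℂ)} (hO : IsOpen O) (hne : O.Nonempty)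
    {q : RingZW n} (hq : q ≠ 0) : ∃ u ∈ O, MvPolynomial.eval (realPair u) q ≠ 0 :=
  exists_eval_conj_ne_zero hO hne hq

/-- Take a generic `u₀` with the largest number of critical points. Its critical points persist and
stay distinct nearby, and by maximality no further ones appear. -/
theorem HD_nonempty (hprime : (idealX f).IsPrime)
    (hc : dimension (varX f) + (c : WithBot ℕ∞) = (n : WithBot ℕ∞)) : (HD f c).Nonempty := by
  obtain ⟨N, g, hg, hsec⟩ := exists_criticalPoint_sections hprime hc
  let G : Set (Fin n → ℂ) := {u | MvPolynomial.eval (realPair u) g ≠ 0}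
  have hGopen : IsOpen G := isOpen_ne_fun
    ((MvPolynomial.continuous_eval g).comp continuous_realPair) continuous_const
  obtain ⟨u₁, -, hu₁⟩ := exists_realPair_eval_ne_zero isOpen_univ Set.univ_nonempty hg
  let S : Set ℕ := {m | ∃ u ∈ G, (criticalPoints f c u).encard = m}
  have hnat : ∀ u ∈ G, ∃ m : ℕ, (criticalPoints f c u).encard = m ∧ m ≤ N := fun u hu => by
    have h := (hsec u hu).1
    obtain ⟨m, hm⟩ := ENat.ne_top_iff_exists.1 (ne_top_of_le_ne_top (ENat.natCast_ne_top N) h)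
    refine ⟨m, hm.symm, ?_⟩
    rw [← hm] at h
    exact_mod_cast h
  have hSne : S.Nonempty := by
    obtain ⟨m, hm, -⟩ := hnat u₁ hu₁
    exact ⟨m, u₁, hu₁, hm⟩
  have hSbdd : BddAbove S := by
    refine ⟨N, ?_⟩
    rintro m ⟨u, hu, hm⟩
    obtain ⟨m', hm', hle⟩ := hnat u hu
    rw [hm] at hm'
    have : m = m' := by exact_mod_cast hm'
    omega
  obtain ⟨u₀, hu₀, hM⟩ := Nat.sSup_mem hSne hSbdd
  have hfin : (criticalPoints f c u₀).Finite := Set.finite_of_encard_eq_coe hM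
  have hζ : ∀ z, ∃ ζ : (Fin n → ℂ) → (Fin n → ℂ), z ∈ criticalPoints f c u₀ →
      Filter.Tendsto ζ (𝓝 u₀) (𝓝 z) ∧ ∀ᶠ u' in 𝓝 u₀, ζ u' ∈ criticalPoints f c u' := fun z => by
    by_cases hz : z ∈ criticalPoints f c u₀
    · obtain ⟨ζ, h1, h2, -⟩ := (hsec u₀ hu₀).2 z hz
      exact ⟨ζ, fun _ => ⟨h1, h2⟩⟩
    · exact ⟨fun _ => z, fun h => absurd h hz⟩
  choose ζ hζ using hζ
  have h1 : ∀ᶠ u in 𝓝 u₀, ∀ z ∈ criticalPoints f c u₀, ζ z u ∈ criticalPoints f c u :=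
    (Filter.eventually_all_finite hfin).2 fun z hz => (hζ z hz).2
  have h2 : ∀ᶠ u in 𝓝 u₀, ∀ y ∈ criticalPoints f c u₀, ∀ z ∈ criticalPoints f c u₀,
      ζ y u = ζ z u → y = z := by
    refine (Filter.eventually_all_finite hfin).2 fun y hy =>
      (Filter.eventually_all_finite hfin).2 fun z hz => ?_
    by_cases hyz : y = z
    · exact .of_forall fun _ _ => hyz
    · filter_upwards [((hζ y hy).1.prodMk_nhds (hζ z hz).1).eventually
        ((isOpen_ne_fun continuous_fst continuous_snd).mem_nhds hyz)] with t ht h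
      exact absurd h ht
  have h3 : ∀ᶠ u in 𝓝 u₀, (criticalPoints f c u).encard = (sSup S : ℕ) := by
    filter_upwards [h1, h2, hGopen.mem_nhds hu₀] with u hu1 hu2 huG
    apply le_antisymm
    · obtain ⟨m, hm, -⟩ := hnat u huG
      rw [hm]
      exact_mod_cast le_csSup hSbdd ⟨u, huG, hm⟩
    · rw [← hM, ← Set.InjOn.encard_image (f := fun z => ζ z u) fun y hy z hz h => hu2 y hy z hz h]
      refine Set.encard_le_encard ?_
      rintro _ ⟨z, hz, rfl⟩
      exact hu1 z hz
  obtain ⟨O, hO, hOopen, huO⟩ := eventually_nhds_iff.1 h3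
  exact ⟨_, O, hOopen, ⟨u₀, huO⟩, hO⟩

end CriticalSections

/-! ## Nearest points are generically regular -/

section NearestRegular

variable {n : ℕ}

theorem sqDist_eq (u x z : Fin n → ℂ) :
    sqDist u x = sqDist u z - 2 * (∑ i, starRingEnd ℂ (u i - z i) * (x i - z i)).re +
      sqDist x z := by
  simp only [sqDist, Complex.re_sum, Finset.mul_sum, ← Finset.sum_sub_distrib,
    ← Finset.sum_add_distrib]
  refine Finset.sum_congr rfl fun i _ => ?_
  simp only [Complex.sq_norm, Complex.normSq_apply, Complex.sub_re, Complex.sub_im,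
    Complex.mul_re, Complex.conj_re, Complex.conj_im]
  ring

theorem sqDist_nonneg (u z : Fin n → ℂ) : 0 ≤ sqDist u z :=
  Finset.sum_nonneg fun i _ => by positivity

theorem eq_of_sqDist_le_zero {u z : Fin n → ℂ} (h : sqDist u z ≤ 0) : u = z := by
  have h1 := (sq_norm_sub_le_sqDist u z).trans h
  have h2 : ‖u - z‖ = 0 := by
    have := le_antisymm h1 (by positivity)
    exact eq_zero_of_pow_eq_zero this
  exact sub_eq_zero.1 (norm_eq_zero.1 h2)

/-- Moving towards a nearest point makes it the only nearest point. -/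
theorem IsNearest.eq_of_sqDist_le {X : Set (Fin n → ℂ)} {u z x : Fin n → ℂ}
    (hz : IsNearest X u z) {t : ℝ} (ht0 : 0 ≤ t) (ht1 : t < 1) (hx : x ∈ X)
    (h : sqDist (z + (t : ℂ) • (u - z)) x ≤ sqDist (z + (t : ℂ) • (u - z)) z) : x = z := by
  apply eq_of_sqDist_le_zero
  have h1 := hz.2 x hx
  rw [sqDist_eq u x z] at h1
  rw [sqDist_eq _ x z] at h
  have h2 : ∑ i, starRingEnd ℂ ((z + (t : ℂ) • (u - z)) i - z i) * (x i - z i) =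
      t * ∑ i, starRingEnd ℂ (u i - z i) * (x i - z i) := by
    rw [Finset.mul_sum]
    refine Finset.sum_congr rfl fun i _ => ?_
    simp only [Pi.add_apply, Pi.smul_apply, Pi.sub_apply, smul_eq_mul, add_sub_cancel_left,
      map_mul, Complex.conj_ofReal, mul_assoc]
  rw [h2, Complex.re_ofReal_mul] at h
  -- With `a` the real part of the sum and `q = sqDist x z`: from `2a ≤ q` and `q ≤ 2ta` follows `(1
  -- - t)q ≤ 0`.
  nlinarith

theorem IsNearest.segment {X : Set (Fin n → ℂ)} {u z : Fin n → ℂ}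
    (hz : IsNearest X u z) {t : ℝ} (ht0 : 0 ≤ t) (ht1 : t < 1) :
    IsNearest X (z + (t : ℂ) • (u - z)) z := by
  refine ⟨hz.1, fun x hx => ?_⟩
  by_contra! h
  rw [hz.eq_of_sqDist_le ht0 ht1 hx h.le] at h
  exact lt_irrefl _ h

/-- Nearest points to a convergent sequence stay bounded, and a limit of a subsequence of them is
again a nearest point. -/
theorem isClosed_setOf_isNearest {X Y : Set (Fin n → ℂ)} (hX : IsClosed X) (hY : IsClosed Y) :
    IsClosed {u | ∃ z ∈ Y, IsNearest X u z} := by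
  refine IsSeqClosed.isClosed fun u u₀ hu hlim => ?_
  choose z hzY hz using hu
  have hbdd : Bornology.IsBounded (Set.range z) := by
    obtain ⟨R, hR⟩ := (Metric.isBounded_range_of_tendsto u hlim).exists_norm_le
    have hcont : Continuous fun u => sqDist u (z 0) :=
      continuous_sqDist.comp (by fun_prop : Continuous fun u : Fin n → ℂ => (u, z 0))
    obtain ⟨C, hC⟩ := (Metric.isBounded_range_of_tendsto _
      ((hcont.tendsto u₀).comp hlim)).exists_norm_le
    have hC0 : 0 ≤ C := (norm_nonneg _).trans (hC _ ⟨0, rfl⟩)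
    refine (isBounded_iff_forall_norm_le).2 ⟨R + (C + 1), ?_⟩
    rintro _ ⟨k, rfl⟩
    have h1 : sqDist (u k) (z k) ≤ C :=
      ((hz k).2 _ (hz 0).1).trans ((le_abs_self _).trans (hC _ ⟨k, rfl⟩))
    have h2 := (sq_norm_sub_le_sqDist (u k) (z k)).trans h1
    have h3 : ‖u k - z k‖ ≤ C + 1 := by nlinarith [norm_nonneg (u k - z k)]
    have h4 := norm_sub_norm_le (z k) (u k)
    rw [norm_sub_rev] at h4
    have h5 := hR _ ⟨k, rfl⟩
    linarith
  obtain ⟨z₀, -, φ, hφ, hzlim⟩ := tendsto_subseq_of_bounded hbdd (fun k => Set.mem_range_self k)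
  have hulim := hlim.comp hφ.tendsto_atTop
  refine ⟨z₀, hY.mem_of_tendsto hzlim (.of_forall fun k => hzY _),
    hX.mem_of_tendsto hzlim (.of_forall fun k => (hz _).1), fun x hx => ?_⟩
  refine le_of_tendsto_of_tendsto ((continuous_sqDist.tendsto (u₀, z₀)).comp
    (hulim.prodMk_nhds hzlim)) ((continuous_sqDist.tendsto (u₀, x)).comp
    (hulim.prodMk_nhds tendsto_const_nhds)) (.of_forall fun k => (hz _).2 x hx)

/-- Nearest points to points close to `u` are close to `z`, the only point nearest to `u`. -/
theorem eventually_isNearest_imp {X : Set (Fin n → ℂ)} (hX : IsClosed X) {u z : Fin n → ℂ}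
    (hz : ∀ x, IsNearest X u x → x = z) {P : (Fin n → ℂ) → Prop} (hP : ∀ᶠ x in 𝓝 z, P x) :
    ∀ᶠ u' in 𝓝 u, ∀ x, IsNearest X u' x → P x := by
  obtain ⟨W, hW, hWopen, hzW⟩ := eventually_nhds_iff.1 hP
  have h := isClosed_setOf_isNearest hX hWopen.isClosed_compl
  have hu : u ∉ {u | ∃ z ∈ Wᶜ, IsNearest X u z} := by
    rintro ⟨x, hxW, hx⟩
    exact hxW (hz x hx ▸ hzW)
  filter_upwards [h.isOpen_compl.mem_nhds hu] with u' hu' x hx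
  by_contra hPx
  exact hu' ⟨x, fun hxW => hPx (hW x hxW), hx⟩

/-- Nearest points over `O` are critical for the smaller variety, and over a generic `u` these are
locally unique. A translation of `u` normal to that variety keeps `z` critical, so the nearest point
to the translate, which is close to `z`, must be `z`. -/
theorem exists_stable_nearest {s : ℕ} {y : Fin s → RingZ n} {c : ℕ} (hprime : (idealX y).IsPrime)
    (hc : dimension (varX y) + (c : WithBot ℕ∞) = (n : WithBot ℕ∞)) {X : Set (Fin n → ℂ)}
    (hX : IsClosed X) (hYX : varX y ⊆ X) {O : Set (Fin n → ℂ)} (hO : IsOpen O) (hne : O.Nonempty)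
    (hnear : ∀ u ∈ O, ∃ z ∈ varX y, IsNearest X u z)
    (hsing : ∀ u ∈ O, ∀ z ∈ MvPolynomial.zeroLocus ℂ (singIdeal y c), ¬ IsNearest X u z) :
    ∃ u, ∃ z ∈ regX y c,
      ∀ᶠ x in 𝓝 z, x ∈ X → (fun i => starRingEnd ℂ (x i - z i)) ∈ normalSpace y z →
        sqDist (u + (x - z)) z ≤ sqDist (u + (x - z)) x := by
  obtain ⟨N, g, hg, hsec⟩ := exists_criticalPoint_sections hprime hc
  have hcrit : ∀ u ∈ O, ∀ z ∈ varX y, IsNearest X u z → z ∈ criticalPoints y c u :=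
    fun u hu z hzY hz => IsNearest.mem_criticalPoints hprime hc
      ⟨hzY, fun x hx => hz.2 x (hYX hx)⟩
      ((mem_regX_iff y c).1 ⟨hzY, fun h => hsing u hu z h hz⟩).2
  obtain ⟨u₀, hu₀, hgu₀⟩ := exists_realPair_eval_ne_zero hO hne hg
  obtain ⟨z, hzY, hz⟩ := hnear u₀ hu₀
  -- Moving `u₀` slightly towards `z` makes `z` the only nearest point while the openness conditions
  -- persist.
  have hline : Filter.Tendsto (fun t : ℝ => z + (t : ℂ) • (u₀ - z)) (𝓝[<] 1) (𝓝 u₀) := by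
    have : Continuous fun t : ℝ => z + (t : ℂ) • (u₀ - z) := by fun_prop
    have h := this.tendsto 1
    simp only [Complex.ofReal_one, one_smul, add_sub_cancel] at h
    exact h.mono_left nhdsWithin_le_nhds
  have hgcont : Continuous fun u : Fin n → ℂ => MvPolynomial.eval (realPair u) g :=
    (MvPolynomial.continuous_eval g).comp continuous_realPair
  obtain ⟨t, ⟨⟨htO, htg⟩, ht0⟩, ht1⟩ := (((hline.eventually (hO.mem_nhds hu₀)).and
    (hline.eventually (hgcont.continuousAt.eventually_ne hgu₀))).and
    (nhdsWithin_le_nhds (lt_mem_nhds (zero_lt_one' ℝ)))).and self_mem_nhdsWithin |>.exists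
  set u := z + (t : ℂ) • (u₀ - z) with hu
  have hzu : IsNearest X u z := hz.segment ht0.le ht1
  have huniq : ∀ x, IsNearest X u x → x = z := fun x hx =>
    hz.eq_of_sqDist_le ht0.le ht1 hx.1 (hx.2 z hz.1)
  have hzc := hcrit u htO z hzY hzu
  obtain ⟨ζ, -, -, hζ⟩ := (hsec u htg).2 z hzc
  obtain ⟨P, hP, Q, hQ, hPQ⟩ := Filter.eventually_prod_iff.1 hζ
  obtain ⟨hzreg, hzn⟩ := mem_criticalPoints_iff.1 hzc
  refine ⟨u, z, hzreg, ?_⟩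
  have hshift : Filter.Tendsto (fun x : Fin n → ℂ => u + (x - z)) (𝓝 z) (𝓝 u) := by
    have : Continuous fun x : Fin n → ℂ => u + (x - z) := by fun_prop
    simpa using this.tendsto z
  filter_upwards [hshift.eventually hQ, hshift.eventually (hO.mem_nhds htO),
    hshift.eventually (eventually_isNearest_imp hX huniq hP)] with x hxQ hxO hxP hxX hxn
  have h1 : z ∈ criticalPoints y c (u + (x - z)) := by
    refine mem_criticalPoints_iff.2 ⟨hzreg, ?_⟩
    have := (normalSpace y z).add_mem hzn hxn
    convert this using 1
    ext i
    simp only [Pi.add_apply, Pi.sub_apply, ← map_add]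
    congr 1
    ring
  obtain ⟨z', hz'Y, hz'⟩ := hnear _ hxO
  have e1 := hPQ hP.self_of_nhds hxQ h1
  have e2 := hPQ (hxP z' hz') hxQ (hcrit _ hxO z' hz'Y hz')
  have e3 : z' = z := e2.trans e1.symm
  rw [e3] at hz'
  exact hz'.2 x hxX

theorem false_of_stable_nearest {s r : ℕ} {f : Fin r → RingZ n} {y : Fin s → RingZ n} {c d e : ℕ}
    (hf : (idealX f).IsPrime) (hd : Algebra.trdeg ℂ (RingZ n ⧸ idealX f) = d)
    (hprime : (idealX y).IsPrime)
    (hc : dimension (varX y) + (c : WithBot ℕ∞) = (n : WithBot ℕ∞))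
    (he : e + c = n) (hed : e + 1 ≤ d) {u z : Fin n → ℂ} (hzX : z ∈ varX f) (hz : z ∈ regX y c)
    (hnear : ∀ᶠ x in 𝓝 z, x ∈ varX f →
      (fun i => starRingEnd ℂ (x i - z i)) ∈ normalSpace y z →
        sqDist (u + (x - z)) z ≤ sqDist (u + (x - z)) x) : False := by
  let ℓ : (Fin n → ℂ) → ℂ := fun x => ∑ i, starRingEnd ℂ (u i - z i) * x i
  have hnear' : ∀ᶠ x in 𝓝 z, x ∈ varX f →
      (fun i => starRingEnd ℂ (x i - z i)) ∈ normalSpace y z →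
        2 * (ℓ x - ℓ z).re + sqDist x z ≤ 0 := by
    filter_upwards [hnear] with x hx hxX hxn
    have h1 := hx hxX hxn
    rw [sqDist_eq _ x z] at h1
    have h2 : (∑ i, starRingEnd ℂ ((u + (x - z)) i - z i) * (x i - z i)).re =
        (ℓ x - ℓ z).re + sqDist x z := by
      simp only [ℓ, sqDist, Complex.sub_re, Complex.re_sum, ← Finset.sum_sub_distrib,
        ← Finset.sum_add_distrib]
      refine Finset.sum_congr rfl fun i _ => ?_
      simp only [Complex.sq_norm, Complex.normSq_apply, Complex.sub_re, Complex.sub_im,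
        Complex.mul_re, Complex.conj_re, Complex.conj_im, Pi.add_apply, Pi.sub_apply,
        Complex.add_re, Complex.add_im]
      ring
    rw [h2] at h1
    linarith
  let T := LinearMap.ker (jacAt y z).mulVecLin
  let b := Module.finBasis ℂ T
  have hrank : (jacAt y z).rank = c :=
    le_antisymm (rank_jacAt_le hprime hc hz.1) ((mem_regX_iff y c).1 hz).2
  have hT : Module.finrank ℂ T = e := by
    have h2 := (jacAt y z).mulVecLin.finrank_range_add_finrank_ker
    rw [Module.finrank_fintype_fun_eq_card, Fintype.card_fin] at h2
    have h3 : (jacAt y z).rank = Module.finrank ℂ (LinearMap.range (jacAt y z).mulVecLin) := rfl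
    have h4 : Module.finrank ℂ T = Module.finrank ℂ (LinearMap.ker (jacAt y z).mulVecLin) := rfl
    omega
  -- Pairings with the conjugates of a tangent basis, which are polynomial in `x`; their level
  -- through `z` is the normal slice. The last function is `ℓ`.
  let g : Fin (Module.finrank ℂ T) ⊕ Unit → RingZ n := Sum.elim
    (fun k => ∑ i, MvPolynomial.C (starRingEnd ℂ ((b k : Fin n → ℂ) i)) * MvPolynomial.X i)
    (fun _ => ∑ i, MvPolynomial.C (starRingEnd ℂ (u i - z i)) * MvPolynomial.X i)
  have hg2 : ∀ x, MvPolynomial.eval x (g (Sum.inr ())) = ℓ x := fun x => by simp [g, ℓ]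
  have hg1 : ∀ x, (∀ k, MvPolynomial.eval x (g (Sum.inl k)) =
      MvPolynomial.eval z (g (Sum.inl k))) →
        (fun i => starRingEnd ℂ (x i - z i)) ∈ normalSpace y z := by
    intro x hx
    rw [mem_normalSpace_iff]
    intro t ht
    let φ : T →ₗ[ℂ] ℂ := (∑ i, starRingEnd ℂ (x i - z i) • LinearMap.proj i).comp T.subtype
    have hφ : φ = 0 := b.ext fun k => by
      have h1 := congrArg (starRingEnd ℂ) (sub_eq_zero.2 (hx k))
      simp only [g, Sum.elim_inl, map_sum, map_mul, MvPolynomial.eval_C, MvPolynomial.eval_X,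
        map_sub, Complex.conj_conj, map_zero] at h1
      rw [← Finset.sum_sub_distrib] at h1
      simp only [φ, LinearMap.comp_apply, LinearMap.sum_apply, LinearMap.smul_apply,
        LinearMap.proj_apply, smul_eq_mul, LinearMap.zero_apply, Submodule.subtype_apply]
      rw [← h1]
      exact Finset.sum_congr rfl fun i _ => by rw [map_sub]; ring
    have := LinearMap.congr_fun hφ ⟨t, ht⟩
    simpa [φ] using this
  have hiso : ∀ᶠ x in 𝓝 z, x ∈ MvPolynomial.zeroLocus ℂ (idealX f) →
      (∀ i, MvPolynomial.eval x (g i) = MvPolynomial.eval z (g i)) → x = z := by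
    filter_upwards [hnear'] with x hx hxX hxg
    have h1 := hx hxX (hg1 x fun k => hxg _)
    have h2 := hxg (Sum.inr ())
    rw [hg2, hg2] at h2
    rw [h2, sub_self, Complex.zero_re, mul_zero, zero_add] at h1
    exact eq_of_sqDist_le_zero h1
  obtain ⟨-, hsec⟩ := trdeg_le_and_exists_section hf g hzX hiso
  obtain ⟨x, hxX, hx, hxlim⟩ := hsec (by
    rw [hd, Nat.card_sum, Nat.card_fin, Nat.card_unique, hT]
    exact_mod_cast hed)
  set t₀ : Fin (Module.finrank ℂ T) ⊕ Unit → ℂ := fun i => MvPolynomial.eval z (g i) with ht₀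
  have hline : Filter.Tendsto (fun ε : ℝ => t₀ + (ε : ℂ) • Pi.single (Sum.inr ()) (1 : ℂ))
      (𝓝[>] 0) (𝓝 t₀) := by
    have : Continuous fun ε : ℝ => t₀ + (ε : ℂ) • Pi.single (Sum.inr ()) (1 : ℂ) := by fun_prop
    have h := this.tendsto 0
    simp only [Complex.ofReal_zero, zero_smul, add_zero] at h
    exact h.mono_left nhdsWithin_le_nhds
  -- Raising `ℓ` alone by a small `ε > 0` gives a point `p` of the slice with `2ε + |p - z|² ≤ 0`.
  obtain ⟨ε, ⟨h1, h2⟩, hε⟩ := (((hline.eventually hx).and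
    ((hxlim.comp hline).eventually hnear')).and self_mem_nhdsWithin).exists
  have hε' : (0 : ℝ) < ε := hε
  simp only [Function.comp_apply] at h2
  have hpX := hxX (t₀ + (ε : ℂ) • Pi.single (Sum.inr ()) (1 : ℂ))
  generalize x (t₀ + (ε : ℂ) • Pi.single (Sum.inr ()) (1 : ℂ)) = p at h1 h2 hpX
  have h3 := h2 hpX (hg1 p fun k => by rw [h1]; simp [ht₀])
  have h4 : ℓ p = ℓ z + ε := by
    rw [← hg2, ← hg2, h1]; simp [ht₀]
  rw [h4, add_sub_cancel_left, Complex.ofReal_re] at h3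
  linarith [sqDist_nonneg p z]

theorem exists_codim {I : Ideal (RingZ n)} (hI : I.IsPrime) :
    ∃ (s : ℕ) (y : Fin s → RingZ n) (e c : ℕ), idealX y = I ∧
      dimension (varX y) + (c : WithBot ℕ∞) = (n : WithBot ℕ∞) ∧ e + c = n ∧
      ringKrullDim (RingZ n ⧸ I) = e := by
  obtain ⟨s, y, hy⟩ := Submodule.fg_iff_exists_fin_generating_family.1
    (IsNoetherian.noetherian I)
  obtain ⟨e, he, htr⟩ := exists_ringKrullDim_eq_trdeg ℂ (RingZ n ⧸ I)
  have hle : e ≤ n := by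
    have h := trdeg_le_of_surjective (Ideal.Quotient.mkₐ ℂ I) (Ideal.Quotient.mkₐ_surjective ℂ I)
    rw [MvPolynomial.trdeg_of_isDomain, htr, Cardinal.lift_id, Cardinal.mk_fin] at h
    exact_mod_cast h
  refine ⟨s, y, e, n - e, hy, ?_, by omega, he⟩
  rw [dimension, varX, show idealX y = I from hy, MvPolynomial.IsPrime.vanishingIdeal_zeroLocus, he]
  norm_cast
  omega

theorem isClosed_zeroLocus {σ : Type} (I : Ideal (MvPolynomial σ ℂ)) :
    IsClosed (MvPolynomial.zeroLocus ℂ I) := by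
  have : MvPolynomial.zeroLocus ℂ I = ⋂ p ∈ I, {x | MvPolynomial.eval x p = 0} := by
    ext x; simp [MvPolynomial.mem_zeroLocus_iff, MvPolynomial.aeval_eq_eval]
  rw [this]
  exact isClosed_biInter fun p _ => isClosed_eq (MvPolynomial.continuous_eval _) continuous_const

/-- The points that have a nearest point of `X` in a given proper subvariety form a set with empty
interior. -/
theorem interior_setOf_isNearest_eq_empty {s : ℕ} {f : Fin s → RingZ n}
    (hf : (idealX f).IsPrime) (I : Ideal (RingZ n)) (hI : idealX f < I) :
    interior {u | ∃ z ∈ MvPolynomial.zeroLocus ℂ I, IsNearest (varX f) u z} = ∅ := by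
  induction I using IsNoetherian.induction with
  | hgt I ih =>
  by_cases hprime : Ideal.IsPrime I
  · obtain ⟨r, y, e, c, rfl, hc, hec, he⟩ := exists_codim hprime
    obtain ⟨d, hd, hdtr⟩ := exists_ringKrullDim_eq_trdeg ℂ (RingZ n ⧸ idealX f)
    -- A nonzero element of the domain dies in the quotient, so the dimension drops.
    have hed : e + 1 ≤ d := by
      obtain ⟨q, hqI, hq⟩ := SetLike.exists_of_lt hI
      have h := ringKrullDim_succ_le_of_surjective (Ideal.Quotient.factor hI.le)
        (Ideal.Quotient.factor_surjective hI.le) (r := Ideal.Quotient.mk _ q)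
        (mem_nonZeroDivisors_of_ne_zero (by rwa [Ne, Ideal.Quotient.eq_zero_iff_mem]))
        (by rw [Ideal.Quotient.factor_mk, Ideal.Quotient.eq_zero_iff_mem]; exact hqI)
      rw [he, hd] at h
      exact_mod_cast h
    have hlt : idealX y < singIdeal y c := by
      refine lt_of_le_of_ne le_sup_left fun h => ?_
      obtain ⟨a, b, hab⟩ := exists_minor_notMem hprime hc
      refine hab (h ▸ ?_)
      exact Ideal.mem_sup_right (Ideal.subset_span ⟨a, b, rfl⟩)
    have hYX : varX y ⊆ varX f := MvPolynomial.zeroLocus_anti_mono hI.le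
    by_contra hne
    set B := {u | ∃ z ∈ MvPolynomial.zeroLocus ℂ (idealX y), IsNearest (varX f) u z}
    set S := {u | ∃ z ∈ MvPolynomial.zeroLocus ℂ (singIdeal y c), IsNearest (varX f) u z} with hS
    -- The singular locus is cut out by a larger ideal, so the induction lets it be discarded.
    have hSint : interior S = ∅ := ih _ hlt (hI.trans hlt)
    have hSclosed : IsClosed S := isClosed_setOf_isNearest (isClosed_varX f) (isClosed_zeroLocus _)
    have hOne : (interior B \ S).Nonempty := by
      by_contra hemp
      rw [Set.not_nonempty_iff_eq_empty, Set.sdiff_eq_empty] at hemp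
      have := interior_maximal hemp isOpen_interior
      rw [hSint, Set.subset_empty_iff] at this
      exact hne this
    obtain ⟨u, z, hz, hst⟩ := exists_stable_nearest hprime hc (isClosed_varX f) hYX
      (isOpen_interior.sdiff hSclosed) hOne (fun u hu => (interior_subset hu.1 : u ∈ B))
      (fun u hu z hz hnear => hu.2 ⟨z, hz, hnear⟩)
    exact false_of_stable_nearest hf hdtr hprime hc hec hed (hYX hz.1) hz hst
  · by_cases htop : I = ⊤
    · have : {u | ∃ z ∈ MvPolynomial.zeroLocus ℂ I, IsNearest (varX f) u z} = ∅ := by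
        simp [htop]
      rw [this, interior_empty]
    · obtain ⟨a, b, hab, ha, hb⟩ : ∃ a b, a * b ∈ I ∧ a ∉ I ∧ b ∉ I := by
        by_contra! hcon
        refine hprime ⟨htop, fun {a b} hab => ?_⟩
        by_cases ha : a ∈ I
        · exact Or.inl ha
        · exact Or.inr (hcon a b hab ha)
      have hlt : ∀ q ∉ I, I < I ⊔ Ideal.span {q} := fun q hq =>
        lt_of_le_of_ne le_sup_left fun h => hq (by
          rw [h]; exact Ideal.mem_sup_right (Ideal.mem_span_singleton_self q))
      have hmem : ∀ (q : RingZ n) (z : Fin n → ℂ), z ∈ MvPolynomial.zeroLocus ℂ I →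
          MvPolynomial.eval z q = 0 → z ∈ MvPolynomial.zeroLocus ℂ (I ⊔ Ideal.span {q}) := by
        intro q z hz hq
        rw [mem_zeroLocus_iff_le_ker, sup_le_iff, Ideal.span_singleton_le_iff_mem]
        exact ⟨mem_zeroLocus_iff_le_ker.1 hz, hq⟩
      have hsub : {u | ∃ z ∈ MvPolynomial.zeroLocus ℂ I, IsNearest (varX f) u z} ⊆
          {u | ∃ z ∈ MvPolynomial.zeroLocus ℂ (I ⊔ Ideal.span {a}), IsNearest (varX f) u z} ∪
          {u | ∃ z ∈ MvPolynomial.zeroLocus ℂ (I ⊔ Ideal.span {b}), IsNearest (varX f) u z} := by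
        rintro u ⟨z, hz, hu⟩
        have h : MvPolynomial.eval z (a * b) = 0 := mem_zeroLocus_iff_le_ker.1 hz hab
        rw [map_mul, mul_eq_zero] at h
        rcases h with h | h
        · exact Or.inl ⟨z, hmem a z hz h, hu⟩
        · exact Or.inr ⟨z, hmem b z hz h, hu⟩
      refine Set.subset_empty_iff.1 ((interior_mono hsub).trans ?_)
      rw [interior_union_isClosed_of_interior_empty
        (isClosed_setOf_isNearest (isClosed_varX f) (isClosed_zeroLocus _))
        (ih _ (hlt b hb) (hI.trans (hlt b hb))), ih _ (hlt a ha) (hI.trans (hlt a ha))]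

/-- If `0` were in `HD(X)`, an open set of `u` would have no critical points. Some `u` in it has
only regular nearest points, and these are critical. -/
theorem sInf_HD_pos {s : ℕ} {f : Fin s → RingZ n} {c : ℕ} (hprime : (idealX f).IsPrime)
    (hc : dimension (varX f) + (c : WithBot ℕ∞) = (n : WithBot ℕ∞)) : 0 < sInf (HD f c) := by
  rw [Nat.pos_iff_ne_zero]
  intro h0
  have hmem := Nat.sInf_mem (HD_nonempty hprime hc)
  rw [h0] at hmem
  obtain ⟨O, hO, hOne, hcrit⟩ := hmem
  have hlt : idealX f < singIdeal f c := by
    refine lt_of_le_of_ne le_sup_left fun h => ?_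
    obtain ⟨a, b, hab⟩ := exists_minor_notMem hprime hc
    refine hab (h ▸ ?_)
    exact Ideal.mem_sup_right (Ideal.subset_span ⟨a, b, rfl⟩)
  have hint := interior_setOf_isNearest_eq_empty hprime (singIdeal f c) hlt
  obtain ⟨u, hu, hus⟩ : ∃ u ∈ O, ¬ ∃ z ∈ MvPolynomial.zeroLocus ℂ (singIdeal f c),
      IsNearest (varX f) u z := by
    by_contra! hcon
    have hO' : O ⊆ {u | ∃ z ∈ MvPolynomial.zeroLocus ℂ (singIdeal f c),
      IsNearest (varX f) u z} := hcon
    have hsub := interior_maximal hO' hO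
    rw [hint, Set.subset_empty_iff] at hsub
    exact hOne.ne_empty hsub
  obtain ⟨z₀, hz₀⟩ := regX_nonempty hprime hc
  obtain ⟨z, hz⟩ := exists_isNearest (isClosed_varX f) ⟨z₀, hz₀.1⟩ u
  have hzc : z ∈ criticalPoints f c u := hz.mem_criticalPoints hprime hc
    ((mem_regX_iff f c).1 ⟨hz.1, fun h => hus ⟨z, h, hz⟩⟩).2
  have h := hcrit u hu
  rw [Nat.cast_zero, Set.encard_eq_zero] at h
  rw [h] at hzc
  exact hzc

end NearestRegular

end HermitianDistance

theorem mainTheorem1 {n s : ℕ} (f : Fin s → MvPolynomial (Fin n) ℂ) (c : ℕ)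
    (hprime : (idealX f).IsPrime)
    (hc : dimension (varX f) + (c : WithBot ℕ∞) = (n : WithBot ℕ∞)) :
    -- the vHD correspondence lies over `X × X̄` and is an irreducible variety of dimension `2n`
    (∀ p ∈ vHDCorrespondence f c, p ∘ Sum.inl ∈ prodX f) ∧
    IsIrreducibleVariety (vHDCorrespondence f c) ∧
    dimension (vHDCorrespondence f c) = ((2 * n : ℕ) : WithBot ℕ∞) ∧
    -- the projection to `X × X̄` is over `X_∘` a vector bundle of rank `2c`, with zero section
    -- `(z, w) ↦ (z, w, z, w)`
    IsAlgebraicVectorBundle (prodReg f c) (vHDCorrespondenceReg f c) (fun zw => zw) (2 * c) ∧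
    -- the projection to `𝕍²` is dominant
    zariskiClosure ((fun p : QuadIdx n → ℂ => p ∘ Sum.inr) '' vHDCorrespondence f c) =
      Set.univ ∧
    -- `vHD(X)` is well defined, and it is the cardinality of the generic fibre
    IsGenericSolutionNumber f c (vHD f c) ∧
    (∃ U : Set (PairIdx n → ℂ), IsZariskiOpen U ∧ U.Nonempty ∧
      ∀ uv ∈ U, (vHDFibre f c uv).encard = (vHD f c : ℕ∞)) ∧
    -- the minimum of `HD(X)` exists and is positive
    (HD f c).Nonempty ∧ 0 < sInf (HD f c) :=
  ⟨fun _ hp => vHDCorrespondence_subset hp, isIrreducibleVariety_vHDCorrespondence hprime hc,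
    dimension_vHDCorrespondence hprime hc,
    isAlgebraicVectorBundle_vHDCorrespondenceReg hprime hc,
    zariskiClosure_image_vHDCorrespondence hprime hc, (isGenericSolutionNumber_vHD hprime hc).1,
    (isGenericSolutionNumber_vHD hprime hc).2, HD_nonempty hprime hc, sInf_HD_pos hprime hc⟩
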